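/- **Setting.** Let $G$ be a countable discrete group acting by measure preserving transformations, a.e. freely, on a $\sigma$-finite, countably separated (for instance standard) measure space $(\mathcal X,\nu)$. Let $\Gamma\subseteq G$ be an almost normal subgroup, i.e. $\Gamma_g:=\Gamma\cap g\Gamma g^{-1}$ has finite index in $\Gamma$ for every $g\in G$, and let $F\subseteq\mathcal X$ be a measurable fundamental domain of $\Gamma$ (up to null sets) with $\nu(F)<\infty$. (These hypotheses hold in particular for ergodic such actions on infinite measure spaces.) Let $\mathcal R_G|F$ be the orbit equivalence relation of $G$ restricted to $F$. For $g\in G$ and a.e. $x\in F$ let $\dot{\wideparen{\Gamma g}}\,x$ be the unique point of $F\cap\Gamma gx$; it depends only on the coset $\Gamma g$. We denote by the same symbol the operator on $L^2(F,\nu)$ given by $(\dot{\wideparen{\Gamma g}}\,\xi)(y)=\sum_{x\in F,\ \dot{\wideparen{\Gamma g}}x=y}\xi(x)$. Let $\mathcal L$ be the lattice of subgroups of $\Gamma$ generated by the groups $\Gamma_\sigma$, $\sigma\in G$. Let $\mathcal B$ be the Borel algebra of the relation: the smallest $\sigma$-algebra of subsets of $F$ that contains the null sets and all the sets $\{x\in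 F: rgx\in\Gamma_{h^{-1}}F\}$ ($g,h\in G$, $r\in\Gamma$), and is invariant under images and preimages by the transformations $\dot{\wideparen{\Gamma g}}$ restricted to $\{x\in F: gx\in\Gamma_g\alpha F\}$ ($\alpha\in\Gamma$), on which they are injective. The algebra of $\mathcal R_G|F$ is the $*$-algebra $\mathfrak A$ of the operators $(T\xi)(y)=\sum_{x\in F,\,x\sim y}k(y,x)\xi(x)$ on $L^2(F,\nu)$, where $k$ is a bounded kernel on $\mathcal R_G|F$ such that $x\mapsto k(\dot{\wideparen{\Gamma g}}x,x)$ is $\mathcal B$-measurable for every $g$, and such that, for some finite set of cosets $\Gamma g$, $k(y,x)\ne0$ implies $y\in\Gamma gx$ for one of them. **Theorem.** (1) Let $\mathcal S$ be the Schlichting completion of $G$ with respect to $\Gamma$, i.e. the closure of the group of left translations by $G$ in the group of permutations of $G/\Gamma$, with the topology of pointwise convergence, and let $K\subseteq \mathcal S$ be the stabilizer of the coset $\Gamma$. Then $\mathcal S$ is a locally compact, Hausdorff, totally disconnected topological group in which $G$ has dense image; $K$ is a compact open subgroup, it is the closure of the image of $\Gamma$, and it is isomorphic as a topological group (compatibly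 with the maps from $\Gamma$) to the profinite completion $\varprojlim\Gamma/N$ of $\Gamma$ with respect to $\mathcal L$ ($N$ running over the members of $\mathcal L$ that are normal in $\Gamma$); $\mathcal S$ is the disjoint union of the double cosets $KgK$, where $\Gamma g\Gamma$ runs over the double cosets of $\Gamma$ in $G$; there is a unique Haar measure on $\mathcal S$ with $K$ of measure $1$. Below, $\overline{D}$ is the closure in $\mathcal S$ of (the image of) $D\subseteq G$. (2) Let $\mathcal Y=\prod_{c\in G/\Gamma}\mathcal S$. A finite product $\overline{C_1}\times\dots\times\overline{C_n}$ with $C_i\subseteq g_i\Gamma$ denotes the cylinder set $\{y: y(g_i\Gamma)\in\overline{C_i},\ i=1,\dots,n\}$. There is a unique measure $\nu_F$ on $\mathcal Y$ such that $$\nu_F(\overline{C_1}\times\dots\times\overline{C_n})=\nu(F\cap C_1F\cap\dots\cap C_nF)$$ for all $n\ge 0$ and all cosets $C_i=g_i\Gamma_i$ with $g_i\in G$, $\Gamma_i\in\mathcal L$. It is concentrated on the set $\mathcal Y_0$ of the $y$ with $y(c)\in \overline{c}$ for all $c\in G/\Gamma$ and $y(\Gamma)=1$. It is the image of $\nu|_F$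 under the map $p:F\to\mathcal Y$ whose coordinate $p(x)(c)$ is the element $\theta\in c$ with $x\in\theta F$; one has $p^{-1}(\overline C)=F\cap CF$ modulo null sets for every coset $C=gH$ with $H\in\mathcal L$, and $\mathcal B$ consists of the sets that agree up to a null set with $p^{-1}(D)$ for some measurable $D\subseteq\mathcal Y$. Hence $f\mapsto$ (multiplication by $f\circ p$) is a faithful representation of $L^\infty(\mathcal Y,\nu_F)$ on $L^2(F,\nu)$, under which $\chi_{\overline{C_1}\times\dots\times\overline{C_n}}$ is $\chi_{F\cap C_1F\cap\dots\cap C_nF}$. (3) The $*$-algebra generated by the $\dot{\wideparen{\Gamma g}}$, $g\in G$, and $L^\infty(\mathcal Y,\nu_F)$ is $\mathfrak A$. (4) Relations. $\dot{\wideparen{\Gamma g}}$ depends only on $\Gamma g$, and is the identity for $g=1$. For $g_1,g_2\in G$ and right coset representatives $r_j$ of $\Gamma_{g_1^{-1}}$ in $\Gamma$ (so $\Gamma=\bigsqcup_j\Gamma_{g_1^{-1}}r_j$), $$\dot{\wideparen{\Gamma g_1}}\;\dot{\wideparen{\Gamma g_2}}=\sum_{j}\dot{\wideparen{\Gamma g_1r_jg_2}}\;\chi_{\overline{(r_jg_2)^{-1}\Gamma_{g_1^{-1}}}}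 .$$ For $g\in G$ and $\alpha\in\Gamma$ the element $v_{g,\alpha}=\dot{\wideparen{\Gamma g}}\,\chi_{\overline{g^{-1}\Gamma_g\alpha}}$ is a partial isometry with initial projection $\chi_{\overline{g^{-1}\Gamma_g\alpha}}$ and final projection $\chi_{\overline{\alpha^{-1}g\Gamma_{g^{-1}}}}$. Define $\tau_g:\mathcal Y\to\mathcal Y$, in terms of the cosets alone, by $\tau_g(y)(c)=h^{-1}\,y(hc)$, where $h=y(g^{-1}\Gamma)$. Then $f\,\dot{\wideparen{\Gamma g}}=\dot{\wideparen{\Gamma g}}\,(f\circ\tau_g)$ for $f\in L^\infty(\mathcal Y,\nu_F)$, and $p(\dot{\wideparen{\Gamma g}}x)=\tau_g(p(x))$ for a.e. $x\in F$; for every $\alpha\in\Gamma$, $\tau_g$ preserves $\nu_F$ as a map from $\overline{g^{-1}\Gamma_g\alpha}$ to $\overline{\alpha^{-1}g\Gamma_{g^{-1}}}$ and is a bijection between the intersections of these sets with $\mathcal Y_0$. These relations present $\mathfrak A$: given a unital $*$-homomorphism $\rho$ of $L^\infty(\mathcal Y,\nu_F)$ into a unital complex $*$-algebra $D$ and elements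 $t_g\in D$, $g\in G$, satisfying the relations of (4) ($t_g$ depends only on $\Gamma g$; $t_1=1$; the composition formula; the formulas for the initial and final projections; $\rho(f)t_g=t_g\rho(f\circ\tau_g)$), there is a unique unital $*$-homomorphism $\mathfrak A\to D$ that extends $\rho$ and maps $\dot{\wideparen{\Gamma g}}$ to $t_g$ for all $g$. (5) Action on cylinder sets. Every member of $\mathcal L$ contains a member of $\mathcal L$ that is normal in $\Gamma$. Let $g,g_1,\dots,g_n\in G$ and $\Gamma_0\in\mathcal L$. There is $\Gamma'\in\mathcal L$, $\Gamma'\subseteq\Gamma_g$, such that for every $\Gamma_1\in\mathcal L$ that is contained in $\Gamma'$ and normal in $\Gamma$, and for all $r\in\Gamma_g$, $\alpha\in\Gamma$, the partial isometry $v_{g,\alpha}$ maps the characteristic function of $$\overline{g^{-1}r\alpha\Gamma_1}\times\overline{g_1^{-1}\Gamma_0}\times\dots\times\overline{g_n^{-1}\Gamma_0}\ \subseteq\ \overline{g^{-1}\Gamma_g\alpha}$$ onto the characteristic function of $$\overline{\alpha^{-1}r^{-1}\Gamma_1g}\times\overline{\alpha^{-1}r^{-1}gg_1^{-1}\Gamma_0}\times\dots\times\overline{\alpha^{-1}r^{-1}gg_n^{-1}\Gamma_0},$$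 both as vectors of $L^2(F,\nu)$ and under $a\mapsto v_{g,\alpha}\,a\,v_{g,\alpha}^*$ as projections; and $\tau_g$ maps the first set, intersected with $\mathcal Y_0$, onto the second one, intersected with $\mathcal Y_0$. (6) Pairing. Let $\mathbb C(\mathcal S/K)$, $\mathbb C(K\backslash\mathcal S)$ and $\mathcal O$ be the linear spans of the functions $\chi_{aK}$, $\chi_{Kb}$ and $\chi_{aKb}$ ($a,b\in G$) on $\mathcal S$. For the Haar measure with $K$ of measure $1$, convolution is a pairing $\mathbb C(\mathcal S/K)\times\mathbb C(K\backslash\mathcal S)\to\mathcal O$ with $\chi_{aK}*\chi_{Kb}=\chi_{aKb}$. There is a linear map $\Theta$ from $\mathcal O$ to the bounded operators on $L^2(F,\nu)$, where $\Theta(\varphi)$ is the operator whose kernel on $\mathcal R_G|F$ is $k(y,x)=\sum_{\theta\in G,\ \theta x=y}\varphi(\theta)$, such that $$[\dot{\wideparen{\Gamma g_2}}]^*\cdot\dot{\wideparen{\Gamma g_1}}=\Theta\big(\chi_{g_2^{-1}Kg_1}\big)\qquad(g_1,g_2\in G),$$ and $\Theta(\varphi*\psi)=\Theta(\varphi)\Theta(\psi)$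 for all $\varphi\in\mathbb C(\mathcal S/K)$, $\psi\in\mathbb C(K\backslash\mathcal S)$. -/

import Mathlib

open MeasureTheory Filter Topology
open scoped ENNReal Pointwise

noncomputable section

/-! ### The `*`-algebra `L^∞` of a measure space -/

namespace LinftyAlgebra

variable {α : Type*} [MeasurableSpace α] {μ : Measure α}

/-- Pointwise multiplication on `L^∞`. -/
instance instMul : Mul (Lp ℂ ∞ μ) where
  mul f g := ((Lp.memLp g).mul (r := ∞) (Lp.memLp f)).toLp (⇑f * ⇑g)

theorem coeFn_mul (f g : Lp ℂ ∞ μ) : ⇑(f * g) =ᵐ[μ] ⇑f * ⇑g :=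
  MemLp.coeFn_toLp _

theorem memLp_one : MemLp (fun _ : α => (1 : ℂ)) ∞ μ :=
  memLp_top_of_bound aestronglyMeasurable_const 1 (by simp)

/-- The constant function `1` in `L^∞`. -/
instance instOne : One (Lp ℂ ∞ μ) where
  one := memLp_one.toLp _

theorem coeFn_one : ⇑(1 : Lp ℂ ∞ μ) =ᵐ[μ] fun _ => (1 : ℂ) :=
  MemLp.coeFn_toLp _

theorem mul_comm' (f g : Lp ℂ ∞ μ) : f * g = g * f := by
  apply Lp.ext
  filter_upwards [coeFn_mul f g, coeFn_mul g f] with x h1 h2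
  rw [h1, h2, Pi.mul_apply, Pi.mul_apply, mul_comm]

theorem mul_assoc' (f g h : Lp ℂ ∞ μ) : f * g * h = f * (g * h) := by
  apply Lp.ext
  filter_upwards [coeFn_mul f g, coeFn_mul g h, coeFn_mul (f * g) h, coeFn_mul f (g * h)]
    with x h1 h2 h3 h4
  simp only [h1, h2, h3, h4, Pi.mul_apply, mul_assoc]

theorem one_mul' (f : Lp ℂ ∞ μ) : 1 * f = f := by
  apply Lp.ext
  filter_upwards [coeFn_mul 1 f, coeFn_one (μ := μ)] with x h1 h2
  simp only [h1, h2, Pi.mul_apply, one_mul]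

theorem mul_add' (f g h : Lp ℂ ∞ μ) : f * (g + h) = f * g + f * h := by
  apply Lp.ext
  filter_upwards [coeFn_mul f g, coeFn_mul f h, coeFn_mul f (g + h), Lp.coeFn_add g h,
    Lp.coeFn_add (f * g) (f * h)] with x h1 h2 h3 h4 h5
  simp only [h1, h2, h3, h4, h5, Pi.mul_apply, Pi.add_apply, mul_add]

theorem smul_mul' (c : ℂ) (f g : Lp ℂ ∞ μ) : c • f * g = c • (f * g) := by
  apply Lp.ext
  filter_upwards [coeFn_mul f g, coeFn_mul (c • f) g, Lp.coeFn_smul c f,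
    Lp.coeFn_smul c (f * g)] with x h1 h2 h3 h4
  simp only [h1, h2, h3, h4, Pi.mul_apply, Pi.smul_apply, smul_eq_mul, mul_assoc]

theorem zero_mul' (f : Lp ℂ ∞ μ) : 0 * f = 0 := by
  simpa using smul_mul' (0 : ℂ) f f

instance instCommRing : CommRing (Lp ℂ ∞ μ) :=
  { (inferInstance : AddCommGroup (Lp ℂ ∞ μ)), instMul, instOne with
    left_distrib := mul_add'
    right_distrib := fun f g h => by
      rw [mul_comm' (f + g) h, mul_add', mul_comm' h f, mul_comm' h g]
    zero_mul := zero_mul'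
    mul_zero := fun f => by rw [mul_comm' f 0, zero_mul']
    mul_assoc := mul_assoc'
    one_mul := one_mul'
    mul_one := fun f => by rw [mul_comm' f 1, one_mul']
    mul_comm := mul_comm' }

instance instAlgebra : Algebra ℂ (Lp ℂ ∞ μ) :=
  Algebra.ofModule smul_mul'
    (fun c f g => by rw [mul_comm f (c • g), smul_mul', mul_comm f g])

instance instStarRing : StarRing (Lp ℂ ∞ μ) where
  star_involutive := star_involutive
  star_mul f g := by
    apply Lp.ext
    filter_upwards [coeFn_mul f g, coeFn_mul (star g) (star f), Lp.coeFn_star f,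
      Lp.coeFn_star g, Lp.coeFn_star (f * g)] with x h1 h2 h3 h4 h5
    simp only [h1, h2, h3, h4, h5, Pi.mul_apply, Pi.star_apply, star_mul]
  star_add f g := by
    apply Lp.ext
    filter_upwards [Lp.coeFn_add f g, Lp.coeFn_add (star f) (star g), Lp.coeFn_star f,
      Lp.coeFn_star g, Lp.coeFn_star (f + g)] with x h1 h2 h3 h4 h5
    simp only [h1, h2, h3, h4, h5, Pi.add_apply, Pi.star_apply, star_add]

/-- The characteristic function `χ_E`, as an element of `L^∞`. -/
def chi (μ : Measure α) {E : Set α} (hE : MeasurableSet E) : Lp ℂ ∞ μ :=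
  (memLp_top_of_bound (μ := μ) (f := E.indicator fun _ => (1 : ℂ))
    ((measurable_const.indicator hE).aestronglyMeasurable) 1
    (Eventually.of_forall fun x => by
      by_cases hx : x ∈ E <;> simp [hx])).toLp _

end LinftyAlgebra

namespace CosetAlgebra

open LinftyAlgebra

/-! ### Almost normal subgroups and the completion of a group with respect to one -/

section Groups

variable {G : Type*} [Group G]

/-- `Γ_g = Γ ∩ g Γ g⁻¹`. -/
def isot (Γ : Subgroup G) (g : G) : Subgroup G :=
  Γ ⊓ Γ.map (MulAut.conj g).toMonoidHom

/-- `Γ` is almost normal: every `Γ_g` has finite index in `Γ`. -/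
def AlmostNormal (Γ : Subgroup G) : Prop :=
  ∀ g : G, (isot Γ g).relIndex Γ ≠ 0

/-- The lattice of subgroups of `Γ` generated by the `Γ ∩ σ Γ σ⁻¹`, `σ ∈ G`. -/
def subgroupLattice (Γ : Subgroup G) : Set (Subgroup G) :=
  latticeClosure (Set.range (isot Γ))

/-- The members of the lattice that are normal in `Γ`, as subgroups of `Γ`. -/
abbrev NormalIndex (Γ : Subgroup G) : Type _ :=
  {N : Subgroup Γ // N.Normal ∧ N.map Γ.subtype ∈ subgroupLattice Γ}

instance (Γ : Subgroup G) (N : NormalIndex Γ) : N.1.Normal := N.2.1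

/-- The inverse limit of the groups `Γ / N`, as a subgroup of their product. -/
def profiniteSubgroup (Γ : Subgroup G) : Subgroup (∀ N : NormalIndex Γ, Γ ⧸ N.1) where
  carrier := {f | ∀ (N M : NormalIndex Γ) (h : N.1 ≤ M.1),
    QuotientGroup.map N.1 M.1 (MonoidHom.id Γ) h (f N) = f M}
  one_mem' := fun N M h => by simp
  mul_mem' := fun {a b} ha hb N M h => by
    simp only [Pi.mul_apply, map_mul, ha N M h, hb N M h]
  inv_mem' := fun {a} ha N M h => by
    simp only [Pi.inv_apply, map_inv, ha N M h]

/-- The profinite completion of `Γ` with respect to the lattice. -/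
def ProfiniteCompl (Γ : Subgroup G) : Type _ := profiniteSubgroup Γ

instance (Γ : Subgroup G) : Group (ProfiniteCompl Γ) :=
  inferInstanceAs (Group (profiniteSubgroup Γ))

/-- The topology induced by the product of the discrete topologies. -/
instance (Γ : Subgroup G) : TopologicalSpace (ProfiniteCompl Γ) :=
  TopologicalSpace.induced
    (fun (f : profiniteSubgroup Γ) (N : NormalIndex Γ) => (f : ∀ N : NormalIndex Γ, Γ ⧸ N.1) N)
    (@Pi.topologicalSpace _ _ (fun _ => ⊥))

/-- The canonical map of `Γ` into its profinite completion. -/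
def toProfinite (Γ : Subgroup G) (γ : Γ) : ProfiniteCompl Γ :=
  (⟨fun N => (γ : Γ ⧸ N.1), fun _ _ _ => rfl⟩ : profiniteSubgroup Γ)

/-- The permutations of `G / Γ` that agree on every finite set with the left translation by an
element of `G`: the closure of `G` in the group of all permutations of `G / Γ`. -/
def schlichtingSubgroup (Γ : Subgroup G) : Subgroup (Equiv.Perm (G ⧸ Γ)) where
  carrier := {s | ∀ A : Finset (G ⧸ Γ), ∃ g : G, ∀ c ∈ A, s c = g • c}
  one_mem' := fun _ => ⟨1, fun c _ => by simp⟩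
  mul_mem' := fun {a b} ha hb A => by
    classical
    obtain ⟨g, hg⟩ := hb A
    obtain ⟨h, hh⟩ := ha (A.image b)
    refine ⟨h * g, fun c hc => ?_⟩
    rw [Equiv.Perm.mul_apply, hh _ (Finset.mem_image_of_mem b hc), hg c hc, mul_smul]
  inv_mem' := fun {a} ha A => by
    classical
    obtain ⟨g, hg⟩ := ha (A.image ⇑a⁻¹)
    refine ⟨g⁻¹, fun c hc => ?_⟩
    have h := hg _ (Finset.mem_image_of_mem (⇑a⁻¹) hc)
    have h' : a (a⁻¹ c) = c := a.apply_symm_apply c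
    rw [h'] at h
    exact (inv_smul_eq_iff.mpr h).symm

/-- The (Schlichting) completion `𝒮` of `G` with respect to `Γ`. -/
def Schlichting (Γ : Subgroup G) : Type _ := schlichtingSubgroup Γ

instance (Γ : Subgroup G) : Group (Schlichting Γ) :=
  inferInstanceAs (Group (schlichtingSubgroup Γ))

/-- The action of `𝒮` on `𝒮 / K = G / Γ`. -/
instance (Γ : Subgroup G) : MulAction (Schlichting Γ) (G ⧸ Γ) :=
  inferInstanceAs (MulAction (schlichtingSubgroup Γ) (G ⧸ Γ))

/-- The topology of pointwise convergence on the discrete set `G / Γ`. -/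
instance (Γ : Subgroup G) : TopologicalSpace (Schlichting Γ) :=
  TopologicalSpace.induced (fun (s : Schlichting Γ) (c : G ⧸ Γ) => s • c)
    (@Pi.topologicalSpace _ _ (fun _ => ⊥))

instance (Γ : Subgroup G) : MeasurableSpace (Schlichting Γ) := borel _

instance (Γ : Subgroup G) : BorelSpace (Schlichting Γ) := ⟨rfl⟩

/-- The canonical homomorphism of `G` into `𝒮`. -/
def emb (Γ : Subgroup G) : G →* Schlichting Γ :=
  (MulAction.toPermHom G (G ⧸ Γ)).codRestrict (schlichtingSubgroup Γ)
    (fun g _ => ⟨g, fun _ _ => rfl⟩)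

/-- The closure in `𝒮` of a subset of `G`. -/
def cl (Γ : Subgroup G) (D : Set G) : Set (Schlichting Γ) := closure (emb Γ '' D)

/-- The subgroup `K` of `𝒮`: the stabilizer of the coset `Γ`. -/
def compactSubgroup (Γ : Subgroup G) : Subgroup (Schlichting Γ) :=
  MulAction.stabilizer (Schlichting Γ) ((1 : G) : G ⧸ Γ)

/-! ### The infinite product `𝒴` and its partial transformations -/

/-- `𝒴`: the product of copies of `𝒮`, one for each coset `gΓ`. -/
abbrev YSpace (Γ : Subgroup G) : Type _ := (G ⧸ Γ) → Schlichting Γ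

/-- For `D ⊆ gΓ`, the cylinder set in `𝒴` of the set `closure D ⊆ 𝒮`, which is a condition on the
coordinate labelled `gΓ`. Finite products of sets are finite intersections of these. -/
def cyl (Γ : Subgroup G) (g : G) (D : Set G) : Set (YSpace Γ) :=
  {y | y (g : G ⧸ Γ) ∈ cl Γ D}

theorem measurableSet_cyl (Γ : Subgroup G) (g : G) (D : Set G) : MeasurableSet (cyl Γ g D) :=
  measurable_pi_apply (g : G ⧸ Γ) isClosed_closure.measurableSet

/-- The transformation of `𝒴` associated with `Γg`: with `h = y(g⁻¹Γ)`, the family `y` is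
translated by `h⁻¹`, its entries together with their labels. -/
def shift (Γ : Subgroup G) (g : G) (y : YSpace Γ) : YSpace Γ :=
  fun c => (y ((g⁻¹ : G) : G ⧸ Γ))⁻¹ * y (y ((g⁻¹ : G) : G ⧸ Γ) • c)

/-- The families `y` with `y(gΓ) ∈ gK` for all `g` and `y(Γ) = 1`. -/
def normalizedSections (Γ : Subgroup G) : Set (YSpace Γ) :=
  {y | (∀ c, y c • ((1 : G) : G ⧸ Γ) = c) ∧ y ((1 : G) : G ⧸ Γ) = 1}

/-- The cylinder set of the closure of `(r g)⁻¹ Γ_{h⁻¹}`. -/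
def compCyl (Γ : Subgroup G) (h r g : G) : Set (YSpace Γ) :=
  cyl Γ (r * g)⁻¹ ((r * g)⁻¹ • (isot Γ h⁻¹ : Set G))

theorem measurableSet_compCyl (Γ : Subgroup G) (h r g : G) : MeasurableSet (compCyl Γ h r g) :=
  measurableSet_cyl _ _ _

/-- The cylinder set of the closure of `g⁻¹ Γ_g α`. -/
def initialCyl (Γ : Subgroup G) (g α : G) : Set (YSpace Γ) :=
  cyl Γ g⁻¹ (g⁻¹ • ((isot Γ g : Set G) * {α}))

theorem measurableSet_initialCyl (Γ : Subgroup G) (g α : G) : MeasurableSet (initialCyl Γ g α) :=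
  measurableSet_cyl _ _ _

/-- The cylinder set of the closure of `α⁻¹ g Γ_{g⁻¹}`. -/
def finalCyl (Γ : Subgroup G) (g α : G) : Set (YSpace Γ) :=
  cyl Γ (α⁻¹ * g) ((α⁻¹ * g) • (isot Γ g⁻¹ : Set G))

theorem measurableSet_finalCyl (Γ : Subgroup G) (g α : G) : MeasurableSet (finalCyl Γ g α) :=
  measurableSet_cyl _ _ _

/-- The finite product of the closures of `g⁻¹ r α Γ₁` and of `gᵢ⁻¹ Γ₀`, `i = 1, …, n`. -/
def sourceCyl (Γ Γ₀ Γ₁ : Subgroup G) (g r α : G) {n : ℕ} (gs : Fin n → G) : Set (YSpace Γ) :=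
  cyl Γ g⁻¹ ((g⁻¹ * r * α) • (Γ₁ : Set G)) ∩ ⋂ i, cyl Γ (gs i)⁻¹ ((gs i)⁻¹ • (Γ₀ : Set G))

theorem measurableSet_sourceCyl (Γ Γ₀ Γ₁ : Subgroup G) (g r α : G) {n : ℕ} (gs : Fin n → G) :
    MeasurableSet (sourceCyl Γ Γ₀ Γ₁ g r α gs) :=
  (measurableSet_cyl _ _ _).inter (MeasurableSet.iInter fun _ => measurableSet_cyl _ _ _)

/-- The finite product of the closures of `α⁻¹ r⁻¹ Γ₁ g` and of `α⁻¹ r⁻¹ g gᵢ⁻¹ Γ₀`,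
`i = 1, …, n`. -/
def targetCyl (Γ Γ₀ Γ₁ : Subgroup G) (g r α : G) {n : ℕ} (gs : Fin n → G) : Set (YSpace Γ) :=
  cyl Γ (α⁻¹ * r⁻¹ * g) ((α⁻¹ * r⁻¹) • ((Γ₁ : Set G) * {g})) ∩
    ⋂ i, cyl Γ (α⁻¹ * r⁻¹ * g * (gs i)⁻¹) ((α⁻¹ * r⁻¹ * g * (gs i)⁻¹) • (Γ₀ : Set G))

theorem measurableSet_targetCyl (Γ Γ₀ Γ₁ : Subgroup G) (g r α : G) {n : ℕ} (gs : Fin n → G) :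
    MeasurableSet (targetCyl Γ Γ₀ Γ₁ g r α gs) :=
  (measurableSet_cyl _ _ _).inter (MeasurableSet.iInter fun _ => measurableSet_cyl _ _ _)

/-! ### The relations -/

/-- `r` is a system of representatives of the right cosets of `H` in `Γ`: `Γ = ⊔ⱼ H rⱼ`. -/
def IsRightTransversal (H Γ : Subgroup G) {n : ℕ} (r : Fin n → G) : Prop :=
  (∀ j, r j ∈ Γ) ∧ ∀ γ ∈ Γ, ∃! j, γ * (r j)⁻¹ ∈ H

/-- The relations between elements `t g`, standing for the transformations `Γg`, and a
representation `ρ` of `L^∞(𝒴, μ)`, in a `*`-algebra `D`. -/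
structure CosetRelations (Γ : Subgroup G) (μ : Measure (YSpace Γ)) {D : Type*} [Ring D]
    [StarRing D] [Algebra ℂ D] (ρ : Lp ℂ ∞ μ →⋆ₐ[ℂ] D) (t : G → D) : Prop where
  /-- `t g` depends only on the coset `Γg`. -/
  coset : ∀ γ ∈ Γ, ∀ g, t (γ * g) = t g
  /-- The coset `Γ` acts identically. -/
  one : t 1 = 1
  /-- The composition formula. -/
  composition : ∀ (g₁ g₂ : G) (r : Fin ((isot Γ g₁⁻¹).relIndex Γ) → G),
    IsRightTransversal (isot Γ g₁⁻¹) Γ r →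
    t g₁ * t g₂ =
      ∑ j, t (g₁ * r j * g₂) * ρ (chi μ (measurableSet_compCyl Γ g₁ (r j) g₂))
  /-- The initial projection of `t g · χ(g⁻¹ Γ_g α)`. -/
  initial : ∀ (g : G), ∀ α ∈ Γ,
    star (t g * ρ (chi μ (measurableSet_initialCyl Γ g α))) *
        (t g * ρ (chi μ (measurableSet_initialCyl Γ g α))) =
      ρ (chi μ (measurableSet_initialCyl Γ g α))
  /-- The final projection of `t g · χ(g⁻¹ Γ_g α)`. -/
  final : ∀ (g : G), ∀ α ∈ Γ,
    (t g * ρ (chi μ (measurableSet_initialCyl Γ g α))) *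
        star (t g * ρ (chi μ (measurableSet_initialCyl Γ g α))) =
      ρ (chi μ (measurableSet_finalCyl Γ g α))
  /-- `t g` implements the transformation `shift Γ g` of `𝒴`. -/
  covariance : ∀ (g : G) (f f' : Lp ℂ ∞ μ),
    (⇑f' =ᵐ[μ] fun y => f (shift Γ g y)) → ρ f * t g = t g * ρ f'

/-! ### Spaces of functions on `𝒮` -/

/-- The characteristic function of a subset of `𝒮`. -/
def ind {Γ : Subgroup G} (E : Set (Schlichting Γ)) : Schlichting Γ → ℂ :=
  E.indicator fun _ => 1

/-- `ℂ(𝒮/K)`: the span of the functions `χ_{aK}`. -/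
def leftCosetSpan (Γ : Subgroup G) : Submodule ℂ (Schlichting Γ → ℂ) :=
  Submodule.span ℂ (Set.range fun a : G =>
    ind ({emb Γ a} * (compactSubgroup Γ : Set (Schlichting Γ))))

/-- `ℂ(K\𝒮)`: the span of the functions `χ_{Kb}`. -/
def rightCosetSpan (Γ : Subgroup G) : Submodule ℂ (Schlichting Γ → ℂ) :=
  Submodule.span ℂ (Set.range fun b : G =>
    ind ((compactSubgroup Γ : Set (Schlichting Γ)) * {emb Γ b}))

/-- `ℂ(aKb | a, b ∈ G)`: the span of the functions `χ_{aKb}`. -/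
def sandwichSpan (Γ : Subgroup G) : Submodule ℂ (Schlichting Γ → ℂ) :=
  Submodule.span ℂ (Set.range fun p : G × G =>
    ind ({emb Γ p.1} * (compactSubgroup Γ : Set (Schlichting Γ)) * {emb Γ p.2}))

theorem sandwich_mem (Γ : Subgroup G) (a b : G) :
    ind ({emb Γ a} * (compactSubgroup Γ : Set (Schlichting Γ)) * {emb Γ b}) ∈ sandwichSpan Γ :=
  Submodule.subset_span ⟨(a, b), rfl⟩

/-- Convolution on `𝒮` with respect to a measure. -/
def conv {Γ : Subgroup G} (m : Measure (Schlichting Γ)) (φ ψ : Schlichting Γ → ℂ) :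
    Schlichting Γ → ℂ :=
  fun s => ∫ t, φ t * ψ (t⁻¹ * s) ∂m

end Groups

/-! ### The action on a measure space and the algebra of the quotient relation -/

section Action

variable {G : Type*} [Group G] {X : Type*} [MulAction G X]

open Classical in
/-- The transformation of `F` associated with the coset `Γg`: the point `x` is sent to the point
of `F` of the form `γ⁻¹ g x`, `γ ∈ Γ`. (On the null set where there is no such point, to `x`.) -/
def dotMap (Γ : Subgroup G) (F : Set X) (g : G) (x : X) : X :=
  if h : ∃ θ : G, θ * g⁻¹ ∈ Γ ∧ θ • x ∈ F then h.choose • x else x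

open Classical in
/-- The coding of points: the coordinate of `x` labelled by the coset `c` is the element `θ` of
`c` with `x ∈ θ F`. (On the null set where there is no such element, it is `1`.) -/
def code (Γ : Subgroup G) (F : Set X) (x : X) : YSpace Γ :=
  fun c => if h : ∃ θ : G, (θ : G ⧸ Γ) = c ∧ θ⁻¹ • x ∈ F then emb Γ h.choose else 1

/-- `{x ∈ F | r g x ∈ Γ_{h⁻¹} F}`: a set of the composition formula. -/
def compSet (Γ : Subgroup G) (F : Set X) (h r g : G) : Set X :=
  {x ∈ F | (r * g) • x ∈ (isot Γ h⁻¹ : Set G) • F}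

/-- `{x ∈ F | g x ∈ Γ_g α F}`: a domain of bijectivity of the transformation of `Γg`. -/
def bijDomain (Γ : Subgroup G) (F : Set X) (g α : G) : Set X :=
  {x ∈ F | g • x ∈ ((isot Γ g : Set G) * {α}) • F}

variable [MeasurableSpace X]

/-- The Borel algebra `ℬ` of the quotient relation: the smallest σ-algebra that contains the null
sets and the sets of the composition formula, and is invariant under the transformations `Γg`
taken on their domains of bijectivity. (It concerns subsets of `F`; the complement of `F` is a
null set of `ν.restrict F`.) -/
abbrev relBorel (ν : Measure X) (Γ : Subgroup G) (F : Set X) : MeasurableSpace X :=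
  sInf {m : MeasurableSpace X |
    (∀ N : Set X, ν.restrict F N = 0 → MeasurableSet[m] N) ∧
    (∀ (h g : G), ∀ r ∈ Γ, MeasurableSet[m] (compSet Γ F h r g)) ∧
    (∀ (g : G), ∀ α ∈ Γ, ∀ E : Set X, MeasurableSet[m] E →
      MeasurableSet[m] (dotMap Γ F g '' (E ∩ bijDomain Γ F g α)) ∧
      MeasurableSet[m] (bijDomain Γ F g α ∩ dotMap Γ F g ⁻¹' E))}

/-- The Hilbert space `L²(F, ν)`. -/
abbrev L2 (ν : Measure X) (F : Set X) : Type _ := Lp ℂ 2 (ν.restrict F)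

variable (G) in
/-- `T` is the operator on `L²(F, ν)` with kernel `k` on the orbit relation restricted to `F`:
`(T ξ)(y) = ∑ k(y, x) ξ(x)`, the sum over the points `x ∈ F` of the orbit `G y`. -/
def IsKernelOp (ν : Measure X) (F : Set X) (k : X → X → ℂ) (T : L2 ν F →L[ℂ] L2 ν F) : Prop :=
  ∀ ξ : L2 ν F, ∀ᵐ y ∂(ν.restrict F),
    T ξ y = ∑' x : {x : X // x ∈ F ∧ x ∈ MulAction.orbit G y}, k y x * ξ x

/-- The algebra of the quotient relation: the operators on `L²(F, ν)` given by the bounded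
`ℬ`-measurable kernels on the relation that are supported on finitely many cosets of `Γ`. -/
def relationAlgebra (ν : Measure X) (Γ : Subgroup G) (F : Set X) :
    Set (L2 ν F →L[ℂ] L2 ν F) :=
  {T | ∃ k : X → X → ℂ, IsKernelOp G ν F k T ∧
    (∃ C : ℝ, ∀ y x, ‖k y x‖ ≤ C) ∧
    (∃ A : Finset G, ∀ y x, k y x ≠ 0 → ∃ g ∈ A, ∃ γ ∈ Γ, y = (γ * g) • x) ∧
    ∀ g : G, Measurable[relBorel ν Γ F] fun x => k (dotMap Γ F g x) x}

/-- The defining property of `ν_F`: the product of the closures of the cosets `Cᵢ = gᵢ Γᵢ`, with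
`Γᵢ` in the lattice, has measure `ν(F ∩ C₁F ∩ … ∩ CₙF)`. -/
def CylinderFormula (ν : Measure X) (Γ : Subgroup G) (F : Set X)
    (μ : Measure (YSpace Γ)) : Prop :=
  ∀ (n : ℕ) (g : Fin n → G) (H : Fin n → Subgroup G), (∀ i, H i ∈ subgroupLattice Γ) →
    μ (⋂ i, cyl Γ (g i) (g i • (H i : Set G))) = ν (F ∩ ⋂ i, (g i • (H i : Set G)) • F)

open Classical in
/-- The kernel of the transformation of the coset `Γg`: the indicator function of its graph. -/
def graphKernel (Γ : Subgroup G) (F : Set X) (g : G) : X → X → ℂ :=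
  fun y x => if dotMap Γ F g x = y then 1 else 0

open Classical in
/-- The kernel of multiplication by the function `u`. -/
def diagKernel (u : X → ℂ) : X → X → ℂ :=
  fun y x => if x = y then u x else 0

/-- The kernel of the function `φ` on `𝒮`: the sum of `φ(θ)` over the `θ ∈ G` with `θ x = y`. -/
def koopmanKernel {Γ : Subgroup G} (φ : Schlichting Γ → ℂ) : X → X → ℂ :=
  fun y x => ∑' θ : {θ : G // θ • x = y}, φ (emb Γ θ)

end Action

end CosetAlgebra

end

open CosetAlgebra LinftyAlgebra

universe u v w

/-!
The proof replaces points by labels. Call a point `x` of `X` good (`Good`) if its stabilizer is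
trivial and every coset `gΓ` contains exactly one `θ` with `x ∈ θF`; almost every point is good, and
goodness is invariant under `G`. For a good point, `sec Γ F x c` is the element `θ` of the coset `c`,
and `pt Γ F c x = θ⁻¹x` is the corresponding point of `F`. The points of `F` in the orbit of `x` are
then the distinct points `pt Γ F c x`, `c ∈ G/Γ`; the code of `x` is `c ↦ sec Γ F x c`; the
transformation `Γg` is `x ↦ pt Γ F (g⁻¹Γ) x`; and passing from `x` to `pt Γ F c x` changes sections and
labels by the one group element `sec Γ F x c` (`Good.sec_pt`, `Good.pt_pt`). In terms of codes this is
`code (Γg x) = shift g (code x)`, and all relations become statements about where the permutations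
that are the entries of a normalized section `y` send cosets: `y` lies in `initialCyl Γ g α` if and
only if `y(g⁻¹Γ)` sends `α⁻¹gΓ` to `Γ`, and similarly for the other cylinder sets. Hence `shift g` is
invertible there, with inverse `shift (g⁻¹α)`.

*The completion.* The profinite completion of `Γ` acts on `G/Γ`, since a coset is fixed by some normal
member of the lattice. This gives the isomorphism with `K`, and compactness of `K`, because the
inverse limit is closed in a product of finite groups.

*The measure.* `ν_F` is the image of `ν|F` under the code. Uniqueness is the π-λ theorem for the boxes
with sides closures of cosets (`CylinderFormula.unique`). On its domain labelled by `α`, the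
transformation `Γg` is pieced together from translations by elements of `G`, so it preserves the
measure (`map_dotMap_restrict`).

*The operators.* The operator of `Γg` is defined as the adjoint of `ξ ↦ ξ ∘ Γg`, which is bounded since
`Γg` has finitely many domains of bijectivity. Relations are checked for the adjoints, where they are
pointwise identities. The kernel of the operator follows by writing it as a finite sum of
compositions with inverse transformations.

*Presentation.* In any `*`-algebra, the relations imply that the adjoint of `t(g) χ` is
`t(g⁻¹α) χ'`, with `χ`, `χ'` the initial and final projections (`CosetRelations.star_partial`), so the
sums `∑ t(g) f` over cosets are closed under products and adjoints by formulas that do not depend on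
the algebra. In the algebra of operators these sums have unique coefficients (`lam_injective`): the
terms have kernels with disjoint supports, and a kernel with finite rows is determined by its
operator because `X` is countably separated (`IsKernelOp.ae_eq_zero`). The same sums are all operators
with bounded `ℬ`-measurable kernels of finite support, since `ℬ`-measurable functions are functions
of the code (`range_lam_eq_relationAlgebra`).

*Pairing.* The kernel of `(Γg₂)* Γg₁` at `(y, σ⁻¹y)` is `1` if `σ ∈ g₂⁻¹Γg₁` and `0` otherwise, which is the
kernel of the function `χ_{g₂⁻¹Kg₁}`. Since operators are determined by their kernels, this defines
`Θ`, and its multiplicativity follows from `χ_{aK} * χ_{Kb} = χ_{aKb}`.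
-/

namespace CosetAlgebra

/-! ### The topological group `𝒮` -/

namespace Schlichting

variable {G : Type*} [Group G] {Γ : Subgroup G}

theorem ext' {s t : Schlichting Γ} (h : ∀ c : G ⧸ Γ, s • c = t • c) : s = t :=
  Subtype.ext (Equiv.ext h)

@[simp] theorem emb_smul (g : G) (c : G ⧸ Γ) : emb Γ g • c = g • c := rfl

theorem exists_approx (s : Schlichting Γ) (A : Finset (G ⧸ Γ)) : ∃ g : G, ∀ c ∈ A, s • c = g • c :=
  s.2 A

theorem exists_approx_set (s : Schlichting Γ) {A : Set (G ⧸ Γ)} (hA : A.Finite) :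
    ∃ g : G, ∀ c ∈ A, s • c = g • c := by
  obtain ⟨g, hg⟩ := exists_approx s hA.toFinset
  exact ⟨g, fun c hc => hg c (hA.mem_toFinset.2 hc)⟩

/-- Neighbourhoods of `s` are described by prescribing the values of `s` on finite sets of cosets. -/
theorem mem_nhds_iff {s : Schlichting Γ} {U : Set (Schlichting Γ)} :
    U ∈ 𝓝 s ↔ ∃ A : Set (G ⧸ Γ), A.Finite ∧ ∀ t : Schlichting Γ, (∀ c ∈ A, t • c = s • c) → t ∈ U := by
  let _ : TopologicalSpace (G ⧸ Γ) := ⊥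
  have : DiscreteTopology (G ⧸ Γ) := ⟨rfl⟩
  have h := nhds_induced (fun (s : Schlichting Γ) (c : G ⧸ Γ) => s • c) s
  have h' : 𝓝 s = Filter.comap (fun (s : Schlichting Γ) (c : G ⧸ Γ) => s • c)
      (𝓝 fun c => s • c) := h
  rw [h', nhds_pi, Filter.mem_comap]
  constructor
  · rintro ⟨V, hV, hVU⟩
    obtain ⟨I, hI, t, ht, hIt⟩ := Filter.mem_pi.1 hV
    refine ⟨I, hI, fun t' ht' => hVU (hIt fun i hi => ?_)⟩
    have := mem_of_mem_nhds (ht i)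
    simpa only [ht' i hi] using this
  · rintro ⟨A, hA, h⟩
    refine ⟨A.pi fun c => {s • c}, Filter.mem_pi.2 ⟨A, hA, fun c => {s • c}, fun c => ?_,
      subset_rfl⟩, fun t ht => h t fun c hc => ht c hc⟩
    simp

theorem isOpen_fiber (c d : G ⧸ Γ) : IsOpen {t : Schlichting Γ | t • c = d} :=
  isOpen_iff_mem_nhds.2 fun _ hs => mem_nhds_iff.2
    ⟨{c}, Set.finite_singleton c, fun _ ht => (ht c rfl).trans hs⟩

theorem isClosed_fiber (c d : G ⧸ Γ) : IsClosed {t : Schlichting Γ | t • c = d} :=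
  ⟨isOpen_iff_mem_nhds.2 fun _ hs => mem_nhds_iff.2
    ⟨{c}, Set.finite_singleton c, fun _ ht h => hs ((ht c rfl).symm.trans h)⟩⟩

instance instTopGroup : IsTopologicalGroup (Schlichting Γ) where
  continuous_mul := continuous_iff_continuousAt.2 fun ⟨s, t⟩ U hU => by
    obtain ⟨A, hA, h⟩ := mem_nhds_iff.1 hU
    have h1 : {s' : Schlichting Γ | ∀ c ∈ (t • ·) '' A, s' • c = s • c} ∈ 𝓝 s :=
      mem_nhds_iff.2 ⟨_, hA.image _, fun _ h => h⟩
    have h2 : {t' : Schlichting Γ | ∀ c ∈ A, t' • c = t • c} ∈ 𝓝 t :=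
      mem_nhds_iff.2 ⟨_, hA, fun _ h => h⟩
    rw [Filter.mem_map]
    filter_upwards [prod_mem_nhds h1 h2]
    rintro ⟨s', t'⟩ ⟨hs, ht⟩
    refine h _ fun c hc => ?_
    simp only [mul_smul]
    rw [ht c hc, hs _ ⟨c, hc, rfl⟩]
  continuous_inv := continuous_iff_continuousAt.2 fun s U hU => by
    obtain ⟨A, hA, h⟩ := mem_nhds_iff.1 hU
    rw [Filter.mem_map]
    refine mem_nhds_iff.2 ⟨(s⁻¹ • ·) '' A, hA.image _, fun t ht => h _ fun c hc => ?_⟩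
    rw [inv_smul_eq_iff, ht _ ⟨c, hc, rfl⟩, smul_inv_smul]

instance instT2 : T2Space (Schlichting Γ) where
  t2 s t hst := by
    obtain ⟨c, hc⟩ : ∃ c : G ⧸ Γ, s • c ≠ t • c := by
      by_contra! h
      exact hst (ext' h)
    exact ⟨_, _, isOpen_fiber c (s • c), isOpen_fiber c (t • c), rfl, rfl,
      Set.disjoint_left.2 fun x h1 h2 => hc (h1.symm.trans h2)⟩

instance instTotallyDisconnected : TotallyDisconnectedSpace (Schlichting Γ) := by
  refine ⟨fun t _ ht x hx y hy => ext' fun c => ?_⟩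
  have hcl : IsClopen {s : Schlichting Γ | s • c = x • c} := ⟨isClosed_fiber _ _, isOpen_fiber _ _⟩
  exact (ht.subset_isClopen hcl ⟨x, hx, rfl⟩ hy).symm

theorem denseRange_emb : DenseRange (emb Γ) := fun s => mem_closure_iff_nhds.2 fun U hU => by
  obtain ⟨A, hA, h⟩ := mem_nhds_iff.1 hU
  obtain ⟨g, hg⟩ := exists_approx_set s hA
  exact ⟨emb Γ g, h _ fun c hc => (hg c hc).symm, g, rfl⟩

instance instSecondCountable [Countable G] : SecondCountableTopology (Schlichting Γ) := by
  let _ : TopologicalSpace (G ⧸ Γ) := ⊥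
  have : DiscreteTopology (G ⧸ Γ) := ⟨rfl⟩
  have : Countable (G ⧸ Γ) := Quotient.countable
  exact TopologicalSpace.secondCountableTopology_induced _ _
    (fun (s : Schlichting Γ) (c : G ⧸ Γ) => s • c)

theorem mem_cl_iff {D : Set G} {s : Schlichting Γ} :
    s ∈ cl Γ D ↔ ∀ A : Set (G ⧸ Γ), A.Finite → ∃ d ∈ D, ∀ c ∈ A, s • c = d • c := by
  rw [cl, mem_closure_iff_nhds]
  constructor
  · intro h A hA
    obtain ⟨_, h1, d, hd, rfl⟩ := h _ (mem_nhds_iff.2 ⟨A, hA, fun t ht => ht⟩)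
    exact ⟨d, hd, fun c hc => (h1 c hc).symm⟩
  · intro h U hU
    obtain ⟨A, hA, hU⟩ := mem_nhds_iff.1 hU
    obtain ⟨d, hd, hdA⟩ := h A hA
    exact ⟨emb Γ d, hU _ fun c hc => (hdA c hc).symm, d, hd, rfl⟩

theorem cl_mono {D E : Set G} (h : D ⊆ E) : cl Γ D ⊆ cl Γ E := closure_mono (Set.image_mono h)

theorem cl_smul (a : G) (D : Set G) (s : Schlichting Γ) :
    s ∈ cl Γ (a • D) ↔ (emb Γ a)⁻¹ * s ∈ cl Γ D := by
  have : cl Γ (a • D) = emb Γ a • cl Γ D := by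
    rw [cl, cl, ← closure_smul, Set.image_smul_distrib]
  rw [this, Set.mem_smul_set_iff_inv_smul_mem, smul_eq_mul]

theorem cl_mul_singleton (b : G) (D : Set G) (s : Schlichting Γ) :
    s ∈ cl Γ (D * {b}) ↔ s * (emb Γ b)⁻¹ ∈ cl Γ D := by
  rw [cl, cl, Set.image_mul, Set.image_singleton, Set.mul_singleton]
  rw [← Homeomorph.coe_mulRight, ← (Homeomorph.mulRight (emb Γ b)).image_closure,
    Homeomorph.coe_mulRight]
  constructor
  · rintro ⟨t, ht, rfl⟩
    simpa using ht
  · intro h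
    exact ⟨_, h, by simp⟩

/-- The closure in `𝒮` of a subgroup of `G`, as a subgroup. -/
def clSubgroup (Γ H : Subgroup G) : Subgroup (Schlichting Γ) := (H.map (emb Γ)).topologicalClosure

theorem coe_clSubgroup (H : Subgroup G) :
    (clSubgroup Γ H : Set (Schlichting Γ)) = cl Γ (H : Set G) := by
  rw [clSubgroup, Subgroup.topologicalClosure_coe, Subgroup.coe_map, cl]

theorem mem_clSubgroup {H : Subgroup G} {s : Schlichting Γ} :
    s ∈ clSubgroup Γ H ↔ s ∈ cl Γ (H : Set G) := by
  rw [← coe_clSubgroup, SetLike.mem_coe]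

theorem smul_eq_of_mem_cl {D : Set G} {s : Schlichting Γ} {c d : G ⧸ Γ} (hs : s ∈ cl Γ D)
    (h : ∀ g ∈ D, g • c = d) : s • c = d := by
  obtain ⟨g, hg, h1⟩ := mem_cl_iff.1 hs {c} (Set.finite_singleton c)
  rw [h1 c rfl, h g hg]

/-- The permutations in `𝒮` that send `Γ` to `gΓ` form the closure of `gΓ`. -/
theorem smul_one_eq_iff {g : G} {s : Schlichting Γ} :
    s • ((1 : G) : G ⧸ Γ) = g ↔ s ∈ cl Γ (g • (Γ : Set G)) := by
  constructor
  · intro hs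
    refine mem_cl_iff.2 fun A hA => ?_
    obtain ⟨d, hd⟩ := exists_approx_set s (hA.insert ((1 : G) : G ⧸ Γ))
    refine ⟨d, ?_, fun c hc => hd c (Set.mem_insert_of_mem _ hc)⟩
    have h1 := (hd _ (Set.mem_insert _ _)).symm.trans hs
    rw [Set.mem_smul_set_iff_inv_smul_mem]
    rw [MulAction.Quotient.smul_coe, smul_eq_mul, mul_one, eq_comm, QuotientGroup.eq] at h1
    simpa using h1
  · intro hs
    refine smul_eq_of_mem_cl hs ?_
    rintro _ ⟨γ, hγ, rfl⟩
    simp only [smul_eq_mul]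
    rw [MulAction.Quotient.smul_coe, smul_eq_mul, mul_one, eq_comm, QuotientGroup.eq]
    simpa using hγ

theorem mem_compactSubgroup {s : Schlichting Γ} :
    s ∈ compactSubgroup Γ ↔ s • ((1 : G) : G ⧸ Γ) = ((1 : G) : G ⧸ Γ) := MulAction.mem_stabilizer_iff

theorem coe_compactSubgroup_eq_cl :
    (compactSubgroup Γ : Set (Schlichting Γ)) = cl Γ (Γ : Set G) := by
  ext s
  rw [SetLike.mem_coe, mem_compactSubgroup, smul_one_eq_iff, one_smul]

theorem smul_coe_one (g : G) : g • ((1 : G) : G ⧸ Γ) = (g : G ⧸ Γ) := by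
  rw [MulAction.Quotient.smul_coe, smul_eq_mul, mul_one]

theorem smul_coe_eq_self_of_mem {g : G} (h : g ∈ Γ) :
    g • ((1 : G) : G ⧸ Γ) = ((1 : G) : G ⧸ Γ) := by
  rw [smul_coe_one, eq_comm, QuotientGroup.eq]; simpa using h

theorem smul_coe_eq_self_iff {g : G} :
    g • ((1 : G) : G ⧸ Γ) = ((1 : G) : G ⧸ Γ) ↔ g ∈ Γ := by
  rw [smul_coe_one, eq_comm, QuotientGroup.eq]; simp

theorem isOpen_compactSubgroup : IsOpen (compactSubgroup Γ : Set (Schlichting Γ)) :=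
  isOpen_fiber _ _

theorem exists_mem_doubleCoset (s : Schlichting Γ) : ∃ g : G, s ∈
    (compactSubgroup Γ : Set (Schlichting Γ)) * {emb Γ g} *
      (compactSubgroup Γ : Set (Schlichting Γ)) := by
  obtain ⟨g, hg⟩ := exists_approx s {((1 : G) : G ⧸ Γ)}
  refine ⟨g, Set.mem_mul.2 ⟨emb Γ g, ?_, (emb Γ g)⁻¹ * s, ?_, by group⟩⟩
  · exact Set.mem_mul.2 ⟨1, one_mem (compactSubgroup Γ), emb Γ g, rfl, one_mul _⟩
  · rw [SetLike.mem_coe, mem_compactSubgroup, mul_smul, hg _ (Finset.mem_singleton_self _),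
      ← emb_smul, inv_smul_smul]

theorem emb_mem_doubleCoset_iff (g g' : G) : emb Γ g' ∈
    (compactSubgroup Γ : Set (Schlichting Γ)) * {emb Γ g} *
      (compactSubgroup Γ : Set (Schlichting Γ)) ↔ g' ∈ (Γ : Set G) * {g} * (Γ : Set G) := by
  constructor
  · intro h
    obtain ⟨_, ⟨k, hk, _, rfl, rfl⟩, l, hl, h⟩ := Set.mem_mul.1 h
    obtain ⟨γ, hγ⟩ := exists_approx_set k
      (A := {((1 : G) : G ⧸ Γ), (g : G ⧸ Γ)}) (Set.toFinite _)
    have h1 := congrArg (· • ((1 : G) : G ⧸ Γ)) h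
    simp only [mul_smul, mem_compactSubgroup.1 hl, emb_smul, smul_coe_one] at h1
    rw [hγ _ (by simp), MulAction.Quotient.smul_coe, smul_eq_mul, QuotientGroup.eq] at h1
    have h2 : γ ∈ Γ := by
      rw [← smul_coe_eq_self_iff, ← hγ _ (by simp), mem_compactSubgroup.1 hk]
    exact Set.mem_mul.2 ⟨γ * g, Set.mem_mul.2 ⟨γ, h2, g, rfl, rfl⟩, _, h1, by group⟩
  · intro h
    obtain ⟨_, ⟨k, hk, _, rfl, rfl⟩, l, hl, rfl⟩ := Set.mem_mul.1 h
    rw [map_mul, map_mul]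
    refine Set.mul_mem_mul (Set.mul_mem_mul ?_ rfl) ?_ <;>
    · rw [SetLike.mem_coe, mem_compactSubgroup, emb_smul, smul_coe_eq_self_iff]
      assumption

end Schlichting

/-! ### The lattice of subgroups -/

section Lattice

variable {G : Type*} [Group G] {Γ : Subgroup G}

open Schlichting

theorem mem_isot {g x : G} : x ∈ isot Γ g ↔ x ∈ Γ ∧ g⁻¹ * x * g ∈ Γ := by
  refine and_congr_right fun _ => ?_
  constructor
  · rintro ⟨y, hy, rfl⟩
    simpa [mul_assoc] using hy
  · intro h
    exact ⟨_, h, by simp [mul_assoc]⟩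

theorem smul_coe_eq_iff {x g h : G} : x • (g : G ⧸ Γ) = (h : G ⧸ Γ) ↔ h⁻¹ * x * g ∈ Γ := by
  rw [MulAction.Quotient.smul_coe, smul_eq_mul, eq_comm, QuotientGroup.eq, mul_assoc]

theorem mem_isot_iff_smul {g x : G} : x ∈ isot Γ g ↔ x ∈ Γ ∧ x • (g : G ⧸ Γ) = g := by
  rw [mem_isot, smul_coe_eq_iff]

theorem isot_le (g : G) : isot Γ g ≤ Γ := inf_le_left

theorem isot_one : isot Γ 1 = Γ := by
  ext x
  simp [mem_isot]

variable (Γ) in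
/-- The elements of `Γ` that fix the points of `A ⊆ G / Γ`. -/
def pointStab (A : Set (G ⧸ Γ)) : Subgroup G := Γ ⊓ fixingSubgroup G A

theorem mem_pointStab {A : Set (G ⧸ Γ)} {x : G} :
    x ∈ pointStab Γ A ↔ x ∈ Γ ∧ ∀ c ∈ A, x • c = c := by
  rw [pointStab, Subgroup.mem_inf, mem_fixingSubgroup_iff]

theorem pointStab_anti {A B : Set (G ⧸ Γ)} (h : A ⊆ B) : pointStab Γ B ≤ pointStab Γ A :=
  fun _ hx => mem_pointStab.2 ⟨(mem_pointStab.1 hx).1, fun c hc => (mem_pointStab.1 hx).2 c (h hc)⟩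

theorem isot_eq_pointStab (g : G) : isot Γ g = pointStab Γ {(g : G ⧸ Γ)} := by
  ext x
  simp [mem_isot_iff_smul, mem_pointStab]

theorem isot_mem (g : G) : isot Γ g ∈ subgroupLattice Γ := subset_latticeClosure ⟨g, rfl⟩

variable (Γ) in
theorem self_mem : Γ ∈ subgroupLattice Γ := by
  simpa only [isot_one] using isot_mem (Γ := Γ) 1

theorem inf_mem {H H' : Subgroup G} (h : H ∈ subgroupLattice Γ) (h' : H' ∈ subgroupLattice Γ) :
    H ⊓ H' ∈ subgroupLattice Γ := isSublattice_latticeClosure.infClosed h h'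

theorem pointStab_mem {A : Set (G ⧸ Γ)} (hA : A.Finite) : pointStab Γ A ∈ subgroupLattice Γ := by
  induction A, hA using Set.Finite.induction_on with
  | empty =>
    convert self_mem Γ
    ext x
    simp [mem_pointStab]
  | @insert c A _ _ ih =>
    obtain ⟨g, rfl⟩ := QuotientGroup.mk_surjective c
    convert inf_mem (isot_mem g) ih using 1
    ext x
    simp only [mem_pointStab, Subgroup.mem_inf, mem_isot_iff_smul, Set.mem_insert_iff,
      forall_eq_or_imp]
    tauto

/-- The members of the lattice lie between `Γ` and the pointwise stabilizer in `Γ` of a finite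
subset of `G / Γ`. -/
theorem le_and_exists_pointStab_le {H : Subgroup G} (hH : H ∈ subgroupLattice Γ) :
    H ≤ Γ ∧ ∃ A : Set (G ⧸ Γ), A.Finite ∧ pointStab Γ A ≤ H := by
  induction hH using latticeClosure_sup_inf_induction with
  | mem H h =>
    obtain ⟨g, rfl⟩ := h
    exact ⟨isot_le g, _, Set.finite_singleton _, (isot_eq_pointStab g).ge⟩
  | sup H _ H' _ h h' =>
    obtain ⟨h1, A, hA, hAH⟩ := h
    exact ⟨sup_le h1 h'.1, A, hA, hAH.trans le_sup_left⟩
  | inf H _ H' _ h h' =>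
    obtain ⟨h1, A, hA, hAH⟩ := h
    obtain ⟨-, B, hB, hBH⟩ := h'
    exact ⟨inf_le_left.trans h1, A ∪ B, hA.union hB,
      le_inf ((pointStab_anti Set.subset_union_left).trans hAH)
        ((pointStab_anti Set.subset_union_right).trans hBH)⟩

theorem le_of_mem {H : Subgroup G} (hH : H ∈ subgroupLattice Γ) : H ≤ Γ :=
  (le_and_exists_pointStab_le hH).1

theorem exists_pointStab_le {H : Subgroup G} (hH : H ∈ subgroupLattice Γ) :
    ∃ A : Set (G ⧸ Γ), A.Finite ∧ pointStab Γ A ≤ H := (le_and_exists_pointStab_le hH).2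

/-- Almost normality says that the orbits of `Γ` on `G / Γ` are finite. -/
theorem AlmostNormal.finite_orbit (hΓ : AlmostNormal Γ) (c : G ⧸ Γ) :
    (MulAction.orbit Γ c).Finite := by
  obtain ⟨g, rfl⟩ := QuotientGroup.mk_surjective c
  have h1 : MulAction.stabilizer Γ (g : G ⧸ Γ) = (isot Γ g).subgroupOf Γ := by
    ext x
    rw [MulAction.mem_stabilizer_iff, Subgroup.mem_subgroupOf, mem_isot_iff_smul]
    exact ⟨fun h => ⟨x.2, h⟩, fun h => h.2⟩
  have h2 := hΓ g
  rw [Subgroup.relIndex, ← h1, MulAction.index_stabilizer] at h2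
  exact Set.finite_of_ncard_ne_zero h2

theorem AlmostNormal.finite_smul_image (hΓ : AlmostNormal Γ) {A : Set (G ⧸ Γ)} (hA : A.Finite) :
    {c : G ⧸ Γ | ∃ γ ∈ Γ, ∃ d ∈ A, c = γ • d}.Finite := by
  refine (hA.biUnion fun d _ => hΓ.finite_orbit d).subset ?_
  rintro _ ⟨γ, hγ, d, hd, rfl⟩
  exact Set.mem_biUnion hd ⟨⟨γ, hγ⟩, rfl⟩

/-- Every member of the lattice contains one that is normal in `Γ`: the pointwise stabilizer of a
finite union of orbits of `Γ`. -/
theorem AlmostNormal.exists_normal_le (hΓ : AlmostNormal Γ) {H : Subgroup G}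
    (hH : H ∈ subgroupLattice Γ) :
    ∃ N ∈ subgroupLattice Γ, N ≤ H ∧ (N.subgroupOf Γ).Normal := by
  obtain ⟨A, hA, hAH⟩ := exists_pointStab_le hH
  refine ⟨_, pointStab_mem (hΓ.finite_smul_image hA), (pointStab_anti fun d hd => ?_).trans hAH,
    ⟨?_⟩⟩
  · exact ⟨1, one_mem _, d, hd, (one_smul _ _).symm⟩
  · intro n hn g
    rw [Subgroup.mem_subgroupOf, mem_pointStab] at hn ⊢
    refine ⟨(g * n * g⁻¹).2, ?_⟩
    rintro _ ⟨γ, hγ, d, hd, rfl⟩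
    have h := hn.2 _ ⟨_, mul_mem (inv_mem g.2) hγ, d, hd, rfl⟩
    simp only [Subgroup.coe_mul, Subgroup.coe_inv, mul_smul] at h ⊢
    rw [h, smul_inv_smul]

theorem relIndex_ne_zero_of_mem (hΓ : AlmostNormal Γ) {H : Subgroup G}
    (hH : H ∈ subgroupLattice Γ) : H.relIndex Γ ≠ 0 := by
  induction hH using latticeClosure_sup_inf_induction with
  | mem H h =>
    obtain ⟨g, rfl⟩ := h
    exact hΓ g
  | sup H _ H' _ h h' => exact ne_zero_of_dvd_ne_zero h (Subgroup.relIndex_dvd_of_le_left Γ le_sup_left)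
  | inf H _ H' _ h h' => exact Subgroup.relIndex_inf_ne_zero h h'

/-! ### Closures of members of the lattice -/

/-- Membership in the closure of a member of the lattice can be tested on an element of `G` that
is close enough. -/
theorem exists_mem_clSubgroup_iff {H : Subgroup G} (hH : H ∈ subgroupLattice Γ) :
    ∃ A : Set (G ⧸ Γ), A.Finite ∧ ∀ (s : Schlichting Γ) (g : G), (∀ c ∈ A, s • c = g • c) →
      (s ∈ clSubgroup Γ H ↔ g ∈ H) := by
  obtain ⟨A, hA, hAH⟩ := exists_pointStab_le hH
  have hle := le_of_mem hH
  have key : ∀ g h : G, h ∈ H → g • ((1 : G) : G ⧸ Γ) = h • ((1 : G) : G ⧸ Γ) →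
      (∀ c ∈ A, g • c = h • c) → g ∈ H := fun g h hh h1 h2 => by
    have : h⁻¹ * g ∈ H := hAH <| mem_pointStab.2 ⟨by
      rw [smul_coe_eq_self_of_mem (hle hh), smul_coe_eq_self_iff] at h1
      exact mul_mem (inv_mem (hle hh)) h1, fun c hc => by rw [mul_smul, h2 c hc, inv_smul_smul]⟩
    simpa using mul_mem hh this
  refine ⟨insert ((1 : G) : G ⧸ Γ) A, hA.insert _, fun s g hs => ?_⟩
  rw [mem_clSubgroup]
  constructor
  · intro h
    obtain ⟨h, hh, hA'⟩ := mem_cl_iff.1 h _ (hA.insert ((1 : G) : G ⧸ Γ))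
    have hgh : ∀ c ∈ insert ((1 : G) : G ⧸ Γ) A, g • c = h • c :=
      fun c hc => (hs c hc).symm.trans (hA' c hc)
    exact key g h hh (hgh _ (Set.mem_insert _ _)) fun c hc => hgh c (Set.mem_insert_of_mem _ hc)
  · intro hg
    refine mem_cl_iff.2 fun B hB => ?_
    obtain ⟨h, hh⟩ := exists_approx_set s ((hA.insert ((1 : G) : G ⧸ Γ)).union hB)
    have hgh : ∀ c ∈ insert ((1 : G) : G ⧸ Γ) A, h • c = g • c :=
      fun c hc => (hh c (Or.inl hc)).symm.trans (hs c hc)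
    exact ⟨h, key h g hg (hgh _ (Set.mem_insert _ _)) fun c hc => hgh c (Set.mem_insert_of_mem _ hc),
      fun c hc => hh c (Or.inr hc)⟩

theorem emb_mem_clSubgroup_iff {H : Subgroup G} (hH : H ∈ subgroupLattice Γ) (g : G) :
    emb Γ g ∈ clSubgroup Γ H ↔ g ∈ H := by
  obtain ⟨A, -, h⟩ := exists_mem_clSubgroup_iff hH
  exact h _ _ fun c _ => rfl

theorem mem_clSubgroup_pointStab {A : Set (G ⧸ Γ)} (hA : A.Finite) {s : Schlichting Γ}
    (hs : s • ((1 : G) : G ⧸ Γ) = ((1 : G) : G ⧸ Γ)) (h : ∀ c ∈ A, s • c = c) :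
    s ∈ clSubgroup Γ (pointStab Γ A) := by
  rw [mem_clSubgroup, mem_cl_iff]
  intro B hB
  obtain ⟨g, hg⟩ := exists_approx_set s ((hA.insert ((1 : G) : G ⧸ Γ)).union hB)
  refine ⟨g, mem_pointStab.2 ⟨?_, fun c hc => ?_⟩, fun c hc => hg c (Or.inr hc)⟩
  · rw [← smul_coe_eq_self_iff, ← hg _ (Or.inl (Set.mem_insert _ _)), hs]
  · rw [← hg _ (Or.inl (Set.mem_insert_of_mem _ hc)), h c hc]

theorem mem_clSubgroup_isot {g : G} {s : Schlichting Γ} :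
    s ∈ clSubgroup Γ (isot Γ g) ↔
      s • ((1 : G) : G ⧸ Γ) = ((1 : G) : G ⧸ Γ) ∧ s • (g : G ⧸ Γ) = g := by
  constructor
  · intro h
    rw [mem_clSubgroup] at h
    exact ⟨smul_eq_of_mem_cl h fun x hx => smul_coe_eq_self_of_mem (isot_le g hx),
      smul_eq_of_mem_cl h fun x hx => (mem_isot_iff_smul.1 hx).2⟩
  · rintro ⟨h1, h2⟩
    rw [isot_eq_pointStab]
    refine mem_clSubgroup_pointStab (Set.finite_singleton _) h1 ?_
    rintro _ rfl
    exact h2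

end Lattice

/-! ### The profinite completion of `Γ` -/

namespace ProfiniteCompl

variable {G : Type*} [Group G] {Γ : Subgroup G}

open Schlichting

/-- The component at `N` of an element of the profinite completion. -/
def comp (f : ProfiniteCompl Γ) (N : NormalIndex Γ) : Γ ⧸ N.1 := f.1 N

theorem comp_compat (f : ProfiniteCompl Γ) {N M : NormalIndex Γ} (h : N.1 ≤ M.1) {γ : Γ}
    (hγ : comp f N = γ) : comp f M = γ := by
  have h1 := f.2 N M h
  have h2 : f.1 N = γ := hγ
  rw [h2] at h1
  exact h1.symm

theorem comp_one (N : NormalIndex Γ) : comp 1 N = ((1 : Γ) : Γ ⧸ N.1) := rfl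

theorem comp_mul (f f' : ProfiniteCompl Γ) (N : NormalIndex Γ) :
    comp (f * f') N = comp f N * comp f' N := rfl

theorem ext' {f f' : ProfiniteCompl Γ} (h : ∀ N, comp f N = comp f' N) : f = f' :=
  Subtype.ext (funext h)

/-- `N` acts trivially on the finite set `A`. -/
def Fixes (N : NormalIndex Γ) (A : Set (G ⧸ Γ)) : Prop := ∀ γ ∈ N.1, ∀ c ∈ A, (γ : G) • c = c

theorem exists_fixes (hΓ : AlmostNormal Γ) {A : Set (G ⧸ Γ)} (hA : A.Finite) :
    ∃ N : NormalIndex Γ, Fixes N A := by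
  obtain ⟨N, hN, hle, hn⟩ := hΓ.exists_normal_le (pointStab_mem hA)
  refine ⟨⟨N.subgroupOf Γ, hn, ?_⟩, fun γ hγ => (mem_pointStab.1 (hle hγ)).2⟩
  rwa [Subgroup.map_subgroupOf_eq_of_le (le_of_mem hN)]

theorem exists_fixes_le (hΓ : AlmostNormal Γ) {A : Set (G ⧸ Γ)} (hA : A.Finite)
    (M : NormalIndex Γ) : ∃ N : NormalIndex Γ, Fixes N A ∧ N.1 ≤ M.1 := by
  obtain ⟨B, hB, hBM⟩ := exists_pointStab_le M.2.2
  obtain ⟨N, hN⟩ := exists_fixes hΓ (hA.union hB)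
  refine ⟨N, fun γ hγ c hc => hN γ hγ c (Or.inl hc), fun γ hγ => ?_⟩
  obtain ⟨m, hm, hmγ⟩ := hBM (mem_pointStab.2 ⟨γ.2, fun c hc => hN γ hγ c (Or.inr hc)⟩)
  rwa [← Subtype.ext hmγ]

theorem exists_inf (N M : NormalIndex Γ) : ∃ P : NormalIndex Γ, P.1 ≤ N.1 ∧ P.1 ≤ M.1 := by
  refine ⟨⟨N.1 ⊓ M.1, inferInstance, ?_⟩, inf_le_left, inf_le_right⟩
  rw [Subgroup.map_inf _ _ _ Γ.subtype_injective]
  exact inf_mem N.2.2 M.2.2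

theorem Fixes.smul_eq {N : NormalIndex Γ} {A : Set (G ⧸ Γ)} (h : Fixes N A) {γ δ : Γ}
    (hγδ : (γ : Γ ⧸ N.1) = δ) {c : G ⧸ Γ} (hc : c ∈ A) : (γ : G) • c = (δ : G) • c := by
  have := h _ (QuotientGroup.eq.1 hγδ) c hc
  rw [Subgroup.coe_mul, Subgroup.coe_inv, mul_smul, inv_smul_eq_iff] at this
  exact this.symm

theorem smul_eq_of_fixes (f : ProfiniteCompl Γ) {N M : NormalIndex Γ} {c : G ⧸ Γ}
    (hN : Fixes N {c}) (hM : Fixes M {c}) {γ δ : Γ} (hγ : comp f N = γ) (hδ : comp f M = δ) :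
    (γ : G) • c = (δ : G) • c := by
  obtain ⟨P, hPN, hPM⟩ := exists_inf N M
  obtain ⟨ε, hε⟩ := QuotientGroup.mk_surjective (comp f P)
  rw [hN.smul_eq (hγ.symm.trans (comp_compat f hPN hε.symm)) rfl,
    hM.smul_eq (hδ.symm.trans (comp_compat f hPM hε.symm)) rfl]

/-- The action of the profinite completion on `G / Γ`: on a point `c`, an element acts like a
representative of its component at any `N` that fixes `c`. -/
theorem exists_act (hΓ : AlmostNormal Γ) (f : ProfiniteCompl Γ) (c : G ⧸ Γ) :
    ∃ d : G ⧸ Γ, ∀ (N : NormalIndex Γ) (γ : Γ), Fixes N {c} → comp f N = γ → (γ : G) • c = d := by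
  obtain ⟨N, hN⟩ := exists_fixes hΓ (Set.finite_singleton c)
  obtain ⟨γ, hγ⟩ := QuotientGroup.mk_surjective (comp f N)
  exact ⟨(γ : G) • c, fun M δ hM hδ => smul_eq_of_fixes f hM hN hδ hγ.symm⟩

/-- The function underlying the action of the profinite completion on `G / Γ`. -/
noncomputable def act (hΓ : AlmostNormal Γ) (f : ProfiniteCompl Γ) (c : G ⧸ Γ) : G ⧸ Γ :=
  (exists_act hΓ f c).choose

theorem act_eq (hΓ : AlmostNormal Γ) (f : ProfiniteCompl Γ) {A : Set (G ⧸ Γ)} {N : NormalIndex Γ}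
    (hN : Fixes N A) {γ : Γ} (hγ : comp f N = γ) {c : G ⧸ Γ} (hc : c ∈ A) :
    act hΓ f c = (γ : G) • c :=
  ((exists_act hΓ f c).choose_spec N γ (fun δ hδ d hd => hN δ hδ d (by rwa [hd])) hγ).symm

theorem act_one (hΓ : AlmostNormal Γ) (c : G ⧸ Γ) : act hΓ 1 c = c := by
  obtain ⟨N, hN⟩ := exists_fixes hΓ (Set.finite_singleton c)
  rw [act_eq hΓ 1 hN (comp_one N) rfl, Subgroup.coe_one, one_smul]

theorem act_mul (hΓ : AlmostNormal Γ) (f f' : ProfiniteCompl Γ) (c : G ⧸ Γ) :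
    act hΓ (f * f') c = act hΓ f (act hΓ f' c) := by
  obtain ⟨N, hN⟩ := exists_fixes hΓ (A := {c, act hΓ f' c}) (Set.toFinite _)
  obtain ⟨γ, hγ⟩ := QuotientGroup.mk_surjective (comp f N)
  obtain ⟨δ, hδ⟩ := QuotientGroup.mk_surjective (comp f' N)
  have h1 : comp (f * f') N = ((γ * δ : Γ) : Γ ⧸ N.1) := by
    rw [comp_mul, ← hγ, ← hδ]
    rfl
  rw [act_eq hΓ (f * f') hN h1 (by simp), act_eq hΓ f hN hγ.symm (by simp),
    act_eq hΓ f' hN hδ.symm (by simp), Subgroup.coe_mul, mul_smul]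

/-- The action of the profinite completion on `G / Γ` by permutations. -/
noncomputable def actPerm (hΓ : AlmostNormal Γ) : ProfiniteCompl Γ →* Equiv.Perm (G ⧸ Γ) where
  toFun f :=
    { toFun := act hΓ f
      invFun := act hΓ f⁻¹
      left_inv := fun c => by rw [← act_mul, inv_mul_cancel, act_one]
      right_inv := fun c => by rw [← act_mul, mul_inv_cancel, act_one] }
  map_one' := Equiv.ext (act_one hΓ)
  map_mul' f f' := Equiv.ext (act_mul hΓ f f')

theorem exists_act_eq (hΓ : AlmostNormal Γ) (f : ProfiniteCompl Γ) {A : Set (G ⧸ Γ)}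
    (hA : A.Finite) : ∃ γ : Γ, ∀ c ∈ A, act hΓ f c = (γ : G) • c := by
  obtain ⟨N, hN⟩ := exists_fixes hΓ hA
  obtain ⟨γ, hγ⟩ := QuotientGroup.mk_surjective (comp f N)
  exact ⟨γ, fun c hc => act_eq hΓ f hN hγ.symm hc⟩

/-- The homomorphism of the profinite completion into `𝒮`. -/
noncomputable def toSchlichting (hΓ : AlmostNormal Γ) : ProfiniteCompl Γ →* Schlichting Γ :=
  (actPerm hΓ).codRestrict (schlichtingSubgroup Γ) fun f A => by
    obtain ⟨γ, hγ⟩ := exists_act_eq hΓ f A.finite_toSet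
    exact ⟨γ, hγ⟩

theorem toSchlichting_smul (hΓ : AlmostNormal Γ) (f : ProfiniteCompl Γ) (c : G ⧸ Γ) :
    toSchlichting hΓ f • c = act hΓ f c := rfl

theorem toSchlichting_mem (hΓ : AlmostNormal Γ) (f : ProfiniteCompl Γ) :
    toSchlichting hΓ f ∈ compactSubgroup Γ := by
  obtain ⟨γ, hγ⟩ := exists_act_eq hΓ f (Set.finite_singleton ((1 : G) : G ⧸ Γ))
  rw [mem_compactSubgroup, toSchlichting_smul, hγ _ rfl, smul_coe_eq_self_of_mem γ.2]

theorem toSchlichting_toProfinite (hΓ : AlmostNormal Γ) (γ : Γ) :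
    toSchlichting hΓ (toProfinite Γ γ) = emb Γ (γ : G) := by
  refine Schlichting.ext' fun c => ?_
  obtain ⟨N, hN⟩ := exists_fixes hΓ (Set.finite_singleton c)
  exact act_eq hΓ _ hN (γ := γ) rfl rfl

theorem toSchlichting_injective (hΓ : AlmostNormal Γ) :
    Function.Injective (toSchlichting hΓ) := by
  rw [injective_iff_map_eq_one]
  intro f hf
  refine ProfiniteCompl.ext' fun N => ?_
  obtain ⟨A, hA, hAN⟩ := exists_pointStab_le N.2.2
  obtain ⟨M, hM, hMN⟩ := exists_fixes_le hΓ hA N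
  obtain ⟨γ, hγ⟩ := QuotientGroup.mk_surjective (comp f M)
  rw [comp_compat f hMN hγ.symm, comp_one, QuotientGroup.eq, mul_one]
  have h : (γ : G) ∈ N.1.map Γ.subtype := hAN (mem_pointStab.2 ⟨γ.2, fun c hc => by
    rw [← act_eq hΓ f hM hγ.symm hc, ← toSchlichting_smul, hf, one_smul]⟩)
  obtain ⟨δ, hδ, hδγ⟩ := h
  rw [← Subtype.ext hδγ]
  exact inv_mem hδ

/-- Elements of `Γ` that agree on a large enough finite set are congruent modulo `N`. -/
theorem exists_finite_determines (N : NormalIndex Γ) : ∃ A : Set (G ⧸ Γ), A.Finite ∧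
    ∀ γ δ : Γ, (∀ c ∈ A, (γ : G) • c = (δ : G) • c) → (γ : Γ ⧸ N.1) = δ := by
  obtain ⟨A, hA, hAN⟩ := exists_pointStab_le N.2.2
  refine ⟨A, hA, fun γ δ h => QuotientGroup.eq.2 ?_⟩
  obtain ⟨ε, hε, h'⟩ := hAN (x := ((γ⁻¹ * δ : Γ) : G)) (mem_pointStab.2 ⟨(γ⁻¹ * δ).2, fun c hc => by
    rw [Subgroup.coe_mul, Subgroup.coe_inv, mul_smul, inv_smul_eq_iff, h c hc]⟩)
  rwa [← Subtype.ext h']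

theorem exists_approx_mem {s : Schlichting Γ} (hs : s ∈ compactSubgroup Γ) {A : Set (G ⧸ Γ)}
    (hA : A.Finite) : ∃ γ : Γ, ∀ c ∈ A, s • c = (γ : G) • c := by
  obtain ⟨γ, hγ, h⟩ := mem_cl_iff.1 (show s ∈ cl Γ (Γ : Set G) by
    rwa [← coe_compactSubgroup_eq_cl]) A hA
  exact ⟨⟨γ, hγ⟩, h⟩

theorem exists_toSchlichting_eq (hΓ : AlmostNormal Γ) {s : Schlichting Γ}
    (hs : s ∈ compactSubgroup Γ) : ∃ f, toSchlichting hΓ f = s := by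
  choose A hA hdet using exists_finite_determines (Γ := Γ)
  choose γ hγ using fun N => exists_approx_mem hs (hA N)
  have key : ∀ (N : NormalIndex Γ) (δ : Γ), (∀ c ∈ A N, s • c = (δ : G) • c) →
      (γ N : Γ ⧸ N.1) = δ := fun N δ h => hdet N _ _ fun c hc => by rw [← hγ N c hc, h c hc]
  have hf : (fun N => (γ N : Γ ⧸ N.1) : ∀ N : NormalIndex Γ, Γ ⧸ N.1) ∈ profiniteSubgroup Γ := by
    intro N M h
    obtain ⟨δ, hδ⟩ := exists_approx_mem hs ((hA N).union (hA M))
    have h1 := key N δ fun c hc => hδ c (Or.inl hc)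
    have h2 := key M δ fun c hc => hδ c (Or.inr hc)
    exact (congrArg (QuotientGroup.map N.1 M.1 (MonoidHom.id Γ) h) h1).trans h2.symm
  let f : ProfiniteCompl Γ := (⟨_, hf⟩ : profiniteSubgroup Γ)
  refine ⟨f, Schlichting.ext' fun c => ?_⟩
  obtain ⟨N, hN⟩ := exists_fixes hΓ (Set.finite_singleton c)
  obtain ⟨δ, hδ⟩ := exists_approx_mem hs ((hA N).insert c)
  have h : comp f N = δ := key N δ fun c hc => hδ c (Set.mem_insert_of_mem _ hc)
  exact (act_eq hΓ f hN h rfl).trans (hδ c (Set.mem_insert _ _)).symm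

theorem isOpen_comp (N : NormalIndex Γ) (q : Γ ⧸ N.1) :
    IsOpen {f : ProfiniteCompl Γ | comp f N = q} := by
  let _ : ∀ N : NormalIndex Γ, TopologicalSpace (Γ ⧸ N.1) := fun _ => ⊥
  have : ∀ N : NormalIndex Γ, DiscreteTopology (Γ ⧸ N.1) := fun _ => ⟨rfl⟩
  refine isOpen_induced_iff.2 ⟨(fun f : ∀ N : NormalIndex Γ, Γ ⧸ N.1 => f N) ⁻¹' {q}, ?_, rfl⟩
  exact (isOpen_discrete ({q} : Set (Γ ⧸ N.1))).preimage
    (continuous_apply (A := fun N : NormalIndex Γ => Γ ⧸ N.1) N)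

theorem continuous_toSchlichting (hΓ : AlmostNormal Γ) : Continuous (toSchlichting hΓ) := by
  refine continuous_iff_continuousAt.2 fun f U hU => ?_
  obtain ⟨A, hA, h⟩ := Schlichting.mem_nhds_iff.1 hU
  obtain ⟨N, hN⟩ := exists_fixes hΓ hA
  obtain ⟨γ, hγ⟩ := QuotientGroup.mk_surjective (comp f N)
  rw [Filter.mem_map]
  filter_upwards [(isOpen_comp N (γ : Γ ⧸ N.1)).mem_nhds hγ.symm] with f' hf'
  refine h _ fun c hc => ?_
  rw [toSchlichting_smul, toSchlichting_smul, act_eq hΓ f' hN hf' hc, act_eq hΓ f hN hγ.symm hc]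

/-- The profinite completion is compact, as a closed subspace of a product of finite spaces. -/
theorem compactSpace (hΓ : AlmostNormal Γ) : CompactSpace (ProfiniteCompl Γ) := by
  let _ : ∀ N : NormalIndex Γ, TopologicalSpace (Γ ⧸ N.1) := fun _ => ⊥
  have hd : ∀ N : NormalIndex Γ, DiscreteTopology (Γ ⧸ N.1) := fun _ => ⟨rfl⟩
  have hfin : ∀ N : NormalIndex Γ, Finite (Γ ⧸ N.1) := fun N => by
    have h := relIndex_ne_zero_of_mem hΓ N.2.2
    rw [Subgroup.relIndex, Subgroup.subgroupOf, Subgroup.comap_map_eq_self_of_injective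
      Γ.subtype_injective] at h
    exact Nat.finite_of_card_ne_zero h
  have hcl : IsClosed (profiniteSubgroup Γ : Set (∀ N : NormalIndex Γ, Γ ⧸ N.1)) := by
    have : (profiniteSubgroup Γ : Set (∀ N : NormalIndex Γ, Γ ⧸ N.1)) =
        ⋂ (N : NormalIndex Γ) (M : NormalIndex Γ) (h : N.1 ≤ M.1),
          {f | QuotientGroup.map N.1 M.1 (MonoidHom.id Γ) h (f N) = f M} := by
      ext f
      simp only [Set.mem_iInter]
      rfl
    rw [this]
    refine isClosed_iInter fun N => isClosed_iInter fun M => isClosed_iInter fun h => ?_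
    exact isClosed_eq (continuous_of_discreteTopology.comp (continuous_apply N))
      (continuous_apply M)
  have hc : CompactSpace (profiniteSubgroup Γ : Set (∀ N : NormalIndex Γ, Γ ⧸ N.1)) :=
    isCompact_iff_compactSpace.1 hcl.isCompact
  exact hc

theorem isCompact_compactSubgroup (hΓ : AlmostNormal Γ) :
    IsCompact (compactSubgroup Γ : Set (Schlichting Γ)) := by
  have := compactSpace hΓ
  convert isCompact_range (continuous_toSchlichting hΓ)
  ext s
  constructor
  · intro hs
    exact exists_toSchlichting_eq hΓ hs
  · rintro ⟨f, rfl⟩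
    exact toSchlichting_mem hΓ f

theorem exists_mulEquiv (hΓ : AlmostNormal Γ) :
    ∃ e : ProfiniteCompl Γ ≃* compactSubgroup Γ, Continuous e ∧ Continuous e.symm ∧
        ∀ γ : Γ, (e (toProfinite Γ γ) : Schlichting Γ) = emb Γ (γ : G) := by
  have := compactSpace hΓ
  let φ : ProfiniteCompl Γ →* compactSubgroup Γ :=
    (toSchlichting hΓ).codRestrict _ (toSchlichting_mem hΓ)
  have hφ : Function.Bijective φ := by
    refine ⟨fun f f' h => toSchlichting_injective hΓ (congrArg Subtype.val h), fun s => ?_⟩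
    obtain ⟨f, hf⟩ := exists_toSchlichting_eq hΓ s.2
    exact ⟨f, Subtype.ext hf⟩
  have hc : Continuous φ := (continuous_toSchlichting hΓ).subtype_mk _
  refine ⟨MulEquiv.ofBijective φ hφ, hc, ?_, toSchlichting_toProfinite hΓ⟩
  exact (Continuous.homeoOfEquivCompactToT2 (f := (MulEquiv.ofBijective φ hφ).toEquiv)
    hc).symm.continuous

end ProfiniteCompl

namespace Schlichting

variable {G : Type*} [Group G] {Γ : Subgroup G}

theorem locallyCompactSpace (hΓ : AlmostNormal Γ) : LocallyCompactSpace (Schlichting Γ) :=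
  (ProfiniteCompl.isCompact_compactSubgroup hΓ).locallyCompactSpace_of_mem_nhds_of_group
    (isOpen_compactSubgroup.mem_nhds (one_mem (compactSubgroup Γ)))

theorem existsUnique_haar [Countable G] (hΓ : AlmostNormal Γ) :
    ∃! m : Measure (Schlichting Γ), m.IsHaarMeasure ∧
      m (compactSubgroup Γ : Set (Schlichting Γ)) = 1 := by
  have := locallyCompactSpace hΓ
  let K : TopologicalSpace.PositiveCompacts (Schlichting Γ) :=
    ⟨⟨compactSubgroup Γ, ProfiniteCompl.isCompact_compactSubgroup hΓ⟩, by
      change (interior (compactSubgroup Γ : Set (Schlichting Γ))).Nonempty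
      rw [isOpen_compactSubgroup.interior_eq]
      exact ⟨1, one_mem (compactSubgroup Γ)⟩⟩
  refine ⟨Measure.haarMeasure K, ⟨inferInstance, Measure.haarMeasure_self⟩, ?_⟩
  rintro m ⟨hm, h1⟩
  have h := Measure.haarMeasure_unique m K
  rw [show m K = 1 from h1, one_smul] at h
  exact h

end Schlichting

/-! ### The partial transformations of the space of normalized sections -/

section Sections

variable {G : Type*} [Group G] {Γ : Subgroup G}

open Schlichting

theorem mem_cyl_smul {g a : G} {D : Set G} {y : YSpace Γ} :
    y ∈ cyl Γ g (a • D) ↔ emb Γ a⁻¹ * y g ∈ cl Γ D := by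
  rw [map_inv]
  exact cl_smul a D (y g)

theorem coe_mul_of_mem (g : G) {γ : G} (hγ : γ ∈ Γ) : ((g * γ : G) : G ⧸ Γ) = g :=
  QuotientGroup.mk_mul_of_mem g hγ

theorem smul_coe (g h : G) : g • (h : G ⧸ Γ) = ((g * h : G) : G ⧸ Γ) := rfl

theorem conj_mem_clSubgroup {H H' : Subgroup G} {a : G} (h : ∀ x ∈ H, a * x * a⁻¹ ∈ H')
    {k : Schlichting Γ} (hk : k ∈ clSubgroup Γ H) :
    emb Γ a * k * emb Γ a⁻¹ ∈ clSubgroup Γ H' := by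
  rw [mem_clSubgroup] at hk ⊢
  refine map_mem_closure (f := fun k => emb Γ a * k * emb Γ a⁻¹) (by fun_prop) hk ?_
  rintro _ ⟨x, hx, rfl⟩
  exact ⟨_, h x hx, by simp only [map_mul]⟩

/-- On normalized sections, membership in the cylinder sets of the relations only says where the
permutations that are their entries send certain cosets. -/
theorem mem_initialCyl_iff {y : YSpace Γ} (hy : y ∈ normalizedSections Γ) {g α : G} (hα : α ∈ Γ) :
    y ∈ initialCyl Γ g α ↔
      y ((g⁻¹ : G) : G ⧸ Γ) • ((α⁻¹ * g : G) : G ⧸ Γ) = ((1 : G) : G ⧸ Γ) := by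
  rw [initialCyl, mem_cyl_smul, cl_mul_singleton, ← mem_clSubgroup, mem_clSubgroup_isot, inv_inv,
    ← map_inv]
  simp only [mul_smul, emb_smul]
  rw [smul_coe_eq_self_of_mem (inv_mem hα), hy.1, smul_coe, mul_inv_cancel, smul_coe,
    ← eq_inv_smul_iff (b := (g : G ⧸ Γ)), smul_coe, inv_mul_cancel]
  exact and_iff_right rfl

theorem mem_finalCyl_iff {y : YSpace Γ} (hy : y ∈ normalizedSections Γ) {g α : G} (hα : α ∈ Γ) :
    y ∈ finalCyl Γ g α ↔
      y ((α⁻¹ * g : G) : G ⧸ Γ) • ((g⁻¹ : G) : G ⧸ Γ) = ((1 : G) : G ⧸ Γ) := by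
  rw [finalCyl, mem_cyl_smul, ← mem_clSubgroup, mem_clSubgroup_isot]
  simp only [mul_smul, emb_smul]
  rw [hy.1, smul_coe, inv_mul_cancel, ← eq_inv_smul_iff (b := ((g⁻¹ : G) : G ⧸ Γ)), smul_coe,
    inv_inv, mul_assoc, mul_inv_cancel, mul_one, ← smul_coe_one α⁻¹,
    smul_coe_eq_self_of_mem (inv_mem hα)]
  exact and_iff_right rfl

theorem mem_compCyl_iff {y : YSpace Γ} (hy : y ∈ normalizedSections Γ) {h r g : G} :
    y ∈ compCyl Γ h r g ↔
      y (((r * g)⁻¹ : G) : G ⧸ Γ) • ((h⁻¹ : G) : G ⧸ Γ) = (((r * g)⁻¹ * h⁻¹ : G) : G ⧸ Γ) := by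
  rw [compCyl, mem_cyl_smul, ← mem_clSubgroup, mem_clSubgroup_isot]
  simp only [mul_smul, emb_smul]
  rw [hy.1, smul_coe, inv_mul_cancel, ← eq_inv_smul_iff (b := ((h⁻¹ : G) : G ⧸ Γ)), smul_coe,
    inv_inv]
  exact and_iff_right rfl

theorem finalCyl_iff_initialCyl {y : YSpace Γ} (hy : y ∈ normalizedSections Γ) {g α : G}
    (hα : α ∈ Γ) : y ∈ finalCyl Γ g α ↔ y ∈ initialCyl Γ (g⁻¹ * α) 1 := by
  rw [mem_finalCyl_iff hy hα, mem_initialCyl_iff hy (one_mem _), mul_inv_rev, inv_inv, inv_one,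
    one_mul, coe_mul_of_mem _ hα]

theorem finalCyl_inv_iff_initialCyl {y : YSpace Γ} (hy : y ∈ normalizedSections Γ) {g α : G}
    (hα : α ∈ Γ) : y ∈ finalCyl Γ (g⁻¹ * α) 1 ↔ y ∈ initialCyl Γ g α := by
  rw [mem_finalCyl_iff hy (one_mem _), mem_initialCyl_iff hy hα, mul_inv_rev, inv_inv, inv_one,
    one_mul, coe_mul_of_mem _ hα]

theorem shift_apply (g : G) (y : YSpace Γ) (c : G ⧸ Γ) :
    shift Γ g y c = (y ((g⁻¹ : G) : G ⧸ Γ))⁻¹ * y (y ((g⁻¹ : G) : G ⧸ Γ) • c) := rfl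

theorem shift_mem {y : YSpace Γ} (hy : y ∈ normalizedSections Γ) (g : G) :
    shift Γ g y ∈ normalizedSections Γ := by
  refine ⟨fun c => ?_, ?_⟩
  · rw [shift_apply, mul_smul, hy.1, inv_smul_smul]
  · rw [shift_apply, hy.1, inv_mul_cancel]

/-- The composition `shift g₁ ∘ shift g₂` is, at `y`, one of the `shift g₃`. -/
theorem shift_shift {y : YSpace Γ} {g₁ g₂ g₃ : G}
    (h : y ((g₂⁻¹ : G) : G ⧸ Γ) • ((g₁⁻¹ : G) : G ⧸ Γ) = ((g₃⁻¹ : G) : G ⧸ Γ)) :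
    shift Γ g₁ (shift Γ g₂ y) = shift Γ g₃ y := by
  funext c
  simp only [shift_apply, h, mul_smul, smul_inv_smul]
  group

theorem shift_of_coe_eq_one {y : YSpace Γ} (hy : y ∈ normalizedSections Γ) {g : G}
    (hg : ((g⁻¹ : G) : G ⧸ Γ) = ((1 : G) : G ⧸ Γ)) : shift Γ g y = y := by
  funext c
  rw [shift_apply, hg, hy.2, one_smul, inv_one, one_mul]

theorem shift_inv_shift {y : YSpace Γ} (hy : y ∈ normalizedSections Γ) {g α : G} (hα : α ∈ Γ)
    (h : y ∈ initialCyl Γ g α) : shift Γ (g⁻¹ * α) (shift Γ g y) = y := by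
  rw [shift_shift (g₃ := 1), shift_of_coe_eq_one hy (by rw [inv_one])]
  rwa [mem_initialCyl_iff hy hα, ← inv_one, ← inv_inv g, ← mul_inv_rev, inv_inv] at h

theorem shift_mem_finalCyl {y : YSpace Γ} (hy : y ∈ normalizedSections Γ) {g α : G} (hα : α ∈ Γ)
    (h : y ∈ initialCyl Γ g α) : shift Γ g y ∈ finalCyl Γ g α := by
  rw [mem_initialCyl_iff hy hα] at h
  rw [mem_finalCyl_iff (shift_mem hy g) hα, shift_apply, h, hy.2, mul_one, inv_smul_eq_iff, hy.1]

/-- The inverse of `shift g` on its domain labelled by `α` is `shift (g⁻¹α)`. -/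
theorem shift_bijOn {g α : G} (hα : α ∈ Γ) :
    Set.BijOn (shift Γ g) (initialCyl Γ g α ∩ normalizedSections Γ)
      (finalCyl Γ g α ∩ normalizedSections Γ) := by
  refine Set.InvOn.bijOn (f' := shift Γ (g⁻¹ * α)) ⟨?_, ?_⟩ ?_ ?_
  · rintro y ⟨h, hy⟩
    exact shift_inv_shift hy hα h
  · rintro y ⟨h, hy⟩
    rw [shift_shift (g₃ := 1), shift_of_coe_eq_one hy (by rw [inv_one])]
    rwa [mem_finalCyl_iff hy hα, ← inv_one, ← inv_inv g, ← mul_inv_rev, inv_inv] at h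
  · rintro y ⟨h, hy⟩
    exact ⟨shift_mem_finalCyl hy hα h, shift_mem hy g⟩
  · rintro y ⟨h, hy⟩
    have h1 := shift_mem_finalCyl hy (one_mem Γ) ((finalCyl_iff_initialCyl hy hα).1 h)
    exact ⟨(finalCyl_inv_iff_initialCyl (shift_mem hy _) hα).1 h1, shift_mem hy _⟩

end Sections

/-! ### Systems of representatives and cylinder sets -/

section Transversals

variable {G : Type*} [Group G] {Γ : Subgroup G}

open Schlichting

theorem exists_rightTransversal {H : Subgroup G} (h : H.relIndex Γ ≠ 0) :
    ∃ r : Fin (H.relIndex Γ) → G, IsRightTransversal H Γ r := by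
  have : Finite (Γ ⧸ H.subgroupOf Γ) := Nat.finite_of_card_ne_zero h
  let e : Fin (H.relIndex Γ) ≃ Γ ⧸ H.subgroupOf Γ := (Finite.equivFin _).symm
  refine ⟨fun j => ((e j).out : G)⁻¹, fun j => inv_mem (e j).out.2, fun γ hγ => ?_⟩
  have key : ∀ j, γ * ((((e j).out : Γ) : G)⁻¹)⁻¹ ∈ H ↔
      j = e.symm (((⟨γ, hγ⟩ : Γ)⁻¹ : Γ) : Γ ⧸ H.subgroupOf Γ) := fun j => by
    rw [Equiv.eq_symm_apply, ← QuotientGroup.out_eq' (e j), eq_comm, QuotientGroup.eq,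
      Subgroup.mem_subgroupOf, QuotientGroup.out_eq']
    simp
  exact ⟨_, (key _).2 rfl, fun j hj => (key j).1 hj⟩

/-- The entry of a normalized section at `g⁻¹Γ` acts at any given point like `g⁻¹γ`, `γ ∈ Γ`. -/
theorem exists_approx_section {y : YSpace Γ} (hy : y ∈ normalizedSections Γ) (g : G) (c : G ⧸ Γ) :
    ∃ γ ∈ Γ, y ((g⁻¹ : G) : G ⧸ Γ) • c = (g⁻¹ * γ) • c := by
  obtain ⟨_, ⟨γ, hγ, rfl⟩, h⟩ := mem_cl_iff.1 (smul_one_eq_iff.1 (hy.1 ((g⁻¹ : G) : G ⧸ Γ)))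
    {c} (Set.finite_singleton c)
  exact ⟨γ, hγ, h c rfl⟩

/-- The sets of the composition formula form a partition. -/
theorem existsUnique_mem_compCyl {y : YSpace Γ} (hy : y ∈ normalizedSections Γ) {g₁ : G} (g₂ : G)
    {n : ℕ} {r : Fin n → G} (hr : IsRightTransversal (isot Γ g₁⁻¹) Γ r) :
    ∃! j, y ∈ compCyl Γ g₁ (r j) g₂ := by
  obtain ⟨γ, hγ, h⟩ := exists_approx_section hy g₂ ((g₁⁻¹ : G) : G ⧸ Γ)
  refine (existsUnique_congr fun j => ?_).1 (hr.2 _ (inv_mem hγ))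
  rw [mem_compCyl_iff hy, mul_inv_rev, coe_mul_of_mem _ (inv_mem (hr.1 j)), h, smul_coe_eq_iff,
    ← inv_mem_iff, mem_isot, and_iff_right (inv_mem (mul_mem (inv_mem hγ) (inv_mem (hr.1 j))))]
  simp [mul_assoc]

/-- The domains of bijectivity of `shift g` form a partition. -/
theorem existsUnique_mem_initialCyl {y : YSpace Γ} (hy : y ∈ normalizedSections Γ) {g : G}
    {n : ℕ} {r : Fin n → G} (hr : IsRightTransversal (isot Γ g) Γ r) :
    ∃! j, y ∈ initialCyl Γ g (r j) := by
  obtain ⟨_, ⟨γ, hγ, rfl⟩, h⟩ := mem_cl_iff.1 (smul_one_eq_iff.1 (hy.1 ((g⁻¹ : G) : G ⧸ Γ)))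
    (Set.range fun j => (((r j)⁻¹ * g : G) : G ⧸ Γ)) (Set.finite_range _)
  refine (existsUnique_congr fun j => ?_).1 (hr.2 _ hγ)
  rw [mem_initialCyl_iff hy (hr.1 j), h _ ⟨j, rfl⟩, smul_coe_eq_iff, mem_isot,
    and_iff_right (mul_mem hγ (inv_mem (hr.1 j)))]
  simp [mul_assoc]

/-- On the `j`-th set of the composition formula for `g⁻¹α` and `g`, intersected with the domain
of `g` and `α`, the composite is the identity. -/
theorem mem_of_mem_compCyl_of_mem_initialCyl {y : YSpace Γ} (hy : y ∈ normalizedSections Γ)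
    {g α r : G} (hα : α ∈ Γ) (hr : r ∈ Γ) (h1 : y ∈ compCyl Γ (g⁻¹ * α) r g)
    (h2 : y ∈ initialCyl Γ g α) : g⁻¹ * α * r * g ∈ Γ := by
  rw [mem_compCyl_iff hy, mul_inv_rev, coe_mul_of_mem _ (inv_mem hr), mul_inv_rev, inv_inv,
    (mem_initialCyl_iff hy hα).1 h2, eq_comm, QuotientGroup.eq, ← inv_mem_iff] at h1
  rw [← inv_mem_iff]
  simpa [mul_assoc] using h1

theorem conj_mem_of_normal {N : Subgroup G} (hN : (N.subgroupOf Γ).Normal) (hle : N ≤ Γ) {a : G}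
    (ha : a ∈ Γ) {x : G} (hx : x ∈ N) : a * x * a⁻¹ ∈ N :=
  hN.conj_mem ⟨x, hle hx⟩ hx ⟨a, ha⟩

theorem sourceCyl_subset {Γ₀ Γ₁ : Subgroup G} (hΓ₁ : Γ₁ ∈ subgroupLattice Γ) {g : G}
    (hle : Γ₁ ≤ isot Γ g) (hN : (Γ₁.subgroupOf Γ).Normal) {r α : G} (hr : r ∈ isot Γ g)
    (hα : α ∈ Γ) {n : ℕ} (gs : Fin n → G) :
    sourceCyl Γ Γ₀ Γ₁ g r α gs ⊆ initialCyl Γ g α := by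
  refine Set.inter_subset_left.trans fun y hy => cl_mono ?_ hy
  rintro _ ⟨x, hx, rfl⟩
  refine ⟨r * (α * x * α⁻¹) * α, Set.mul_mem_mul ?_ rfl, by simp [mul_assoc]⟩
  exact mul_mem hr (hle (conj_mem_of_normal hN (le_of_mem hΓ₁) hα hx))

theorem targetCyl_subset {Γ₀ Γ₁ : Subgroup G} {g : G} (hle : Γ₁ ≤ isot Γ g) {r α : G}
    (hr : r ∈ isot Γ g) {n : ℕ} (gs : Fin n → G) :
    targetCyl Γ Γ₀ Γ₁ g r α gs ⊆ finalCyl Γ g α := by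
  refine Set.inter_subset_left.trans fun y hy => ?_
  have h1 : ((α⁻¹ * r⁻¹ * g : G) : G ⧸ Γ) = ((α⁻¹ * g : G) : G ⧸ Γ) := by
    rw [QuotientGroup.eq]
    simpa [mul_assoc] using (mem_isot.1 hr).2
  change y ((α⁻¹ * r⁻¹ * g : G) : G ⧸ Γ) ∈ cl Γ _ at hy
  rw [h1] at hy
  refine cl_mono ?_ hy
  rintro _ ⟨_, ⟨x, hx, g', hg, rfl⟩, rfl⟩
  obtain rfl : g' = g := hg
  refine ⟨g'⁻¹ * (r⁻¹ * x) * g', ?_, by simp [mul_assoc]⟩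
  have h := mem_isot.1 (mul_mem (inv_mem hr) (hle hx))
  refine mem_isot.2 ⟨h.2, ?_⟩
  simpa [mul_assoc] using h.1

/-- On the domain of `g` and `α`, the transformation of `Γg` matches the two cylinder sets. -/
theorem mem_sourceCyl_iff {Γ₀ Γ₁ : Subgroup G} (hΓ₁ : Γ₁ ∈ subgroupLattice Γ) {g : G}
    (hN : (Γ₁.subgroupOf Γ).Normal) {n : ℕ} {gs : Fin n → G}
    (hΓ₀ : Γ₀ ≤ Γ)
    (hconj : ∀ i, ∀ x ∈ Γ₁, (g * (gs i)⁻¹)⁻¹ * x * (g * (gs i)⁻¹) ∈ Γ₀) {r α : G}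
    (hr : r ∈ isot Γ g) (hα : α ∈ Γ) {y : YSpace Γ} (hy : y ∈ normalizedSections Γ)
    (hyi : y ∈ initialCyl Γ g α) :
    y ∈ sourceCyl Γ Γ₀ Γ₁ g r α gs ↔ shift Γ g y ∈ targetCyl Γ Γ₀ Γ₁ g r α gs := by
  have hrα : r * α ∈ Γ := mul_mem (isot_le g hr) hα
  have h1 : ((α⁻¹ * r⁻¹ * g : G) : G ⧸ Γ) = ((α⁻¹ * g : G) : G ⧸ Γ) := by
    rw [QuotientGroup.eq]
    simpa [mul_assoc] using (mem_isot.1 hr).2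
  have h2 := (mem_initialCyl_iff hy hα).1 hyi
  set h := y ((g⁻¹ : G) : G ⧸ Γ) with hh
  have hfirst : shift Γ g y ((α⁻¹ * r⁻¹ * g : G) : G ⧸ Γ) = h⁻¹ := by
    rw [h1, shift_apply, ← hh, h2, hy.2, mul_one]
  have conjN : ∀ a ∈ Γ, ∀ k ∈ clSubgroup Γ Γ₁, emb Γ a * k * emb Γ a⁻¹ ∈ clSubgroup Γ Γ₁ :=
    fun a ha k hk => conj_mem_clSubgroup
      (fun x hx => conj_mem_of_normal hN (le_of_mem hΓ₁) ha hx) hk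
  have hA : y ∈ cyl Γ g⁻¹ ((g⁻¹ * r * α) • (Γ₁ : Set G)) ↔
      shift Γ g y ∈ cyl Γ (α⁻¹ * r⁻¹ * g) ((α⁻¹ * r⁻¹) • ((Γ₁ : Set G) * {g})) := by
    rw [mem_cyl_smul, mem_cyl_smul, hfirst, cl_mul_singleton, ← mem_clSubgroup, ← mem_clSubgroup,
      ← hh]
    constructor
    · intro hk
      have := inv_mem (conjN _ hrα _ hk)
      simpa [mul_assoc] using this
    · intro hk
      have := conjN _ (inv_mem hrα) _ (inv_mem hk)
      simpa [mul_assoc] using this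
  rw [sourceCyl, targetCyl, Set.mem_inter_iff, Set.mem_inter_iff, ← hA, Set.mem_iInter,
    Set.mem_iInter]
  refine and_congr_right fun hk => forall_congr' fun i => ?_
  rw [mem_cyl_smul, ← mem_clSubgroup, ← hh] at hk
  have hk' := conjN _ hrα _ hk
  set k' := emb Γ (r * α) * (emb Γ (g⁻¹ * r * α)⁻¹ * h) * emb Γ (r * α)⁻¹ with hk'def
  have hform : h = emb Γ g⁻¹ * k' * emb Γ (r * α) := by
    simp [hk'def, mul_assoc]
  have hcj := conj_mem_clSubgroup (Γ := Γ) (H' := Γ₀) (a := (g * (gs i)⁻¹)⁻¹)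
    (by simpa using hconj i) (inv_mem hk')
  have hfix : k' • ((g * (gs i)⁻¹ : G) : G ⧸ Γ) = ((g * (gs i)⁻¹ : G) : G ⧸ Γ) := by
    rw [mem_clSubgroup] at hk'
    refine smul_eq_of_mem_cl hk' fun x hx => ?_
    rw [smul_coe_eq_iff]
    exact hΓ₀ (hconj i x hx)
  have hlabel : h • ((α⁻¹ * r⁻¹ * g * (gs i)⁻¹ : G) : G ⧸ Γ) = (((gs i)⁻¹ : G) : G ⧸ Γ) := by
    rw [hform, mul_smul, mul_smul, emb_smul, emb_smul, smul_coe,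
      show r * α * (α⁻¹ * r⁻¹ * g * (gs i)⁻¹) = g * (gs i)⁻¹ by group, hfix, smul_coe]
    congr 1
    group
  rw [mem_cyl_smul, mem_cyl_smul, shift_apply, ← hh, hlabel, ← mem_clSubgroup, ← mem_clSubgroup]
  have hprod : emb Γ (α⁻¹ * r⁻¹ * g * (gs i)⁻¹)⁻¹ * (h⁻¹ * y (((gs i)⁻¹ : G) : G ⧸ Γ)) =
      (emb Γ (g * (gs i)⁻¹)⁻¹ * k'⁻¹ * emb Γ ((g * (gs i)⁻¹)⁻¹)⁻¹) *
        (emb Γ ((gs i)⁻¹)⁻¹ * y (((gs i)⁻¹ : G) : G ⧸ Γ)) := by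
    rw [hform]
    simp [mul_assoc]
  rw [hprod, Subgroup.mul_mem_cancel_left _ hcj]

/-- A member of the lattice inside `Γ_g` whose conjugates by the `g gᵢ⁻¹` lie in `Γ₀`: the elements
of `Γ` that fix finitely many suitable cosets. -/
theorem exists_conj_le {Γ₀ : Subgroup G} (hΓ₀ : Γ₀ ∈ subgroupLattice Γ) (g : G) {n : ℕ}
    (gs : Fin n → G) : ∃ Γ' ∈ subgroupLattice Γ, Γ' ≤ isot Γ g ∧
      ∀ i, ∀ x ∈ Γ', (g * (gs i)⁻¹)⁻¹ * x * (g * (gs i)⁻¹) ∈ Γ₀ := by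
  obtain ⟨A, hA, hAΓ⟩ := exists_pointStab_le hΓ₀
  let B : Set (G ⧸ Γ) := insert (g : G ⧸ Γ)
    (⋃ i, (fun c => (g * (gs i)⁻¹) • c) '' insert ((1 : G) : G ⧸ Γ) A)
  refine ⟨pointStab Γ B, pointStab_mem ((Set.finite_iUnion fun i => (hA.insert _).image _).insert _),
    ?_, fun i x hx => hAΓ ?_⟩
  · rw [isot_eq_pointStab]
    exact pointStab_anti (Set.singleton_subset_iff.2 (Set.mem_insert _ _))
  · have key : ∀ c ∈ insert ((1 : G) : G ⧸ Γ) A,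
        ((g * (gs i)⁻¹)⁻¹ * x * (g * (gs i)⁻¹)) • c = c := fun c hc => by
      rw [mul_smul, mul_smul, (mem_pointStab.1 hx).2 _ (Set.mem_insert_of_mem _
        (Set.mem_iUnion.2 ⟨i, c, hc, rfl⟩)), inv_smul_smul]
    exact mem_pointStab.2 ⟨smul_coe_eq_self_iff.1 (key _ (Set.mem_insert _ _)),
      fun c hc => key c (Set.mem_insert_of_mem _ hc)⟩

theorem shift_image_sourceCyl {Γ₀ Γ₁ : Subgroup G} (hΓ₁ : Γ₁ ∈ subgroupLattice Γ) {g : G}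
    (hle : Γ₁ ≤ isot Γ g) (hN : (Γ₁.subgroupOf Γ).Normal) {n : ℕ} {gs : Fin n → G}
    (hΓ₀ : Γ₀ ≤ Γ)
    (hconj : ∀ i, ∀ x ∈ Γ₁, (g * (gs i)⁻¹)⁻¹ * x * (g * (gs i)⁻¹) ∈ Γ₀) {r α : G}
    (hr : r ∈ isot Γ g) (hα : α ∈ Γ) :
    shift Γ g '' (sourceCyl Γ Γ₀ Γ₁ g r α gs ∩ normalizedSections Γ) =
      targetCyl Γ Γ₀ Γ₁ g r α gs ∩ normalizedSections Γ := by
  ext z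
  constructor
  · rintro ⟨y, ⟨h, hy⟩, rfl⟩
    exact ⟨(mem_sourceCyl_iff hΓ₁ hN hΓ₀ hconj hr hα hy
      (sourceCyl_subset hΓ₁ hle hN hr hα gs h)).1 h, shift_mem hy g⟩
  · rintro ⟨h, hz⟩
    obtain ⟨y, ⟨hyi, hy⟩, rfl⟩ := (shift_bijOn hα).surjOn ⟨targetCyl_subset hle hr gs h, hz⟩
    exact ⟨y, ⟨(mem_sourceCyl_iff hΓ₁ hN hΓ₀ hconj hr hα hy hyi).2 h, hy⟩, rfl⟩

end Transversals

/-! ### Good points and their sections -/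

section Good

variable {G : Type*} [Group G] {X : Type*} [MulAction G X]

open Schlichting

/-- A point is good if its stabilizer is trivial and if its orbit meets the translates of `F` as it
should for a fundamental domain: every coset `gΓ` contains exactly one `θ` with `x ∈ θ F`. -/
structure Good (Γ : Subgroup G) (F : Set X) (x : X) : Prop where
  free : ∀ g : G, g • x = x → g = 1
  existsUnique : ∀ c : G ⧸ Γ, ∃! θ : G, (θ : G ⧸ Γ) = c ∧ θ⁻¹ • x ∈ F

open Classical in
/-- The section of a good point `x`: the element `θ` of the coset `c` with `x ∈ θ F`. -/
noncomputable def sec (Γ : Subgroup G) (F : Set X) (x : X) (c : G ⧸ Γ) : G :=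
  if h : ∃ θ : G, (θ : G ⧸ Γ) = c ∧ θ⁻¹ • x ∈ F then h.choose else 1

/-- The point of `F` in the orbit of `x` that is labelled by the coset `c`. -/
noncomputable def pt (Γ : Subgroup G) (F : Set X) (c : G ⧸ Γ) (x : X) : X := (sec Γ F x c)⁻¹ • x

variable {Γ : Subgroup G} {F : Set X}

theorem code_eq (x : X) (c : G ⧸ Γ) : code Γ F x c = emb Γ (sec Γ F x c) := by
  rw [code, sec]
  split_ifs
  · rfl
  · rw [map_one]

namespace Good

variable {x : X} (hx : Good Γ F x)

include hx

theorem sec_spec (c : G ⧸ Γ) : ((sec Γ F x c : G) : G ⧸ Γ) = c ∧ (sec Γ F x c)⁻¹ • x ∈ F := by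
  have h : ∃ θ : G, (θ : G ⧸ Γ) = c ∧ θ⁻¹ • x ∈ F := (hx.existsUnique c).exists
  rw [sec, dif_pos h]
  exact h.choose_spec

theorem coe_sec (c : G ⧸ Γ) : ((sec Γ F x c : G) : G ⧸ Γ) = c := (hx.sec_spec c).1

theorem pt_mem (c : G ⧸ Γ) : pt Γ F c x ∈ F := (hx.sec_spec c).2

theorem sec_eq {θ : G} {c : G ⧸ Γ} (h : (θ : G ⧸ Γ) = c) (hF : θ⁻¹ • x ∈ F) :
    sec Γ F x c = θ := (hx.existsUnique c).unique (hx.sec_spec c) ⟨h, hF⟩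

theorem eq_of_smul_eq {g h : G} (e : g • x = h • x) : g = h := by
  have := hx.free (h⁻¹ * g) (by rw [mul_smul, e, inv_smul_smul])
  rwa [inv_mul_eq_one, eq_comm] at this

theorem smul (g : G) : Good Γ F (g • x) where
  free h hh := by
    have := hx.free (g⁻¹ * h * g) (by rw [mul_smul, mul_smul, hh, inv_smul_smul])
    have h2 : h = g * (g⁻¹ * h * g) * g⁻¹ := by group
    rw [h2, this, mul_one, mul_inv_cancel]
  existsUnique c := by
    refine ⟨g * sec Γ F x (g⁻¹ • c), ⟨?_, ?_⟩, ?_⟩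
    · rw [← smul_coe, hx.coe_sec, smul_inv_smul]
    · rw [mul_inv_rev, mul_smul, inv_smul_smul]
      exact hx.pt_mem _
    · rintro θ ⟨h1, h2⟩
      rw [hx.sec_eq (θ := g⁻¹ * θ), mul_inv_cancel_left]
      · rw [← smul_coe, h1]
      · rwa [mul_inv_rev, inv_inv, mul_smul]

theorem sec_smul (g : G) (c : G ⧸ Γ) : sec Γ F (g • x) c = g * sec Γ F x (g⁻¹ • c) :=
  (hx.smul g).sec_eq (by rw [← smul_coe, hx.coe_sec, smul_inv_smul])
    (by rw [mul_inv_rev, mul_smul, inv_smul_smul]; exact hx.pt_mem _)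

theorem good_pt (c : G ⧸ Γ) : Good Γ F (pt Γ F c x) := hx.smul _

theorem sec_pt (c d : G ⧸ Γ) :
    sec Γ F (pt Γ F c x) d = (sec Γ F x c)⁻¹ * sec Γ F x (sec Γ F x c • d) := by
  rw [pt, hx.sec_smul, inv_inv]

/-- The points of `F` in the orbits of `x` and of `pt c x` are the same, and the labels change by the
element `sec x c`. -/
theorem pt_pt (c d : G ⧸ Γ) : pt Γ F d (pt Γ F c x) = pt Γ F (sec Γ F x c • d) x := by
  rw [pt, hx.sec_pt, pt, pt, mul_inv_rev, inv_inv, mul_smul, smul_inv_smul]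

theorem sec_one (hF : x ∈ F) : sec Γ F x ((1 : G) : G ⧸ Γ) = 1 :=
  hx.sec_eq rfl (by simpa using hF)

theorem pt_one (hF : x ∈ F) : pt Γ F ((1 : G) : G ⧸ Γ) x = x := by
  rw [pt, hx.sec_one hF, inv_one, one_smul]

theorem pt_injective : Function.Injective fun c => pt Γ F c x := fun c d h => by
  have := hx.eq_of_smul_eq h
  rw [← hx.coe_sec c, ← hx.coe_sec d, inv_injective this]

theorem exists_pt_eq (g : G) (hg : g • x ∈ F) : pt Γ F ((g⁻¹ : G) : G ⧸ Γ) x = g • x := by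
  rw [pt, hx.sec_eq (θ := g⁻¹) rfl (by simpa using hg), inv_inv]

theorem dotMap_eq (g : G) : dotMap Γ F g x = pt Γ F ((g⁻¹ : G) : G ⧸ Γ) x := by
  have h : ∃ θ : G, θ * g⁻¹ ∈ Γ ∧ θ • x ∈ F := by
    refine ⟨(sec Γ F x ((g⁻¹ : G) : G ⧸ Γ))⁻¹, ?_, hx.pt_mem _⟩
    exact QuotientGroup.eq.1 (hx.coe_sec ((g⁻¹ : G) : G ⧸ Γ))
  rw [dotMap, dif_pos h, ← hx.exists_pt_eq _ h.choose_spec.2]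
  congr 1
  rw [QuotientGroup.eq, inv_inv]
  exact h.choose_spec.1

theorem code_mem (hF : x ∈ F) : code Γ F x ∈ normalizedSections Γ := by
  refine ⟨fun c => ?_, ?_⟩
  · rw [code_eq, emb_smul, smul_coe_one, hx.coe_sec]
  · rw [code_eq, hx.sec_one hF, map_one]

theorem code_pt (c d : G ⧸ Γ) :
    code Γ F (pt Γ F c x) d = (code Γ F x c)⁻¹ * code Γ F x (code Γ F x c • d) := by
  rw [code_eq, code_eq, code_eq, hx.sec_pt, map_mul, map_inv, emb_smul]

theorem code_dotMap (g : G) : code Γ F (dotMap Γ F g x) = shift Γ g (code Γ F x) := by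
  funext c
  rw [hx.dotMap_eq, hx.code_pt, shift_apply]

/-- Translates of `F` are seen by the section. -/
theorem mem_smul_iff (D : Set G) : x ∈ D • F ↔ ∃ c, sec Γ F x c ∈ D := by
  constructor
  · rintro ⟨θ, hθ, f, hf, rfl⟩
    refine ⟨(θ : G ⧸ Γ), ?_⟩
    rwa [hx.sec_eq (θ := θ) rfl (by simpa using hf)]
  · rintro ⟨c, hc⟩
    exact ⟨_, hc, _, hx.pt_mem c, smul_inv_smul _ _⟩

/-- The inverse image under the code of the cylinder set of a coset `C` is `CF`. -/
theorem mem_coset_smul_iff {H : Subgroup G} (hH : H ∈ subgroupLattice Γ) (g : G) :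
    x ∈ (g • (H : Set G)) • F ↔ code Γ F x ∈ cyl Γ g (g • (H : Set G)) := by
  rw [hx.mem_smul_iff, mem_cyl_smul, code_eq, ← mem_clSubgroup, ← map_mul,
    emb_mem_clSubgroup_iff hH]
  constructor
  · rintro ⟨c, h, hh, hc⟩
    obtain rfl : (g : G ⧸ Γ) = c := by
      rw [← hx.coe_sec c, ← hc]
      exact (coe_mul_of_mem g (le_of_mem hH hh)).symm
    rw [← hc]
    simpa using hh
  · intro h
    exact ⟨g, _, h, by simp⟩

theorem mem_compSet_iff (hF : x ∈ F) (h r g : G) :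
    x ∈ compSet Γ F h r g ↔ code Γ F x ∈ compCyl Γ h r g := by
  rw [compCyl, ← hx.mem_coset_smul_iff (isot_mem _), compSet, Set.mem_ofPred_eq,
    and_iff_right hF, smul_assoc, Set.mem_smul_set_iff_inv_smul_mem, inv_inv]

theorem mem_bijDomain_iff (hF : x ∈ F) {g α : G} (hα : α ∈ Γ) :
    x ∈ bijDomain Γ F g α ↔ code Γ F x ∈ initialCyl Γ g α := by
  rw [bijDomain, Set.mem_ofPred_eq, and_iff_right hF, (hx.smul g).mem_smul_iff, initialCyl,
    mem_cyl_smul, cl_mul_singleton, code_eq, ← mem_clSubgroup, ← map_inv, ← map_mul, ← map_mul,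
    emb_mem_clSubgroup_iff (isot_mem g)]
  constructor
  · rintro ⟨c, ρ, hρ, α', hα', hc⟩
    obtain rfl : α' = α := hα'
    have h1 := (hx.smul g).coe_sec c
    rw [← hc] at h1
    simp only at h1 hc
    rw [coe_mul_of_mem _ hα, ← smul_coe_one, smul_coe_eq_self_of_mem (isot_le g hρ)] at h1
    rw [hx.sec_smul, ← h1, smul_coe_one, ← eq_mul_inv_iff_mul_eq] at hc
    rw [inv_inv, ← hc]
    exact hρ
  · intro h
    rw [inv_inv] at h
    refine ⟨((1 : G) : G ⧸ Γ), _, h, α, rfl, ?_⟩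
    rw [hx.sec_smul, smul_coe_one]
    simp

theorem dotMap_mem (g : G) : dotMap Γ F g x ∈ F := by
  rw [hx.dotMap_eq]
  exact hx.pt_mem _

theorem good_dotMap (g : G) : Good Γ F (dotMap Γ F g x) := by
  rw [hx.dotMap_eq]
  exact hx.good_pt _

theorem dotMap_congr {g γ : G} (hγ : γ ∈ Γ) : dotMap Γ F (γ * g) x = dotMap Γ F g x := by
  rw [hx.dotMap_eq, hx.dotMap_eq, mul_inv_rev, coe_mul_of_mem _ (inv_mem hγ)]

theorem dotMap_one (hF : x ∈ F) : dotMap Γ F 1 x = x := by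
  rw [hx.dotMap_eq, inv_one, hx.pt_one hF]

theorem dotMap_dotMap {g₁ g₂ g₃ : G}
    (h : code Γ F x ((g₂⁻¹ : G) : G ⧸ Γ) • ((g₁⁻¹ : G) : G ⧸ Γ) = ((g₃⁻¹ : G) : G ⧸ Γ)) :
    dotMap Γ F g₁ (dotMap Γ F g₂ x) = dotMap Γ F g₃ x := by
  rw [(hx.good_dotMap g₂).dotMap_eq, hx.dotMap_eq, hx.dotMap_eq, hx.pt_pt, ← h, code_eq, emb_smul]

theorem dotMap_dotMap_of_mem_compCyl (hF : x ∈ F) {g₁ r g₂ : G} (hr : r ∈ Γ)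
    (h : code Γ F x ∈ compCyl Γ g₁ r g₂) :
    dotMap Γ F g₁ (dotMap Γ F g₂ x) = dotMap Γ F (g₁ * r * g₂) x := by
  refine hx.dotMap_dotMap ?_
  rw [mem_compCyl_iff (hx.code_mem hF), mul_inv_rev, coe_mul_of_mem _ (inv_mem hr)] at h
  rw [h]
  congr 1
  group

theorem dotMap_inv_dotMap (hF : x ∈ F) {g α : G} (hα : α ∈ Γ)
    (h : code Γ F x ∈ initialCyl Γ g α) : dotMap Γ F (g⁻¹ * α) (dotMap Γ F g x) = x := by
  rw [hx.dotMap_dotMap (g₃ := 1), hx.dotMap_one hF]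
  rw [mul_inv_rev, inv_inv, (mem_initialCyl_iff (hx.code_mem hF) hα).1 h, inv_one]

theorem dotMap_dotMap_inv (hF : x ∈ F) {g α : G} (hα : α ∈ Γ)
    (h : code Γ F x ∈ finalCyl Γ g α) : dotMap Γ F g (dotMap Γ F (g⁻¹ * α) x) = x := by
  rw [hx.dotMap_dotMap (g₃ := 1), hx.dotMap_one hF]
  rw [mul_inv_rev, inv_inv, (mem_finalCyl_iff (hx.code_mem hF) hα).1 h, inv_one]

/-- The points of `F` in the orbit of a good point are labelled by `G / Γ`. -/
theorem exists_orbitEquiv : ∃ e : G ⧸ Γ ≃ {z : X // z ∈ F ∧ z ∈ MulAction.orbit G x},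
    ∀ c, (e c : X) = pt Γ F c x := by
  refine ⟨Equiv.ofBijective (fun c => ⟨pt Γ F c x, hx.pt_mem c, _, rfl⟩) ⟨fun c d h => ?_, ?_⟩,
    fun c => rfl⟩
  · exact hx.pt_injective (congrArg Subtype.val h)
  · rintro ⟨_, hF, g, rfl⟩
    exact ⟨_, Subtype.ext (hx.exists_pt_eq g hF)⟩

theorem tsum_orbit (f : X → ℂ) :
    ∑' z : {z : X // z ∈ F ∧ z ∈ MulAction.orbit G x}, f z = ∑' c, f (pt Γ F c x) := by
  obtain ⟨e, he⟩ := hx.exists_orbitEquiv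
  rw [← e.tsum_eq]
  simp only [he]

theorem dotMap_pt_eq_iff (hF : x ∈ F) (g : G) (c : G ⧸ Γ) :
    dotMap Γ F g (pt Γ F c x) = x ↔ sec Γ F x c * g⁻¹ ∈ Γ := by
  have h1 : pt Γ F (sec Γ F x c • ((g⁻¹ : G) : G ⧸ Γ)) x = x ↔
      sec Γ F x c • ((g⁻¹ : G) : G ⧸ Γ) = ((1 : G) : G ⧸ Γ) := by
    rw [← hx.pt_injective.eq_iff, hx.pt_one hF]
  rw [(hx.good_pt c).dotMap_eq, hx.pt_pt, h1, smul_coe_eq_iff, inv_one, one_mul]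

end Good

end Good

/-! ### The measure on the product space -/

section MeasureY

variable {G : Type*} [Group G] {Γ : Subgroup G}

open Schlichting

theorem isOpen_cl_smul {H : Subgroup G} (hH : H ∈ subgroupLattice Γ) (g : G) :
    IsOpen (cl Γ (g • (H : Set G))) := by
  obtain ⟨A, hA, h⟩ := exists_mem_clSubgroup_iff hH
  have hopen : IsOpen (cl Γ (H : Set G)) := isOpen_iff_mem_nhds.2 fun s hs => by
    refine Schlichting.mem_nhds_iff.2 ⟨A, hA, fun t ht => ?_⟩
    obtain ⟨x, hx⟩ := exists_approx_set s hA
    rw [← mem_clSubgroup, h s x hx] at hs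
    rwa [← mem_clSubgroup, h t x fun c hc => (ht c hc).trans (hx c hc)]
  have : cl Γ (g • (H : Set G)) = (fun s => (emb Γ g)⁻¹ * s) ⁻¹' cl Γ (H : Set G) :=
    Set.ext fun s => cl_smul g _ s
  rw [this]
  exact hopen.preimage (continuous_const_mul _)

theorem isTopologicalBasis_cl :
    TopologicalSpace.IsTopologicalBasis
      {U : Set (Schlichting Γ) | ∃ (g : G), ∃ H ∈ subgroupLattice Γ, U = cl Γ (g • (H : Set G))} := by
  refine TopologicalSpace.isTopologicalBasis_of_isOpen_of_nhds ?_ ?_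
  · rintro _ ⟨g, H, hH, rfl⟩
    exact isOpen_cl_smul hH g
  · intro s U hs hU
    obtain ⟨A, hA, h⟩ := Schlichting.mem_nhds_iff.1 (hU.mem_nhds hs)
    obtain ⟨g, hg⟩ := exists_approx_set s (hA.insert ((1 : G) : G ⧸ Γ))
    refine ⟨_, ⟨g, _, pointStab_mem hA, rfl⟩, ?_, fun t ht => h t fun c hc => ?_⟩
    · rw [cl_smul, ← mem_clSubgroup]
      refine mem_clSubgroup_pointStab hA ?_ fun c hc => ?_
      · rw [mul_smul, hg _ (Set.mem_insert _ _), inv_smul_eq_iff, emb_smul]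
      · rw [mul_smul, hg _ (Set.mem_insert_of_mem _ hc), inv_smul_eq_iff, emb_smul]
    · rw [hg c (Set.mem_insert_of_mem _ hc)]
      refine smul_eq_of_mem_cl ht ?_
      rintro _ ⟨x, hx, rfl⟩
      change (g * x) • c = g • c
      rw [mul_smul, (mem_pointStab.1 hx).2 c hc]

variable [Countable G]

theorem borel_eq_generateFrom_cl : borel (Schlichting Γ) =
    MeasurableSpace.generateFrom
      {U : Set (Schlichting Γ) | ∃ (g : G), ∃ H ∈ subgroupLattice Γ, U = cl Γ (g • (H : Set G))} :=
  isTopologicalBasis_cl.borel_eq_generateFrom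

variable (Γ) in
/-- The finite products of closures of cosets, without restriction on their labels. -/
def boxes : Set (Set (YSpace Γ)) :=
  {S | ∃ (n : ℕ) (c : Fin n → G ⧸ Γ) (g : Fin n → G) (H : Fin n → Subgroup G),
    (∀ i, H i ∈ subgroupLattice Γ) ∧ S = ⋂ i, {y | y (c i) ∈ cl Γ (g i • (H i : Set G))}}

omit [Countable G] in
theorem measurableSet_eval_cl (c : G ⧸ Γ) (D : Set G) :
    MeasurableSet {y : YSpace Γ | y c ∈ cl Γ D} :=
  measurable_pi_apply c isClosed_closure.measurableSet

omit [Countable G] in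
theorem isPiSystem_boxes : IsPiSystem (boxes Γ) := by
  rintro _ ⟨n, c, g, H, hH, rfl⟩ _ ⟨m, c', g', H', hH', rfl⟩ -
  refine ⟨n + m, Fin.append c c', Fin.append g g', Fin.append H H', fun i => ?_, ?_⟩
  · refine Fin.addCases (fun i => ?_) (fun i => ?_) i
    · rw [Fin.append_left]; exact hH i
    · rw [Fin.append_right]; exact hH' i
  · ext y
    simp only [Set.mem_inter_iff, Set.mem_iInter, Set.mem_ofPred_eq]
    constructor
    · rintro ⟨h1, h2⟩ i
      refine Fin.addCases (fun i => ?_) (fun i => ?_) i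
      · simpa only [Fin.append_left] using h1 i
      · simpa only [Fin.append_right] using h2 i
    · intro h
      refine ⟨fun i => ?_, fun i => ?_⟩
      · simpa only [Fin.append_left] using h (Fin.castAdd m i)
      · simpa only [Fin.append_right] using h (Fin.natAdd n i)

theorem generateFrom_boxes :
    (inferInstance : MeasurableSpace (YSpace Γ)) = MeasurableSpace.generateFrom (boxes Γ) := by
  refine le_antisymm (iSup_le fun c => ?_) (MeasurableSpace.generateFrom_le ?_)
  · change MeasurableSpace.comap (fun y : YSpace Γ => y c) (borel (Schlichting Γ)) ≤ _
    rw [borel_eq_generateFrom_cl, MeasurableSpace.comap_generateFrom]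
    refine MeasurableSpace.generateFrom_mono ?_
    rintro _ ⟨_, ⟨g, H, hH, rfl⟩, rfl⟩
    refine ⟨1, fun _ => c, fun _ => g, fun _ => H, fun _ => hH, ?_⟩
    rw [Set.iInter_const]
    rfl
  · rintro _ ⟨n, c, g, H, hH, rfl⟩
    exact MeasurableSet.iInter fun i => measurableSet_eval_cl _ _

/-- The Borel structure of `𝒮` is generated by the evaluations of permutations at cosets. -/
theorem measurable_of_fibers {Z : Type*} [MeasurableSpace Z] {f : Z → Schlichting Γ}
    (h : ∀ c d : G ⧸ Γ, MeasurableSet {z | f z • c = d}) : Measurable f := by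
  have : Countable (G ⧸ Γ) := Quotient.countable
  refine measurable_of_isOpen fun U hU => ?_
  have hU' : f ⁻¹' U = ⋃ p ∈ {p : Finset (G ⧸ Γ) × G |
      ∀ s : Schlichting Γ, (∀ c ∈ p.1, s • c = p.2 • c) → s ∈ U},
      ⋂ c ∈ p.1, {z | f z • c = p.2 • c} := by
    ext z
    simp only [Set.mem_preimage, Set.mem_iUnion, Set.mem_iInter, Set.mem_ofPred_eq, exists_prop]
    constructor
    · intro hz
      obtain ⟨A, hA, hAU⟩ := Schlichting.mem_nhds_iff.1 (hU.mem_nhds hz)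
      obtain ⟨g, hg⟩ := exists_approx_set (f z) hA
      refine ⟨(hA.toFinset, g), fun s hs => hAU s fun c hc => ?_, fun c hc => ?_⟩
      · rw [hs c (hA.mem_toFinset.2 hc), hg c hc]
      · exact hg c (hA.mem_toFinset.1 hc)
    · rintro ⟨p, hp, hz⟩
      exact hp _ hz
  rw [hU']
  exact MeasurableSet.biUnion (Set.to_countable _) fun p _ =>
    MeasurableSet.biInter (Set.to_countable _) fun c _ => h c _

theorem measurable_eval_smul {c d : G ⧸ Γ} :
    Measurable fun y : YSpace Γ => y (y c • d) := by
  have : Countable (G ⧸ Γ) := Quotient.countable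
  intro A hA
  have : (fun y : YSpace Γ => y (y c • d)) ⁻¹' A = ⋃ e : G ⧸ Γ,
      ((fun y : YSpace Γ => y c) ⁻¹' {s | s • d = e}) ∩ ((fun y : YSpace Γ => y e) ⁻¹' A) := by
    ext y
    simp
  rw [this]
  exact MeasurableSet.iUnion fun e => (measurable_pi_apply c (isClosed_fiber d e).measurableSet).inter
    (measurable_pi_apply e hA)

theorem measurable_shift (g : G) : Measurable (shift Γ g) :=
  measurable_pi_iff.2 fun _ => (measurable_pi_apply _).inv.mul measurable_eval_smul

end MeasureY

section Code

variable {G : Type*} [Group G] [Countable G] {X : Type*} [MulAction G X] [MeasurableSpace X]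
  [MeasurableConstSMul G X] {ν : Measure X} [SMulInvariantMeasure G X ν] {Γ : Subgroup G}
  {F : Set X}

open Schlichting

variable (G) in
theorem ae_forall_smul {P : X → Prop} (h : ∀ᵐ x ∂ν, P x) : ∀ᵐ x ∂ν, ∀ g : G, P (g • x) :=
  ae_all_iff.2 fun g => (measurePreserving_smul g ν).quasiMeasurePreserving.ae h

/-- Almost every point is good. -/
theorem ae_good (hfree : ∀ᵐ x ∂ν, ∀ g : G, g • x = x → g = 1)
    (hF : IsFundamentalDomain Γ F ν) : ∀ᵐ x ∂ν, Good Γ F x := by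
  have h1 := ae_forall_smul G hF.ae_covers
  have h2 : ∀ᵐ x ∂ν, ∀ γ : Γ, γ ≠ 1 → ¬ (x ∈ F ∧ x ∈ γ • F) := by
    refine ae_all_iff.2 fun γ => ?_
    by_cases hγ : γ = 1
    · simp [hγ]
    · have := hF.aedisjoint (Ne.symm hγ)
      simp only [Function.onFun, one_smul] at this
      have h := measure_eq_zero_iff_ae_notMem.1 this
      filter_upwards [h] with x hx _ h'
      exact hx h'
  filter_upwards [hfree, h1, ae_forall_smul G h2] with x hx h1 h2
  refine ⟨hx, fun c => ?_⟩
  obtain ⟨g, rfl⟩ := QuotientGroup.mk_surjective c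
  obtain ⟨γ, hγ⟩ := h1 g⁻¹
  refine ⟨g * (γ : G)⁻¹, ⟨coe_mul_of_mem g (inv_mem γ.2), ?_⟩, ?_⟩
  · rw [mul_inv_rev, inv_inv, mul_smul]
    exact hγ
  · rintro θ ⟨h3, h4⟩
    have hmem := QuotientGroup.eq.1 h3
    by_contra hne
    have hne' : (⟨θ⁻¹ * g, hmem⟩ : Γ) * γ⁻¹ ≠ 1 := fun h => hne <| by
      have h5 : (θ⁻¹ * g) * (γ : G)⁻¹ = 1 := congrArg Subtype.val h
      rw [mul_assoc, inv_mul_eq_one] at h5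
      exact h5
    refine h2 θ⁻¹ _ hne' ⟨h4, ?_⟩
    rw [Set.mem_smul_set_iff_inv_smul_mem]
    have : ((⟨θ⁻¹ * g, hmem⟩ : Γ) * γ⁻¹)⁻¹ • θ⁻¹ • x = γ • g⁻¹ • x := by
      rw [Subgroup.smul_def, Subgroup.smul_def, smul_smul, smul_smul]
      congr 1
      simp [mul_assoc]
    rw [this]
    exact hγ

theorem ae_restrict_of_ae_smul (hFm : MeasurableSet F) {P : X → Prop}
    (h : ∀ᵐ x ∂ν.restrict F, P x) : ∀ᵐ x ∂ν, ∀ g : G, g • x ∈ F → P (g • x) :=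
  ae_forall_smul G ((ae_restrict_iff' hFm).1 h)

omit [Countable G] [MeasurableConstSMul G X] [SMulInvariantMeasure G X ν] in
theorem ae_good_restrict (hg : ∀ᵐ x ∂ν, Good Γ F x) (hFm : MeasurableSet F) :
    ∀ᵐ x ∂ν.restrict F, x ∈ F ∧ Good Γ F x :=
  (ae_restrict_mem hFm).and (ae_restrict_of_ae hg)

/-- The transformations of `F` preserve null sets. -/
theorem ae_pt (hg : ∀ᵐ x ∂ν, Good Γ F x) (hFm : MeasurableSet F) {P : X → Prop}
    (h : ∀ᵐ x ∂ν.restrict F, P x) : ∀ᵐ x ∂ν.restrict F, ∀ c, P (pt Γ F c x) := by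
  filter_upwards [ae_good_restrict hg hFm,
    ae_restrict_of_ae (ae_restrict_of_ae_smul (G := G) hFm h)] with x hx h c
  exact h _ (hx.2.pt_mem c)

theorem ae_dotMap (hg : ∀ᵐ x ∂ν, Good Γ F x) (hFm : MeasurableSet F) {P : X → Prop}
    (h : ∀ᵐ x ∂ν.restrict F, P x) (g : G) : ∀ᵐ x ∂ν.restrict F, P (dotMap Γ F g x) := by
  filter_upwards [ae_good_restrict hg hFm, ae_pt hg hFm h] with x hx h
  rw [hx.2.dotMap_eq]
  exact h _

omit [SMulInvariantMeasure G X ν] in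
theorem nullMeasurableSet_sec (hg : ∀ᵐ x ∂ν, Good Γ F x) (hFm : MeasurableSet F) (c : G ⧸ Γ)
    (D : Set G) : NullMeasurableSet {x | sec Γ F x c ∈ D} (ν.restrict F) := by
  have hm : MeasurableSet (⋃ θ ∈ {θ : G | (θ : G ⧸ Γ) = c ∧ θ ∈ D}, θ • F) :=
    MeasurableSet.biUnion (Set.to_countable _) fun θ _ => hFm.const_smul θ
  refine hm.nullMeasurableSet.congr ?_
  refine eventuallyEq_set.2 ?_
  filter_upwards [ae_good_restrict hg hFm] with x hx
  simp only [Set.mem_iUnion, exists_prop, Set.mem_smul_set_iff_inv_smul_mem]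
  constructor
  · rintro ⟨θ, ⟨h1, h2⟩, h3⟩
    rwa [hx.2.sec_eq h1 h3]
  · intro h
    exact ⟨_, ⟨hx.2.coe_sec c, h⟩, hx.2.pt_mem c⟩

omit [SMulInvariantMeasure G X ν] in
theorem aemeasurable_code (hg : ∀ᵐ x ∂ν, Good Γ F x) (hFm : MeasurableSet F) :
    AEMeasurable (code Γ F) (ν.restrict F) := by
  have : Countable (G ⧸ Γ) := Quotient.countable
  refine aemeasurable_pi_iff.2 fun c => NullMeasurable.aemeasurable fun A _ => ?_
  simp only [code_eq]
  exact nullMeasurableSet_sec hg hFm c (emb Γ ⁻¹' A)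

omit [Countable G] [MeasurableConstSMul G X] [SMulInvariantMeasure G X ν] in
theorem preimage_cyl_ae_eq (hg : ∀ᵐ x ∂ν, Good Γ F x) (hFm : MeasurableSet F) (g : G)
    {H : Subgroup G} (hH : H ∈ subgroupLattice Γ) :
    code Γ F ⁻¹' cyl Γ g (g • (H : Set G)) =ᵐ[ν.restrict F] ((g • (H : Set G)) • F : Set X) := by
  refine eventuallyEq_set.2 ?_
  filter_upwards [ae_good_restrict hg hFm] with x hx
  exact (hx.2.mem_coset_smul_iff hH g).symm

omit [SMulInvariantMeasure G X ν] in
/-- The image of `ν|F` under the code satisfies the cylinder formula. -/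
theorem cylinderFormula_map (hg : ∀ᵐ x ∂ν, Good Γ F x) (hFm : MeasurableSet F) :
    CylinderFormula ν Γ F ((ν.restrict F).map (code Γ F)) := by
  intro n g H hH
  rw [Measure.map_apply_of_aemeasurable (aemeasurable_code hg hFm)
    (MeasurableSet.iInter fun i => measurableSet_cyl _ _ _), Set.preimage_iInter]
  have h : (⋂ i, code Γ F ⁻¹' cyl Γ (g i) (g i • (H i : Set G))) =ᵐ[ν.restrict F]
      (⋂ i, (g i • (H i : Set G)) • F : Set X) :=
    Filter.EventuallyEq.countable_iInter fun i => preimage_cyl_ae_eq hg hFm (g i) (hH i)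
  rw [measure_congr h, Measure.restrict_apply' hFm, Set.inter_comm]

omit [Countable G] [MeasurableConstSMul G X] [SMulInvariantMeasure G X ν] in
theorem CylinderFormula.measure_univ {μ : Measure (YSpace Γ)} (hμ : CylinderFormula ν Γ F μ) :
    μ Set.univ = ν F := by
  have := hμ 0 (fun _ => 1) (fun _ => Γ) (fun i => i.elim0)
  simpa using this

omit [MeasurableConstSMul G X] [SMulInvariantMeasure G X ν] in
/-- The measures with the cylinder formula are concentrated on the sections of `G → G / Γ`. -/
theorem CylinderFormula.ae_section {μ : Measure (YSpace Γ)} (hμ : CylinderFormula ν Γ F μ)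
    (hg : ∀ᵐ x ∂ν, Good Γ F x) (hFm : MeasurableSet F) (hFfin : ν F < ∞) :
    ∀ᵐ y ∂μ, ∀ c, y c • ((1 : G) : G ⧸ Γ) = c := by
  have : Countable (G ⧸ Γ) := Quotient.countable
  refine ae_all_iff.2 fun c => ?_
  obtain ⟨g, rfl⟩ := QuotientGroup.mk_surjective c
  have h1 := hμ 1 (fun _ => g) (fun _ => Γ) (fun _ => self_mem Γ)
  rw [Set.iInter_const, Set.iInter_const] at h1
  have h2 : ν (F ∩ (g • (Γ : Set G)) • F) = ν F := by
    rw [Set.inter_comm, ← Measure.restrict_apply' hFm, ← Measure.restrict_apply_univ F]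
    refine measure_congr (eventuallyEq_set.2 ?_)
    filter_upwards [ae_good_restrict hg hFm] with x hx
    rw [hx.2.mem_smul_iff]
    refine iff_of_true ⟨g, ?_⟩ trivial
    rw [Set.mem_smul_set_iff_inv_smul_mem]
    exact QuotientGroup.eq.1 (hx.2.coe_sec (g : G ⧸ Γ)).symm
  rw [h2, ← hμ.measure_univ] at h1
  have h3 : μ (cyl Γ g (g • (Γ : Set G)))ᶜ = 0 := by
    rw [measure_compl (measurableSet_cyl _ _ _) (by rw [h1, hμ.measure_univ]; exact hFfin.ne), h1,
      tsub_self]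
  filter_upwards [measure_eq_zero_iff_ae_notMem.1 h3] with y hy
  exact smul_one_eq_iff.2 (not_not.1 hy)

omit [MeasurableConstSMul G X] [SMulInvariantMeasure G X ν] in
/-- The boxes form a π-system that generates the σ-algebra of `𝒴`; the cylinder formula gives the
measures of those with consistent labels, and the others are null sets. -/
theorem CylinderFormula.unique {μ μ' : Measure (YSpace Γ)} (hμ : CylinderFormula ν Γ F μ)
    (hμ' : CylinderFormula ν Γ F μ') (hg : ∀ᵐ x ∂ν, Good Γ F x) (hFm : MeasurableSet F)
    (hFfin : ν F < ∞) : μ = μ' := by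
  have : IsFiniteMeasure μ := ⟨by rwa [hμ.measure_univ]⟩
  refine ext_of_generate_finite _ generateFrom_boxes isPiSystem_boxes ?_
    (hμ.measure_univ.trans hμ'.measure_univ.symm)
  rintro _ ⟨n, c, g, H, hH, rfl⟩
  by_cases hc : ∀ i, c i = g i
  · obtain rfl : c = fun i => (g i : G ⧸ Γ) := funext hc
    exact (hμ n g H hH).trans (hμ' n g H hH).symm
  · -- a factor with the wrong label makes the box null
    push Not at hc
    obtain ⟨i, hi⟩ := hc
    have key : ∀ {μ : Measure (YSpace Γ)}, CylinderFormula ν Γ F μ →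
        μ (⋂ i, {y | y (c i) ∈ cl Γ (g i • (H i : Set G))}) = 0 := fun {μ} hμ => by
      refine measure_eq_zero_iff_ae_notMem.2 ?_
      filter_upwards [hμ.ae_section hg hFm hFfin] with y hy hmem
      refine hi ((hy (c i)).symm.trans (smul_one_eq_iff.2 ?_))
      exact cl_mono (Set.smul_set_mono (le_of_mem (hH i))) (Set.mem_iInter.1 hmem i)
    rw [key hμ, key hμ']

omit [SMulInvariantMeasure G X ν] in
theorem ae_normalizedSections (hg : ∀ᵐ x ∂ν, Good Γ F x) (hFm : MeasurableSet F) :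
    ∀ᵐ y ∂(ν.restrict F).map (code Γ F), y ∈ normalizedSections Γ := by
  have hcount : Countable (G ⧸ Γ) := Quotient.countable
  have hm : MeasurableSet (normalizedSections Γ) := by
    have h : normalizedSections Γ =
        (⋂ c, (fun y : YSpace Γ => y c) ⁻¹' {s | s • ((1 : G) : G ⧸ Γ) = c}) ∩
          (fun y : YSpace Γ => y ((1 : G) : G ⧸ Γ)) ⁻¹' {1} := by
      ext y
      simp [normalizedSections]
    rw [h]
    exact (MeasurableSet.iInter fun c =>
      measurable_pi_apply c (isClosed_fiber _ c).measurableSet).inter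
        (measurable_pi_apply ((1 : G) : G ⧸ Γ) (measurableSet_singleton 1))
  refine (ae_map_iff (aemeasurable_code hg hFm) hm).2 ?_
  filter_upwards [ae_good_restrict hg hFm] with x hx
  exact hx.2.code_mem hx.1

end Code

/-! ### The transformations of `F` and the Borel algebra -/

section Transformations

variable {G : Type*} [Group G] [Countable G] {X : Type*} [MulAction G X] [MeasurableSpace X]
  [MeasurableConstSMul G X] {ν : Measure X} [SMulInvariantMeasure G X ν] {Γ : Subgroup G}
  {F : Set X}

open Schlichting

omit [SMulInvariantMeasure G X ν] in
theorem aemeasurable_dotMap (hg : ∀ᵐ x ∂ν, Good Γ F x) (hFm : MeasurableSet F) (g : G) :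
    AEMeasurable (dotMap Γ F g) (ν.restrict F) := by
  let ι := {σ : G // (σ : G ⧸ Γ) = ((g⁻¹ : G) : G ⧸ Γ)}
  have h1 : (F : Set X) =ᵐ[ν] ⋃ σ : ι, F ∩ (σ : G) • F := by
    refine eventuallyEq_set.2 ?_
    filter_upwards [hg] with x hx
    simp only [Set.mem_iUnion]
    constructor
    · intro hF
      refine ⟨⟨sec Γ F x ((g⁻¹ : G) : G ⧸ Γ), hx.coe_sec _⟩, hF, ?_⟩
      rw [Set.mem_smul_set_iff_inv_smul_mem]
      exact hx.pt_mem _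
    · rintro ⟨σ, h, -⟩
      exact h
  rw [Measure.restrict_congr_set h1, aemeasurable_iUnion_iff]
  rintro ⟨σ, hσ⟩
  refine (measurable_const_smul σ⁻¹).aemeasurable.congr ?_
  refine (ae_restrict_iff' (hFm.inter (hFm.const_smul σ))).2 ?_
  filter_upwards [hg] with x hx hxσ
  rw [hx.dotMap_eq, pt, hx.sec_eq hσ]
  exact Set.mem_smul_set_iff_inv_smul_mem.1 hxσ.2

/-- The transformation of `Γg` preserves the measure, as a map from its domain of bijectivity
labelled by `α` onto its image: it is pieced together from the translations by the `σ⁻¹` with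
`σ ∈ g⁻¹Γ` and `σ α⁻¹ g ∈ Γ`, and `x` lies in the piece of `σ` if `σ` is the value of its section
at `g⁻¹Γ`. -/
theorem map_dotMap_restrict (hg : ∀ᵐ x ∂ν, Good Γ F x) (hFm : MeasurableSet F) (g : G) {α : G}
    (hα : α ∈ Γ) :
    ((ν.restrict F).restrict (code Γ F ⁻¹' initialCyl Γ g α)).map (dotMap Γ F g) =
      (ν.restrict F).restrict (code Γ F ⁻¹' finalCyl Γ g α) := by
  let ι := {σ : G // (σ : G ⧸ Γ) = ((g⁻¹ : G) : G ⧸ Γ) ∧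
    ((σ⁻¹ : G) : G ⧸ Γ) = ((α⁻¹ * g : G) : G ⧸ Γ)}
  have hmP : ∀ σ : ι, MeasurableSet (F ∩ (σ : G) • F) := fun σ => hFm.inter (hFm.const_smul _)
  have hmQ : ∀ σ : ι, MeasurableSet (F ∩ (σ : G)⁻¹ • F) := fun σ => hFm.inter (hFm.const_smul _)
  have h1 : code Γ F ⁻¹' initialCyl Γ g α =ᵐ[ν.restrict F] ⋃ σ : ι, F ∩ (σ : G) • F := by
    refine eventuallyEq_set.2 ?_
    filter_upwards [ae_good_restrict hg hFm] with x hx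
    rw [Set.mem_preimage, mem_initialCyl_iff (hx.2.code_mem hx.1) hα, code_eq, emb_smul]
    simp only [Set.mem_iUnion, Set.mem_inter_iff, Set.mem_smul_set_iff_inv_smul_mem]
    constructor
    · intro h
      refine ⟨⟨sec Γ F x ((g⁻¹ : G) : G ⧸ Γ), hx.2.coe_sec _, ?_⟩, hx.1, hx.2.pt_mem _⟩
      rw [← smul_coe_one, inv_smul_eq_iff, h]
    · rintro ⟨⟨σ, h1, h2⟩, -, h3⟩
      rw [hx.2.sec_eq h1 h3, ← h2, smul_coe, mul_inv_cancel]
  have h2 : code Γ F ⁻¹' finalCyl Γ g α =ᵐ[ν.restrict F] ⋃ σ : ι, F ∩ (σ : G)⁻¹ • F := by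
    refine eventuallyEq_set.2 ?_
    filter_upwards [ae_good_restrict hg hFm] with x hx
    rw [Set.mem_preimage, mem_finalCyl_iff (hx.2.code_mem hx.1) hα, code_eq, emb_smul]
    simp only [Set.mem_iUnion, Set.mem_inter_iff, Set.mem_smul_set_iff_inv_smul_mem]
    constructor
    · intro h
      refine ⟨⟨(sec Γ F x ((α⁻¹ * g : G) : G ⧸ Γ))⁻¹, ?_, ?_⟩, hx.1, ?_⟩
      · rw [← smul_coe_one, inv_smul_eq_iff, h]
      · rw [inv_inv, hx.2.coe_sec]
      · rw [inv_inv]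
        exact hx.2.pt_mem _
    · rintro ⟨⟨σ, h1, h2⟩, -, h3⟩
      rw [hx.2.sec_eq h2 h3, ← h1, smul_coe, inv_mul_cancel]
  have hP : (ν.restrict F).restrict (code Γ F ⁻¹' initialCyl Γ g α) =
      Measure.sum fun σ : ι => ν.restrict (F ∩ (σ : G) • F) := by
    rw [Measure.restrict_congr_set h1, Measure.restrict_restrict (MeasurableSet.iUnion hmP),
      Set.inter_eq_left.2 (Set.iUnion_subset fun σ => Set.inter_subset_left)]
    refine Measure.restrict_iUnion_ae (fun σ τ hστ => ?_) fun σ => (hmP σ).nullMeasurableSet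
    refine measure_eq_zero_iff_ae_notMem.2 ?_
    filter_upwards [hg] with x hx h
    exact hστ (Subtype.ext ((hx.sec_eq σ.2.1 (Set.mem_smul_set_iff_inv_smul_mem.1 h.1.2)).symm.trans
      (hx.sec_eq τ.2.1 (Set.mem_smul_set_iff_inv_smul_mem.1 h.2.2))))
  have hQ : (ν.restrict F).restrict (code Γ F ⁻¹' finalCyl Γ g α) =
      Measure.sum fun σ : ι => ν.restrict (F ∩ (σ : G)⁻¹ • F) := by
    rw [Measure.restrict_congr_set h2, Measure.restrict_restrict (MeasurableSet.iUnion hmQ),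
      Set.inter_eq_left.2 (Set.iUnion_subset fun σ => Set.inter_subset_left)]
    refine Measure.restrict_iUnion_ae (fun σ τ hστ => ?_) fun σ => (hmQ σ).nullMeasurableSet
    refine measure_eq_zero_iff_ae_notMem.2 ?_
    filter_upwards [hg] with x hx h
    exact hστ (Subtype.ext (inv_injective
      ((hx.sec_eq σ.2.2 (Set.mem_smul_set_iff_inv_smul_mem.1 h.1.2)).symm.trans
      (hx.sec_eq τ.2.2 (Set.mem_smul_set_iff_inv_smul_mem.1 h.2.2)))))
  have hmeas : AEMeasurable (dotMap Γ F g)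
      (Measure.sum fun σ : ι => ν.restrict (F ∩ (σ : G) • F)) := by
    rw [← hP]
    exact (aemeasurable_dotMap hg hFm g).restrict
  rw [hP, hQ, Measure.map_sum hmeas]
  congr 1
  funext σ
  have h3 : dotMap Γ F g =ᵐ[ν.restrict (F ∩ (σ : G) • F)] fun x => (σ : G)⁻¹ • x := by
    refine (ae_restrict_iff' (hmP σ)).2 ?_
    filter_upwards [hg] with x hx hxσ
    rw [hx.dotMap_eq, pt, hx.sec_eq σ.2.1]
    exact Set.mem_smul_set_iff_inv_smul_mem.1 hxσ.2
  rw [Measure.map_congr h3]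
  have h4 : F ∩ (σ : G) • F = (fun x => (σ : G)⁻¹ • x) ⁻¹' (F ∩ (σ : G)⁻¹ • F) := by
    ext x
    simp only [Set.mem_inter_iff, Set.mem_preimage, Set.mem_smul_set_iff_inv_smul_mem, inv_inv,
      smul_inv_smul]
    exact and_comm
  rw [h4]
  exact ((measurePreserving_smul (σ : G)⁻¹ ν).restrict_preimage (hmQ σ)).map_eq

/-- Each domain of bijectivity is mapped with preservation of the measure, and there are finitely
many of them. -/
theorem map_dotMap_le (hg : ∀ᵐ x ∂ν, Good Γ F x) (hFm : MeasurableSet F) (hΓ : AlmostNormal Γ)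
    (g : G) : (ν.restrict F).map (dotMap Γ F g) ≤
      ((isot Γ g).relIndex Γ : ℝ≥0∞) • ν.restrict F := by
  obtain ⟨r, hr⟩ := exists_rightTransversal (hΓ g)
  refine Measure.le_iff.2 fun E hE => ?_
  have hm := aemeasurable_dotMap hg hFm g
  rw [Measure.map_apply_of_aemeasurable hm hE]
  have hcover : (dotMap Γ F g ⁻¹' E : Set X) ≤ᵐ[ν.restrict F]
      ⋃ j, dotMap Γ F g ⁻¹' E ∩ code Γ F ⁻¹' initialCyl Γ g (r j) := by
    filter_upwards [ae_good_restrict hg hFm] with x hx hE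
    obtain ⟨j, hj, -⟩ := existsUnique_mem_initialCyl (hx.2.code_mem hx.1) hr
    exact Set.mem_iUnion.2 ⟨j, hE, hj⟩
  refine (measure_mono_ae hcover).trans ((measure_iUnion_le _).trans ?_)
  rw [tsum_fintype]
  have hle : ∀ j, ν.restrict F (dotMap Γ F g ⁻¹' E ∩ code Γ F ⁻¹' initialCyl Γ g (r j)) ≤
      ν.restrict F E := fun j => by
    have hn : NullMeasurableSet (code Γ F ⁻¹' initialCyl Γ g (r j)) (ν.restrict F) :=
      (aemeasurable_code hg hFm).nullMeasurable (measurableSet_initialCyl Γ g (r j))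
    rw [← Measure.restrict_apply₀' hn, ← Measure.map_apply_of_aemeasurable hm.restrict hE,
      map_dotMap_restrict hg hFm g (hr.1 j)]
    exact Measure.restrict_le_self E
  refine (Finset.sum_le_sum fun j _ => hle j).trans ?_
  simp

theorem measurePreserving_shift (hg : ∀ᵐ x ∂ν, Good Γ F x) (hFm : MeasurableSet F) (g : G) {α : G}
    (hα : α ∈ Γ) : MeasurePreserving (shift Γ g)
      (((ν.restrict F).map (code Γ F)).restrict (initialCyl Γ g α))
      (((ν.restrict F).map (code Γ F)).restrict (finalCyl Γ g α)) := by
  refine ⟨measurable_shift g, ?_⟩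
  have hc := aemeasurable_code hg hFm (Γ := Γ)
  have hd := aemeasurable_dotMap hg hFm g
  rw [Measure.restrict_map_of_aemeasurable hc (measurableSet_initialCyl _ _ _),
    Measure.restrict_map_of_aemeasurable hc (measurableSet_finalCyl _ _ _),
    ← map_dotMap_restrict hg hFm g hα,
    AEMeasurable.map_map_of_aemeasurable (measurable_shift g).aemeasurable hc.restrict,
    AEMeasurable.map_map_of_aemeasurable _ hd.restrict]
  · refine Measure.map_congr ?_
    filter_upwards [ae_restrict_of_ae (ae_good_restrict hg hFm)] with x hx
    exact (hx.2.code_dotMap g).symm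
  · rw [map_dotMap_restrict hg hFm g hα]
    exact hc.restrict

theorem quasiMeasurePreserving_shift (hg : ∀ᵐ x ∂ν, Good Γ F x) (hFm : MeasurableSet F) (g : G) :
    Measure.QuasiMeasurePreserving (shift Γ g) ((ν.restrict F).map (code Γ F))
      ((ν.restrict F).map (code Γ F)) := by
  refine ⟨measurable_shift g, Measure.AbsolutelyContinuous.mk fun E hE h0 => ?_⟩
  have hc := aemeasurable_code hg hFm (Γ := Γ)
  rw [Measure.map_apply (measurable_shift g) hE]
  rw [Measure.map_apply_of_aemeasurable hc hE] at h0
  rw [Measure.map_apply_of_aemeasurable hc (measurable_shift g hE)]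
  rw [measure_eq_zero_iff_ae_notMem] at h0 ⊢
  filter_upwards [ae_good_restrict hg hFm, ae_dotMap hg hFm h0 g] with x hx h h'
  rw [Set.mem_preimage, Set.mem_preimage, ← hx.2.code_dotMap] at h'
  exact h h'

/-! ### The Borel algebra of the relation -/

/-- The σ-algebra of the sets that agree up to a null set with the inverse image of a measurable
set under a map. -/
abbrev aeComap {Y : Type*} [MeasurableSpace Y] (μ : Measure X) (f : X → Y) : MeasurableSpace X where
  MeasurableSet' E := ∃ D : Set Y, MeasurableSet D ∧ E =ᵐ[μ] f ⁻¹' D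
  measurableSet_empty := ⟨∅, MeasurableSet.empty, EventuallyEq.rfl⟩
  measurableSet_compl := by
    rintro E ⟨D, hD, h⟩
    exact ⟨Dᶜ, hD.compl, h.compl⟩
  measurableSet_iUnion := by
    intro E hE
    choose D hD h using hE
    refine ⟨⋃ i, D i, MeasurableSet.iUnion hD, ?_⟩
    rw [Set.preimage_iUnion]
    exact Filter.EventuallyEq.countable_iUnion h

/-- The Borel algebra consists, up to null sets, of the inverse images of measurable sets under the
code. That these have the required invariance follows from `code_dotMap`; conversely the code is
measurable with respect to any σ-algebra that contains the null sets and the sets of the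
composition formula, since its entries are determined by where they send cosets. -/
theorem measurableSet_relBorel_iff (hg : ∀ᵐ x ∂ν, Good Γ F x) (hFm : MeasurableSet F)
    (E : Set X) : MeasurableSet[relBorel ν Γ F] E ↔
      ∃ D : Set (YSpace Γ), MeasurableSet D ∧ E =ᵐ[ν.restrict F] code Γ F ⁻¹' D := by
  constructor
  · intro h
    refine MeasurableSpace.measurableSet_sInf.1 h (aeComap (ν.restrict F) (code Γ F)) ⟨?_, ?_, ?_⟩
    · intro N hN
      refine ⟨∅, MeasurableSet.empty, ?_⟩
      rw [Set.preimage_empty]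
      exact ae_eq_empty.2 hN
    · intro h g r _
      refine ⟨_, measurableSet_compCyl Γ h r g, eventuallyEq_set.2 ?_⟩
      filter_upwards [ae_good_restrict hg hFm] with x hx
      exact hx.2.mem_compSet_iff hx.1 h r g
    · rintro g α hα E ⟨D, hD, hE⟩
      have hE' := eventuallyEq_set.1 hE
      constructor
      · refine ⟨_, (measurableSet_finalCyl Γ g α).inter (measurable_shift (g⁻¹ * α) hD),
          eventuallyEq_set.2 ?_⟩
        filter_upwards [ae_good_restrict hg hFm,
          ae_restrict_of_ae (ae_restrict_of_ae_smul (G := G) hFm hE')] with y hy hEy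
        have hpt : ∀ c, pt Γ F c y ∈ E ↔ code Γ F (pt Γ F c y) ∈ D :=
          fun c => hEy _ (hy.2.pt_mem c)
        constructor
        · rintro ⟨x, ⟨hxE, hxb⟩, rfl⟩
          -- `x` lies in the orbit of the good point `dotMap g x`, hence is good
          have hx : Good Γ F x := by
            have h := hy.2
            rw [dotMap] at h
            split_ifs at h with h'
            · simpa using h.smul h'.choose⁻¹
            · exact h
          have hxF : x ∈ F := hxb.1
          have hxi := (hx.mem_bijDomain_iff hxF hα).1 hxb
          have hfin := shift_mem_finalCyl (hx.code_mem hxF) hα hxi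
          rw [← hx.code_dotMap] at hfin
          refine ⟨hfin, ?_⟩
          rw [Set.mem_preimage, ← hy.2.code_dotMap, hx.dotMap_inv_dotMap hxF hα hxi]
          have h1 := hpt (((g⁻¹ * α)⁻¹ : G) : G ⧸ Γ)
          rw [← hy.2.dotMap_eq, hx.dotMap_inv_dotMap hxF hα hxi] at h1
          exact h1.1 hxE
        · rintro ⟨h1, h2⟩
          rw [Set.mem_preimage, ← hy.2.code_dotMap, hy.2.dotMap_eq, ← hpt, ← hy.2.dotMap_eq] at h2
          refine ⟨_, ⟨h2, ?_⟩, hy.2.dotMap_dotMap_inv hy.1 hα h1⟩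
          rw [(hy.2.good_dotMap _).mem_bijDomain_iff (hy.2.dotMap_mem _) hα, hy.2.code_dotMap,
            ← finalCyl_inv_iff_initialCyl (shift_mem (hy.2.code_mem hy.1) _) hα]
          exact shift_mem_finalCyl (hy.2.code_mem hy.1) (one_mem Γ)
            ((finalCyl_iff_initialCyl (hy.2.code_mem hy.1) hα).1 h1)
      · refine ⟨_, (measurableSet_initialCyl Γ g α).inter (measurable_shift g hD),
          eventuallyEq_set.2 ?_⟩
        filter_upwards [ae_good_restrict hg hFm, ae_dotMap hg hFm hE' g] with x hx h
        rw [Set.mem_inter_iff, hx.2.mem_bijDomain_iff hx.1 hα, Set.mem_preimage, h]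
        simp only [Set.mem_preimage, Set.mem_inter_iff, ← hx.2.code_dotMap]
  · rintro ⟨D, hD, hE⟩
    -- the conditions on the values of a section at `g` come from the composition formula
    have hbasic : ∀ g σ : G, {x | (emb Γ g)⁻¹ * code Γ F x g ∈ clSubgroup Γ (isot Γ σ)}
        =ᵐ[ν.restrict F] compSet Γ F σ⁻¹ 1 g⁻¹ := fun g σ => by
      refine eventuallyEq_set.2 ?_
      filter_upwards [ae_good_restrict hg hFm] with x hx
      rw [hx.2.mem_compSet_iff hx.1, compCyl, mem_cyl_smul, one_mul, inv_inv, inv_inv, map_inv,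
        ← mem_clSubgroup, inv_inv]
    have hfiber : ∀ g σ d : G,
        {x | code Γ F x g • (σ : G ⧸ Γ) = d} =ᵐ[ν.restrict F] (∅ : Set X) ∨
        ∃ γ ∈ Γ, {x | code Γ F x g • (σ : G ⧸ Γ) = d} =ᵐ[ν.restrict F]
          compSet Γ F σ⁻¹ 1 (g * γ)⁻¹ := fun g σ d => by
      by_cases hγ : ∃ γ ∈ Γ, (g * γ) • (σ : G ⧸ Γ) = d
      · obtain ⟨γ, hγ, hd⟩ := hγ
        refine Or.inr ⟨γ, hγ, EventuallyEq.trans (eventuallyEq_set.2 ?_) (hbasic (g * γ) σ)⟩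
        filter_upwards [ae_good_restrict hg hFm] with x hx
        rw [coe_mul_of_mem g hγ, mem_clSubgroup_isot, mul_smul, mul_smul,
          (hx.2.code_mem hx.1).1, inv_smul_eq_iff, inv_smul_eq_iff, emb_smul, emb_smul, hd,
          smul_coe_one, coe_mul_of_mem g hγ]
        exact (and_iff_right rfl).symm
      · refine Or.inl (eventuallyEq_set.2 ?_)
        filter_upwards [ae_good_restrict hg hFm] with x hx
        refine iff_of_false (fun h => hγ ?_) (Set.notMem_empty x)
        refine ⟨g⁻¹ * sec Γ F x g, QuotientGroup.eq.1 (hx.2.coe_sec (g : G ⧸ Γ)).symm, ?_⟩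
        rw [mul_inv_cancel_left, ← emb_smul, ← code_eq]
        exact h
    have hempty := fun s : Set X => ae_eq_empty (μ := ν.restrict F) (s := s)
    have hdiff := fun s t : Set X => ae_eq_set (μ := ν.restrict F) (s := s) (t := t)
    refine MeasurableSpace.measurableSet_sInf.2 fun m hm => ?_
    obtain ⟨hnull, hcomp, -⟩ := hm
    have hcongr : ∀ A B : Set X, A =ᵐ[ν.restrict F] B → MeasurableSet[m] B → MeasurableSet[m] A := by
      intro A B hAB hB
      have h := (hdiff _ _).1 hAB
      have : A = (B \ (B \ A)) ∪ (A \ B) := by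
        ext x
        simp only [Set.mem_union, Set.mem_sdiff]
        tauto
      rw [this]
      exact (hB.diff (hnull _ h.2)).union (hnull _ h.1)
    refine hcongr _ _ hE ?_
    have hmeas : Measurable[m] (code Γ F) := by
      refine @measurable_pi_iff _ _ _ m _ _ |>.2 fun c => @measurable_of_fibers _ _ _ _ _ m _ ?_
      intro c' d
      obtain ⟨g, rfl⟩ := QuotientGroup.mk_surjective c
      obtain ⟨σ, rfl⟩ := QuotientGroup.mk_surjective c'
      obtain ⟨d, rfl⟩ := QuotientGroup.mk_surjective d
      rcases hfiber g σ d with h | ⟨γ, -, h⟩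
      · exact hnull _ ((hempty _).1 h)
      · exact hcongr _ _ h (hcomp _ _ _ (one_mem Γ))
    exact hmeas hD

end Transformations

end CosetAlgebra

namespace LinftyAlgebra

/-! ### Characteristic functions in `L^∞` -/

variable {α : Type*} [MeasurableSpace α] {μ : Measure α}

theorem coeFn_chi {E : Set α} (hE : MeasurableSet E) :
    ⇑(chi μ hE) =ᵐ[μ] E.indicator fun _ => (1 : ℂ) := MemLp.coeFn_toLp _

theorem star_chi {E : Set α} (hE : MeasurableSet E) : star (chi μ hE) = chi μ hE := by
  apply Lp.ext
  filter_upwards [Lp.coeFn_star (chi μ hE), coeFn_chi (μ := μ) hE] with x h1 h2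
  rw [h1, Pi.star_apply, h2]
  by_cases hx : x ∈ E <;> simp [hx]

theorem chi_mul_chi {E E' E'' : Set α} (hE : MeasurableSet E) (hE' : MeasurableSet E')
    (hE'' : MeasurableSet E'') (h : ∀ᵐ x ∂μ, x ∈ E'' ↔ x ∈ E ∧ x ∈ E') :
    chi μ hE * chi μ hE' = chi μ hE'' := by
  apply Lp.ext
  filter_upwards [coeFn_mul (chi μ hE) (chi μ hE'), coeFn_chi (μ := μ) hE, coeFn_chi (μ := μ) hE',
    coeFn_chi (μ := μ) hE'', h] with x h1 h2 h3 h4 h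
  rw [h1, Pi.mul_apply, h2, h3, h4]
  by_cases hx : x ∈ E <;> by_cases hx' : x ∈ E' <;> simp [hx, hx', h]

theorem chi_mul_self {E : Set α} (hE : MeasurableSet E) : chi μ hE * chi μ hE = chi μ hE :=
  chi_mul_chi hE hE hE (Eventually.of_forall fun _ => (and_self_iff).symm)

theorem chi_mul_eq_zero {E E' : Set α} (hE : MeasurableSet E) (hE' : MeasurableSet E')
    (h : ∀ᵐ x ∂μ, x ∈ E → x ∉ E') : chi μ hE * chi μ hE' = 0 := by
  apply Lp.ext
  filter_upwards [coeFn_mul (chi μ hE) (chi μ hE'), coeFn_chi (μ := μ) hE, coeFn_chi (μ := μ) hE',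
    Lp.coeFn_zero ℂ ∞ μ, h] with x h1 h2 h3 h4 h
  rw [h1, Pi.mul_apply, h2, h3, h4]
  by_cases hx : x ∈ E
  · simp [hx, h hx]
  · simp [hx]

theorem coeFn_finset_sum {ι : Type*} (s : Finset ι) (f : ι → Lp ℂ ∞ μ) :
    ⇑(∑ i ∈ s, f i) =ᵐ[μ] fun x => ∑ i ∈ s, f i x := by
  classical
  induction s using Finset.induction_on with
  | empty =>
    simp only [Finset.sum_empty]
    exact Lp.coeFn_zero ℂ ∞ μ
  | insert i s hi ih =>
    rw [Finset.sum_insert hi]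
    filter_upwards [Lp.coeFn_add (f i) (∑ i ∈ s, f i), ih] with x h1 h2
    rw [h1, Pi.add_apply, h2, Finset.sum_insert hi]

/-- The characteristic functions of the members of a partition add up to `1`. -/
theorem sum_chi_eq_one {ι : Type*} [Fintype ι] {E : ι → Set α} (hE : ∀ i, MeasurableSet (E i))
    (h : ∀ᵐ x ∂μ, ∃! i, x ∈ E i) : ∑ i, chi μ (hE i) = 1 := by
  classical
  apply Lp.ext
  filter_upwards [coeFn_finset_sum Finset.univ fun i => chi μ (hE i), coeFn_one (μ := μ),
    ae_all_iff.2 fun i => coeFn_chi (μ := μ) (hE i), h] with x h1 h2 h3 ⟨i, hi, hu⟩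
  rw [h1, h2, Finset.sum_eq_single i]
  · rw [h3, Set.indicator_of_mem hi]
  · intro j _ hj
    rw [h3, Set.indicator_of_notMem fun hx => hj (hu j hx)]
  · simp

theorem ae_norm_le (f : Lp ℂ ∞ μ) : ∀ᵐ x ∂μ, ‖f x‖ ≤ ‖f‖ := by
  have h1 := Lp.eLpNorm_ne_top f
  rw [eLpNorm_exponent_top] at h1
  filter_upwards [enorm_ae_le_eLpNormEssSup f μ] with x hx
  rw [Lp.norm_def, eLpNorm_exponent_top, ← toReal_enorm]
  exact ENNReal.toReal_mono h1 hx

theorem exists_comp {φ : α → α} (hφ : Measure.QuasiMeasurePreserving φ μ μ) (f : Lp ℂ ∞ μ) :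
    ∃ f' : Lp ℂ ∞ μ, ⇑f' =ᵐ[μ] fun x => f (φ x) := by
  have h : MemLp (fun x => f (φ x)) ∞ μ :=
    memLp_top_of_bound ((Lp.aestronglyMeasurable f).comp_quasiMeasurePreserving hφ) ‖f‖
      (hφ.ae (ae_norm_le f))
  exact ⟨h.toLp _, h.coeFn_toLp⟩

end LinftyAlgebra

namespace CosetAlgebra

/-! ### Consequences of the relations -/

namespace CosetRelations

variable {G : Type*} [Group G] {Γ : Subgroup G} {μ : Measure (YSpace Γ)}
  {D : Type*} [Ring D] [StarRing D] [Algebra ℂ D] {ρ : Lp ℂ ∞ μ →⋆ₐ[ℂ] D} {t : G → D}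

section Single

variable (hrel : CosetRelations Γ μ ρ t) (hΓ : AlmostNormal Γ)
  (hns : ∀ᵐ y ∂μ, y ∈ normalizedSections Γ)

include hrel

theorem eq_of_coe_eq {g h : G} (e : ((g⁻¹ : G) : G ⧸ Γ) = ((h⁻¹ : G) : G ⧸ Γ)) : t g = t h := by
  have := hrel.coset _ (QuotientGroup.eq.1 e) h
  rwa [inv_inv, inv_mul_cancel_right] at this

theorem eq_one_of_mem {g : G} (h : g ∈ Γ) : t g = 1 := by
  have := hrel.coset g h 1
  rwa [mul_one, hrel.one] at this

include hΓ hns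

/-- In the composition formula for `t (g⁻¹α) t g`, all terms but one vanish on the domain labelled by
`α`, and this one is the identity. -/
theorem inv_mul_partial (g : G) {α : G} (hα : α ∈ Γ) :
    t (g⁻¹ * α) * (t g * ρ (chi μ (measurableSet_initialCyl Γ g α))) =
      ρ (chi μ (measurableSet_initialCyl Γ g α)) := by
  obtain ⟨r, hr⟩ := exists_rightTransversal (hΓ (g⁻¹ * α)⁻¹)
  have hj : ∀ j, t (g⁻¹ * α * r j * g) * ρ (chi μ (measurableSet_compCyl Γ (g⁻¹ * α) (r j) g)) *
      ρ (chi μ (measurableSet_initialCyl Γ g α)) =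
      ρ (chi μ (measurableSet_compCyl Γ (g⁻¹ * α) (r j) g)) *
      ρ (chi μ (measurableSet_initialCyl Γ g α)) := fun j => by
    by_cases hmem : g⁻¹ * α * r j * g ∈ Γ
    · rw [hrel.eq_one_of_mem hmem, one_mul]
    · rw [mul_assoc, ← map_mul, chi_mul_eq_zero, map_zero, mul_zero]
      filter_upwards [hns] with y hy h1 h2
      exact hmem (mem_of_mem_compCyl_of_mem_initialCyl hy hα (hr.1 j) h1 h2)
  rw [← mul_assoc, hrel.composition _ _ r hr, Finset.sum_mul, Finset.sum_congr rfl fun j _ => hj j,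
    ← Finset.sum_mul, ← map_sum, sum_chi_eq_one, map_one, one_mul]
  filter_upwards [hns] with y hy
  exact existsUnique_mem_compCyl hy g hr

/-- The adjoint of the partial isometry of `Γg` and `α` is that of `Γg⁻¹α`. -/
theorem star_partial (g : G) {α : G} (hα : α ∈ Γ) :
    star (t g * ρ (chi μ (measurableSet_initialCyl Γ g α))) =
      t (g⁻¹ * α) * ρ (chi μ (measurableSet_finalCyl Γ g α)) := by
  set p := ρ (chi μ (measurableSet_initialCyl Γ g α)) with hp
  have hpp : p * p = p := by rw [hp, ← map_mul, chi_mul_self]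
  have hps : star p = p := by rw [hp, ← map_star, star_chi]
  have h1 := hrel.inv_mul_partial hΓ hns g hα
  rw [← hrel.final g α hα, ← hp, ← mul_assoc, h1, star_mul, ← mul_assoc, hps, hpp]

/-- The adjoint is a sum over the domains of bijectivity. -/
theorem star_eq_sum (g : G) {r : Fin ((isot Γ g).relIndex Γ) → G}
    (hr : IsRightTransversal (isot Γ g) Γ r) :
    star (t g) = ∑ j, t (g⁻¹ * r j) * ρ (chi μ (measurableSet_finalCyl Γ g (r j))) := by
  have h1 : ∑ j, chi μ (measurableSet_initialCyl Γ g (r j)) = 1 := by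
    refine sum_chi_eq_one (fun j => measurableSet_initialCyl Γ g (r j)) ?_
    filter_upwards [hns] with y hy
    exact existsUnique_mem_initialCyl hy hr
  conv_lhs => rw [← mul_one (t g), ← map_one ρ, ← h1, map_sum, Finset.mul_sum, star_sum]
  exact Finset.sum_congr rfl fun j _ => hrel.star_partial hΓ hns g (hr.1 j)

end Single

/-- The linear map of the free module on the cosets, with coefficients in `L^∞`, to `D`: it sends
the coset `c` with coefficient `f` to `t(g) f`, `c = g⁻¹Γ`. -/
noncomputable def lam (ρ : Lp ℂ ∞ μ →⋆ₐ[ℂ] D) (t : G → D) : ((G ⧸ Γ) →₀ Lp ℂ ∞ μ) →ₗ[ℂ] D :=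
  Finsupp.lsum ℂ fun c => (LinearMap.mulLeft ℂ (t c.out⁻¹)).comp ρ.toAlgHom.toLinearMap

theorem lam_single (c : G ⧸ Γ) (f : Lp ℂ ∞ μ) :
    lam ρ t (Finsupp.single c f) = t c.out⁻¹ * ρ f := by
  rw [lam, Finsupp.lsum_single]
  rfl

theorem lam_single_coe (hrel : CosetRelations Γ μ ρ t) (g : G) (f : Lp ℂ ∞ μ) :
    lam ρ t (Finsupp.single ((g⁻¹ : G) : G ⧸ Γ) f) = t g * ρ f := by
  rw [lam_single, hrel.eq_of_coe_eq (g := (((g⁻¹ : G) : G ⧸ Γ).out)⁻¹) (h := g)]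
  rw [inv_inv, QuotientGroup.out_eq']

/-- The product of two terms `t g f`, by covariance and the composition formula. -/
theorem lam_single_mul_single (hrel : CosetRelations Γ μ ρ t) (c d : G ⧸ Γ)
    (f f' : Lp ℂ ∞ μ) {k : Lp ℂ ∞ μ} (hk : ⇑k =ᵐ[μ] fun y => f (shift Γ d.out⁻¹ y))
    {r : Fin ((isot Γ (c.out⁻¹)⁻¹).relIndex Γ) → G}
    (hr : IsRightTransversal (isot Γ (c.out⁻¹)⁻¹) Γ r) :
    lam ρ t (Finsupp.single c f) * lam ρ t (Finsupp.single d f') =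
      lam ρ t (∑ j, Finsupp.single ((((c.out⁻¹ * r j * d.out⁻¹)⁻¹ : G) : G ⧸ Γ))
        (chi μ (measurableSet_compCyl Γ c.out⁻¹ (r j) d.out⁻¹) * (k * f'))) := by
  rw [lam_single, lam_single, mul_assoc, ← mul_assoc (ρ f), hrel.covariance _ f k hk,
    mul_assoc, ← mul_assoc (t _), hrel.composition _ _ r hr, Finset.sum_mul, map_sum]
  refine Finset.sum_congr rfl fun j _ => ?_
  rw [hrel.lam_single_coe, map_mul, map_mul, mul_assoc]

theorem star_lam_single (hrel : CosetRelations Γ μ ρ t) (hΓ : AlmostNormal Γ)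
    (hns : ∀ᵐ y ∂μ, y ∈ normalizedSections Γ) (c : G ⧸ Γ) (f : Lp ℂ ∞ μ)
    {r : Fin ((isot Γ c.out⁻¹).relIndex Γ) → G} (hr : IsRightTransversal (isot Γ c.out⁻¹) Γ r)
    {k : Fin ((isot Γ c.out⁻¹).relIndex Γ) → Lp ℂ ∞ μ}
    (hk : ∀ j, ⇑(k j) =ᵐ[μ] fun y => (star f) (shift Γ ((c.out⁻¹)⁻¹ * r j) y)) :
    star (lam ρ t (Finsupp.single c f)) =
      lam ρ t (∑ j, Finsupp.single (((((c.out⁻¹)⁻¹ * r j)⁻¹ : G) : G ⧸ Γ))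
        (k j * chi μ (measurableSet_finalCyl Γ c.out⁻¹ (r j)))) := by
  rw [lam_single, star_mul, ← map_star, hrel.star_eq_sum hΓ hns _ hr, Finset.mul_sum, map_sum]
  refine Finset.sum_congr rfl fun j _ => ?_
  rw [← mul_assoc, hrel.covariance _ _ _ (hk j), hrel.lam_single_coe, map_mul, mul_assoc]

theorem lam_one (hrel : CosetRelations Γ μ ρ t) :
    lam ρ t (Finsupp.single ((1 : G) : G ⧸ Γ) 1) = 1 := by
  have := hrel.lam_single_coe 1 1
  rwa [inv_one, hrel.one, map_one, one_mul] at this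

section Two

variable {D' : Type*} [Ring D'] [StarRing D'] [Algebra ℂ D'] {ρ' : Lp ℂ ∞ μ →⋆ₐ[ℂ] D'} {t' : G → D'}
  (hrel : CosetRelations Γ μ ρ t) (hrel' : CosetRelations Γ μ ρ' t') (hΓ : AlmostNormal Γ)
  (hns : ∀ᵐ y ∂μ, y ∈ normalizedSections Γ)
  (hq : ∀ g, Measure.QuasiMeasurePreserving (shift Γ g) μ μ)

include hrel hrel' hΓ hq

/-- Products are computed by the relations alone, in the same way in any two algebras. -/
theorem exists_lam_mul (a b : (G ⧸ Γ) →₀ Lp ℂ ∞ μ) :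
    ∃ c, lam ρ t a * lam ρ t b = lam ρ t c ∧ lam ρ' t' a * lam ρ' t' b = lam ρ' t' c := by
  induction a using Finsupp.induction_linear with
  | zero => exact ⟨0, by simp⟩
  | add a a' ha ha' =>
    obtain ⟨c, h1, h2⟩ := ha
    obtain ⟨c', h1', h2'⟩ := ha'
    exact ⟨c + c', by simp only [map_add, add_mul, h1, h1'],
      by simp only [map_add, add_mul, h2, h2']⟩
  | single d f =>
    induction b using Finsupp.induction_linear with
    | zero => exact ⟨0, by simp⟩
    | add a a' ha ha' =>
      obtain ⟨c, h1, h2⟩ := ha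
      obtain ⟨c', h1', h2'⟩ := ha'
      exact ⟨c + c', by simp only [map_add, mul_add, h1, h1'],
        by simp only [map_add, mul_add, h2, h2']⟩
    | single e f' =>
      obtain ⟨k, hk⟩ := exists_comp (hq e.out⁻¹) f
      obtain ⟨r, hr⟩ := exists_rightTransversal (hΓ (d.out⁻¹)⁻¹)
      exact ⟨_, hrel.lam_single_mul_single d e f f' hk hr,
        hrel'.lam_single_mul_single d e f f' hk hr⟩

include hns

/-- Adjoints are computed by the relations alone, in the same way in any two algebras. -/
theorem exists_lam_star (a : (G ⧸ Γ) →₀ Lp ℂ ∞ μ) :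
    ∃ c, star (lam ρ t a) = lam ρ t c ∧ star (lam ρ' t' a) = lam ρ' t' c := by
  induction a using Finsupp.induction_linear with
  | zero => exact ⟨0, by simp⟩
  | add a a' ha ha' =>
    obtain ⟨c, h1, h2⟩ := ha
    obtain ⟨c', h1', h2'⟩ := ha'
    exact ⟨c + c', by simp only [map_add, star_add, h1, h1'],
      by simp only [map_add, star_add, h2, h2']⟩
  | single d f =>
    obtain ⟨r, hr⟩ := exists_rightTransversal (hΓ d.out⁻¹)
    choose k hk using fun j => exists_comp (hq ((d.out⁻¹)⁻¹ * r j)) (star f)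
    exact ⟨_, hrel.star_lam_single hΓ hns d f hr hk, hrel'.star_lam_single hΓ hns d f hr hk⟩

end Two

section Presentation

variable [StarModule ℂ D] (hrel : CosetRelations Γ μ ρ t) (hΓ : AlmostNormal Γ)
  (hns : ∀ᵐ y ∂μ, y ∈ normalizedSections Γ)
  (hq : ∀ g, Measure.QuasiMeasurePreserving (shift Γ g) μ μ)

include hrel hΓ hns hq

/-- The `*`-algebra generated by the `t g` and `L^∞` is the span of the products `t(g) f`. -/
theorem coe_adjoin_eq_range :
    (StarAlgebra.adjoin ℂ (Set.range t ∪ Set.range ρ) : Set D) = Set.range (lam ρ t) := by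
  apply Set.Subset.antisymm
  · let S : StarSubalgebra ℂ D :=
      { carrier := Set.range (lam ρ t)
        mul_mem' := by
          rintro _ _ ⟨a, rfl⟩ ⟨b, rfl⟩
          obtain ⟨c, hc, -⟩ := exists_lam_mul hrel hrel hΓ hq a b
          exact ⟨c, hc.symm⟩
        add_mem' := by
          rintro _ _ ⟨a, rfl⟩ ⟨b, rfl⟩
          exact ⟨a + b, map_add _ _ _⟩
        algebraMap_mem' := fun z => ⟨z • Finsupp.single ((1 : G) : G ⧸ Γ) 1, by
          rw [map_smul, hrel.lam_one, Algebra.algebraMap_eq_smul_one]⟩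
        star_mem' := by
          rintro _ ⟨a, rfl⟩
          obtain ⟨c, hc, -⟩ := exists_lam_star hrel hrel hΓ hns hq a
          exact ⟨c, hc.symm⟩ }
    have h : StarAlgebra.adjoin ℂ (Set.range t ∪ Set.range ρ) ≤ S := by
      refine StarAlgebra.adjoin_le ?_
      rintro _ (⟨g, rfl⟩ | ⟨f, rfl⟩)
      · exact ⟨_, (hrel.lam_single_coe g 1).trans (by rw [map_one, mul_one])⟩
      · exact ⟨_, (hrel.lam_single_coe 1 f).trans (by rw [hrel.one, one_mul])⟩
    exact h
  · rintro _ ⟨a, rfl⟩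
    induction a using Finsupp.induction_linear with
    | zero => rw [map_zero]; exact zero_mem (StarAlgebra.adjoin ℂ (Set.range t ∪ Set.range ρ))
    | add a b ha hb => rw [map_add]; exact add_mem ha hb
    | single c f =>
      rw [lam_single]
      exact mul_mem (StarAlgebra.subset_adjoin _ _ (Or.inl ⟨_, rfl⟩))
        (StarAlgebra.subset_adjoin _ _ (Or.inr ⟨_, rfl⟩))

/-- The relations present the algebra, as soon as its elements have unique expressions as sums of
products `t(g) f` over distinct cosets. -/
theorem existsUnique_starAlgHom (hinj : Function.Injective (lam ρ t)) {D' : Type*} [Ring D']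
    [StarRing D'] [Algebra ℂ D'] [StarModule ℂ D'] {ρ' : Lp ℂ ∞ μ →⋆ₐ[ℂ] D'} {t' : G → D'}
    (hrel' : CosetRelations Γ μ ρ' t') :
    ∃! Φ : StarAlgebra.adjoin ℂ (Set.range t ∪ Set.range ρ) →⋆ₐ[ℂ] D',
      (∀ (a : StarAlgebra.adjoin ℂ (Set.range t ∪ Set.range ρ)) (g : G),
        (a : D) = t g → Φ a = t' g) ∧
      (∀ (a : StarAlgebra.adjoin ℂ (Set.range t ∪ Set.range ρ)) (f : Lp ℂ ∞ μ),
        (a : D) = ρ f → Φ a = ρ' f) := by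
  have hcoe := hrel.coe_adjoin_eq_range hΓ hns hq
  have hex : ∀ a : StarAlgebra.adjoin ℂ (Set.range t ∪ Set.range ρ), ∃ c, lam ρ t c = a :=
    fun a => hcoe.subset a.2
  choose coef hcoef using hex
  have hval : ∀ (a : StarAlgebra.adjoin ℂ (Set.range t ∪ Set.range ρ)) (c), lam ρ t c = a → lam ρ' t' (coef a) = lam ρ' t' c := fun a c h => by
    rw [hinj ((hcoef a).trans h.symm)]
  let Φ : StarAlgebra.adjoin ℂ (Set.range t ∪ Set.range ρ) →⋆ₐ[ℂ] D' :=
    { toFun := fun a => lam ρ' t' (coef a)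
      map_one' := by rw [hval 1 _ hrel.lam_one, hrel'.lam_one]
      map_mul' := fun a b => by
        obtain ⟨c, h1, h2⟩ := exists_lam_mul hrel hrel' hΓ hq (coef a) (coef b)
        rw [h2, hval (a * b) c]
        rw [← h1, hcoef, hcoef]
        rfl
      map_zero' := by rw [hval 0 0 (map_zero _), map_zero]
      map_add' := fun a b => by
        rw [hval (a + b) (coef a + coef b), map_add]
        rw [map_add, hcoef, hcoef]
        rfl
      commutes' := fun z => by
        rw [hval _ (z • Finsupp.single ((1 : G) : G ⧸ Γ) 1), map_smul, hrel'.lam_one,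
          Algebra.algebraMap_eq_smul_one]
        rw [map_smul, hrel.lam_one, Algebra.algebraMap_eq_smul_one]
        rfl
      map_star' := fun a => by
        obtain ⟨c, h1, h2⟩ := exists_lam_star hrel hrel' hΓ hns hq (coef a)
        rw [h2, hval (star a) c]
        rw [← h1, hcoef]
        rfl }
  refine ⟨Φ, ⟨fun a g h => ?_, fun a f h => ?_⟩, ?_⟩
  · change lam ρ' t' (coef a) = t' g
    rw [hval a (Finsupp.single ((g⁻¹ : G) : G ⧸ Γ) 1), hrel'.lam_single_coe, map_one, mul_one]
    rw [hrel.lam_single_coe, map_one, mul_one, h]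
  · change lam ρ' t' (coef a) = ρ' f
    rw [hval a (Finsupp.single ((1⁻¹ : G) : G ⧸ Γ) f), hrel'.lam_single_coe, hrel'.one, one_mul]
    rw [hrel.lam_single_coe, hrel.one, one_mul, h]
  · rintro Ψ ⟨h1, h2⟩
    refine DFunLike.ext _ _ fun a => ?_
    change Ψ a = lam ρ' t' (coef a)
    have key : ∀ c, ∀ b : StarAlgebra.adjoin ℂ (Set.range t ∪ Set.range ρ),
        (b : D) = lam ρ t c → Ψ b = lam ρ' t' c := by
      intro c
      induction c using Finsupp.induction_linear with
      | zero =>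
        intro b hb
        obtain rfl : b = 0 := Subtype.ext (hb.trans (map_zero _))
        rw [map_zero, map_zero]
      | add c c' hc hc' =>
        intro b hb
        let x : StarAlgebra.adjoin ℂ (Set.range t ∪ Set.range ρ) := ⟨_, hcoe.symm.subset ⟨c, rfl⟩⟩
        let x' : StarAlgebra.adjoin ℂ (Set.range t ∪ Set.range ρ) := ⟨_, hcoe.symm.subset ⟨c', rfl⟩⟩
        obtain rfl : b = x + x' := Subtype.ext (hb.trans (map_add _ _ _))
        rw [map_add, map_add, hc x rfl, hc' x' rfl]
      | single c f =>
        intro b hb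
        let x : StarAlgebra.adjoin ℂ (Set.range t ∪ Set.range ρ) :=
          ⟨t c.out⁻¹, StarAlgebra.subset_adjoin _ _ (Or.inl ⟨_, rfl⟩)⟩
        let x' : StarAlgebra.adjoin ℂ (Set.range t ∪ Set.range ρ) :=
          ⟨ρ f, StarAlgebra.subset_adjoin _ _ (Or.inr ⟨_, rfl⟩)⟩
        obtain rfl : b = x * x' := Subtype.ext (hb.trans (lam_single c f))
        rw [map_mul, lam_single, h1 x _ rfl, h2 x' f rfl]
    exact key _ _ (hcoef a).symm

end Presentation

end CosetRelations

/-! ### Operators on `L²` -/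

section L2Operators

variable {X : Type*} [MeasurableSpace X] {μ : Measure X}

/-- A map into functions that is linear and bounded up to null sets defines a bounded operator. -/
theorem exists_clm (Ψ : Lp ℂ 2 μ → X → ℂ) (hmem : ∀ ξ, MemLp (Ψ ξ) 2 μ)
    (hadd : ∀ ξ η, Ψ (ξ + η) =ᵐ[μ] Ψ ξ + Ψ η) (hsmul : ∀ (c : ℂ) ξ, Ψ (c • ξ) =ᵐ[μ] c • Ψ ξ)
    (C : ℝ) (hC : 0 ≤ C)
    (hb : ∀ ξ : Lp ℂ 2 μ, eLpNorm (Ψ ξ) 2 μ ≤ ENNReal.ofReal C * eLpNorm ξ 2 μ) :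
    ∃ T : Lp ℂ 2 μ →L[ℂ] Lp ℂ 2 μ, ∀ ξ, T ξ =ᵐ[μ] Ψ ξ := by
  let T₀ : Lp ℂ 2 μ →ₗ[ℂ] Lp ℂ 2 μ :=
    { toFun := fun ξ => (hmem ξ).toLp _
      map_add' := fun ξ η => by
        apply Lp.ext
        filter_upwards [(hmem (ξ + η)).coeFn_toLp, (hmem ξ).coeFn_toLp, (hmem η).coeFn_toLp,
          hadd ξ η, Lp.coeFn_add ((hmem ξ).toLp _) ((hmem η).toLp _)] with x h1 h2 h3 h4 h5
        rw [h1, h4, h5, Pi.add_apply, Pi.add_apply, h2, h3]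
      map_smul' := fun c ξ => by
        apply Lp.ext
        filter_upwards [(hmem (c • ξ)).coeFn_toLp, (hmem ξ).coeFn_toLp, hsmul c ξ,
          Lp.coeFn_smul c ((hmem ξ).toLp _)] with x h1 h2 h3 h4
        rw [h1, h3, RingHom.id_apply, h4, Pi.smul_apply, Pi.smul_apply, h2] }
  refine ⟨T₀.mkContinuous C fun ξ => ?_, fun ξ => (hmem ξ).coeFn_toLp⟩
  change ‖(hmem ξ).toLp _‖ ≤ _
  rw [Lp.norm_toLp, Lp.norm_def, ← ENNReal.toReal_ofReal hC, ← ENNReal.toReal_mul]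
  exact ENNReal.toReal_mono (ENNReal.mul_ne_top ENNReal.ofReal_ne_top (Lp.eLpNorm_ne_top ξ)) (hb ξ)

/-- Composition with a map that increases the measure by a bounded factor at most. -/
theorem exists_compOp {f : X → X} (hf : AEMeasurable f μ) {n : ℕ}
    (h : μ.map f ≤ (n : ℝ≥0∞) • μ) :
    ∃ T : Lp ℂ 2 μ →L[ℂ] Lp ℂ 2 μ, ∀ ξ, T ξ =ᵐ[μ] fun x => ξ (f x) := by
  have hac : μ.map f ≪ μ := (Measure.absolutelyContinuous_of_le h).trans
    (Measure.smul_absolutelyContinuous)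
  have hae : ∀ {P : X → Prop}, (∀ᵐ x ∂μ, P x) → ∀ᵐ x ∂μ, P (f x) := fun hP =>
    ae_of_ae_map hf (hac.ae_le hP)
  have hsm : ∀ ξ : Lp ℂ 2 μ, AEStronglyMeasurable ξ (μ.map f) := fun ξ =>
    (Lp.aestronglyMeasurable ξ).mono_ac hac
  have hb : ∀ ξ : Lp ℂ 2 μ, eLpNorm (fun x => ξ (f x)) 2 μ ≤
      ENNReal.ofReal (Real.sqrt n) * eLpNorm ξ 2 μ := fun ξ => by
    have h1 : eLpNorm (fun x => ξ (f x)) 2 μ = eLpNorm ξ 2 (μ.map f) :=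
      (eLpNorm_map_measure (hsm ξ) hf).symm
    rw [h1]
    refine (eLpNorm_mono_measure _ h).trans ?_
    rw [eLpNorm_smul_measure_of_ne_top ENNReal.ofNat_ne_top, smul_eq_mul]
    gcongr
    rw [Real.sqrt_eq_rpow, ← ENNReal.ofReal_rpow_of_nonneg (Nat.cast_nonneg n) (by norm_num)]
    simp
  refine exists_clm (fun ξ x => ξ (f x)) (fun ξ => ⟨(hsm ξ).comp_aemeasurable hf, ?_⟩)
    (fun ξ η => hae (Lp.coeFn_add ξ η)) (fun c ξ => hae (Lp.coeFn_smul c ξ)) _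
    (Real.sqrt_nonneg n) hb
  exact (hb ξ).trans_lt (ENNReal.mul_lt_top ENNReal.ofReal_lt_top (Lp.eLpNorm_lt_top ξ))

/-- Multiplication by a bounded function. -/
theorem exists_mulOp {u : X → ℂ} (hu : AEStronglyMeasurable u μ) {C : ℝ} (hC : 0 ≤ C)
    (hb : ∀ᵐ x ∂μ, ‖u x‖ ≤ C) :
    ∃ T : Lp ℂ 2 μ →L[ℂ] Lp ℂ 2 μ, ∀ ξ, T ξ =ᵐ[μ] fun x => u x * ξ x := by
  have hle : ∀ ξ : Lp ℂ 2 μ, eLpNorm (fun x => u x * ξ x) 2 μ ≤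
      ENNReal.ofReal C * eLpNorm ξ 2 μ := fun ξ => by
    refine eLpNorm_le_mul_eLpNorm_of_ae_le_mul ?_ 2
    filter_upwards [hb] with x hx
    rw [norm_mul]
    gcongr
  refine exists_clm (fun ξ x => u x * ξ x)
    (fun ξ => ⟨hu.mul (Lp.aestronglyMeasurable ξ), ?_⟩) (fun ξ η => ?_) (fun c ξ => ?_) C hC hle
  · exact (hle ξ).trans_lt (ENNReal.mul_lt_top ENNReal.ofReal_lt_top (Lp.eLpNorm_lt_top ξ))
  · filter_upwards [Lp.coeFn_add ξ η] with x hx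
    rw [hx, Pi.add_apply, Pi.add_apply, mul_add]
  · filter_upwards [Lp.coeFn_smul c ξ] with x hx
    rw [hx, Pi.smul_apply, Pi.smul_apply, smul_eq_mul, smul_eq_mul, mul_left_comm]

theorem coeFn_finset_sum_two {ι : Type*} (s : Finset ι) (f : ι → Lp ℂ 2 μ) :
    ⇑(∑ i ∈ s, f i) =ᵐ[μ] fun x => ∑ i ∈ s, f i x := by
  classical
  induction s using Finset.induction_on with
  | empty =>
    simp only [Finset.sum_empty]
    exact Lp.coeFn_zero ℂ 2 μ
  | insert i s hi ih =>
    rw [Finset.sum_insert hi]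
    filter_upwards [Lp.coeFn_add (f i) (∑ i ∈ s, f i), ih] with x h1 h2
    rw [h1, Pi.add_apply, h2, Finset.sum_insert hi]

end L2Operators

/-! ### The operators of the transformations and of the functions on `𝒴` -/

section Operators

variable {G : Type*} [Group G] [Countable G] {X : Type*} [MulAction G X] [MeasurableSpace X]
  [MeasurableConstSMul G X] {ν : Measure X} [SMulInvariantMeasure G X ν] {Γ : Subgroup G}
  {F : Set X}

open Schlichting

/-- The operator `ξ ↦ ξ ∘ Γg`; it is the adjoint of the operator of `Γg`. -/
noncomputable def compOp (hg : ∀ᵐ x ∂ν, Good Γ F x) (hFm : MeasurableSet F) (hΓ : AlmostNormal Γ)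
    (g : G) : L2 ν F →L[ℂ] L2 ν F :=
  (exists_compOp (aemeasurable_dotMap hg hFm g) (map_dotMap_le hg hFm hΓ g)).choose

theorem compOp_ae (hg : ∀ᵐ x ∂ν, Good Γ F x) (hFm : MeasurableSet F) (hΓ : AlmostNormal Γ)
    (g : G) (ξ : L2 ν F) :
    compOp hg hFm hΓ g ξ =ᵐ[ν.restrict F] fun x => ξ (dotMap Γ F g x) :=
  (exists_compOp (aemeasurable_dotMap hg hFm g) (map_dotMap_le hg hFm hΓ g)).choose_spec ξ

omit [SMulInvariantMeasure G X ν] in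
theorem exists_mulOp_code (hg : ∀ᵐ x ∂ν, Good Γ F x) (hFm : MeasurableSet F)
    (f : Lp ℂ ∞ ((ν.restrict F).map (code Γ F))) :
    ∃ T : L2 ν F →L[ℂ] L2 ν F, ∀ ξ, T ξ =ᵐ[ν.restrict F] fun x => f (code Γ F x) * ξ x :=
  exists_mulOp ((Lp.aestronglyMeasurable f).comp_aemeasurable (aemeasurable_code hg hFm))
    (norm_nonneg f) (ae_of_ae_map (aemeasurable_code hg hFm) (ae_norm_le f))

omit [Countable G] [MulAction G X] [MeasurableConstSMul G X] [SMulInvariantMeasure G X ν] in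
theorem clm_ext {T T' : L2 ν F →L[ℂ] L2 ν F} (h : ∀ ξ, T ξ =ᵐ[ν.restrict F] T' ξ) : T = T' :=
  ContinuousLinearMap.ext fun ξ => Lp.ext (h ξ)

/-- The representation of `L^∞(𝒴, ν_F)` by multiplication operators. -/
noncomputable def mulRep (hg : ∀ᵐ x ∂ν, Good Γ F x) (hFm : MeasurableSet F) :
    Lp ℂ ∞ ((ν.restrict F).map (code Γ F)) →⋆ₐ[ℂ] (L2 ν F →L[ℂ] L2 ν F) where
  toFun f := (exists_mulOp_code hg hFm f).choose
  map_one' := clm_ext fun ξ => by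
    filter_upwards [(exists_mulOp_code hg hFm 1).choose_spec ξ,
      ae_of_ae_map (aemeasurable_code hg hFm) (coeFn_one (μ := (ν.restrict F).map (code Γ F)))]
      with x h1 h2
    rw [h1, h2, one_mul]
    rfl
  map_mul' f f' := clm_ext fun ξ => by
    filter_upwards [(exists_mulOp_code hg hFm (f * f')).choose_spec ξ,
      (exists_mulOp_code hg hFm f).choose_spec ((exists_mulOp_code hg hFm f').choose ξ),
      (exists_mulOp_code hg hFm f').choose_spec ξ,
      ae_of_ae_map (aemeasurable_code hg hFm) (coeFn_mul f f')] with x h1 h2 h3 h4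
    rw [h1, h4, _root_.mul_apply_eq_comp, h2, h3, Pi.mul_apply, mul_assoc]
  map_zero' := clm_ext fun ξ => by
    filter_upwards [(exists_mulOp_code hg hFm 0).choose_spec ξ, Lp.coeFn_zero ℂ 2 (ν.restrict F),
      ae_of_ae_map (aemeasurable_code hg hFm)
        (Lp.coeFn_zero ℂ ∞ ((ν.restrict F).map (code Γ F)))] with x h1 h2 h3
    rw [h1, h3, _root_.zero_apply, h2, Pi.zero_apply, Pi.zero_apply, zero_mul]
  map_add' f f' := clm_ext fun ξ => by
    filter_upwards [(exists_mulOp_code hg hFm (f + f')).choose_spec ξ,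
      (exists_mulOp_code hg hFm f).choose_spec ξ, (exists_mulOp_code hg hFm f').choose_spec ξ,
      Lp.coeFn_add ((exists_mulOp_code hg hFm f).choose ξ) ((exists_mulOp_code hg hFm f').choose ξ),
      ae_of_ae_map (aemeasurable_code hg hFm) (Lp.coeFn_add f f')] with x h1 h2 h3 h4 h5
    rw [h1, h5, _root_.add_apply, h4, Pi.add_apply, Pi.add_apply, h2, h3, add_mul]
  commutes' c := clm_ext fun ξ => by
    filter_upwards [(exists_mulOp_code hg hFm (algebraMap ℂ _ c)).choose_spec ξ,
      Lp.coeFn_smul c ξ, ae_of_ae_map (aemeasurable_code hg hFm)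
        (Lp.coeFn_smul c (1 : Lp ℂ ∞ ((ν.restrict F).map (code Γ F)))),
      ae_of_ae_map (aemeasurable_code hg hFm)
        (coeFn_one (μ := (ν.restrict F).map (code Γ F)))] with x h1 h2 h3 h4
    rw [h1, Algebra.algebraMap_eq_smul_one, h3, Algebra.algebraMap_eq_smul_one,
      _root_.smul_apply, _root_.one_apply_eq_self, h2, Pi.smul_apply,
      Pi.smul_apply, h4, smul_eq_mul, mul_one, smul_eq_mul]
  map_star' f := by
    rw [ContinuousLinearMap.star_eq_adjoint, ContinuousLinearMap.eq_adjoint_iff]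
    intro ξ η
    rw [L2.inner_def, L2.inner_def]
    refine integral_congr_ae ?_
    filter_upwards [(exists_mulOp_code hg hFm (star f)).choose_spec ξ,
      (exists_mulOp_code hg hFm f).choose_spec η,
      ae_of_ae_map (aemeasurable_code hg hFm) (Lp.coeFn_star f)] with x h1 h2 h3
    rw [h1, h2, h3, Pi.star_apply]
    simp only [RCLike.inner_apply, map_mul, RCLike.star_def, RCLike.conj_conj]
    ring

omit [SMulInvariantMeasure G X ν] in
theorem mulRep_ae (hg : ∀ᵐ x ∂ν, Good Γ F x) (hFm : MeasurableSet F)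
    (f : Lp ℂ ∞ ((ν.restrict F).map (code Γ F))) (ξ : L2 ν F) :
    mulRep hg hFm f ξ =ᵐ[ν.restrict F] fun x => f (code Γ F x) * ξ x :=
  (exists_mulOp_code hg hFm f).choose_spec ξ

omit [SMulInvariantMeasure G X ν] in
open Classical in
theorem mulRep_chi_ae (hg : ∀ᵐ x ∂ν, Good Γ F x) (hFm : MeasurableSet F) {E : Set (YSpace Γ)}
    (hE : MeasurableSet E) (ξ : L2 ν F) :
    mulRep hg hFm (chi _ hE) ξ =ᵐ[ν.restrict F]
      fun x => if code Γ F x ∈ E then ξ x else 0 := by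
  filter_upwards [mulRep_ae hg hFm (chi _ hE) ξ,
    ae_of_ae_map (aemeasurable_code hg hFm) (coeFn_chi hE)] with x h1 h2
  rw [h1, h2]
  by_cases h : code Γ F x ∈ E <;> simp [h]

/-- The operator of `Γg` on its domain of bijectivity labelled by `α` is composition with the
inverse transformation. -/
theorem star_chi_mul_compOp (hg : ∀ᵐ x ∂ν, Good Γ F x) (hFm : MeasurableSet F)
    (hΓ : AlmostNormal Γ) (g : G) {α : G} (hα : α ∈ Γ) :
    star (mulRep hg hFm (chi _ (measurableSet_initialCyl Γ g α)) * compOp hg hFm hΓ g) =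
      mulRep hg hFm (chi _ (measurableSet_finalCyl Γ g α)) * compOp hg hFm hΓ (g⁻¹ * α) := by
  classical
  symm
  rw [ContinuousLinearMap.star_eq_adjoint, ContinuousLinearMap.eq_adjoint_iff]
  intro ξ η
  rw [L2.inner_def, L2.inner_def]
  have hc := aemeasurable_code hg hFm (Γ := Γ)
  have hni : NullMeasurableSet (code Γ F ⁻¹' initialCyl Γ g α) (ν.restrict F) :=
    hc.nullMeasurable (measurableSet_initialCyl _ _ _)
  have hnf : NullMeasurableSet (code Γ F ⁻¹' finalCyl Γ g α) (ν.restrict F) :=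
    hc.nullMeasurable (measurableSet_finalCyl _ _ _)
  have h1 : ∫ x, inner ℂ ((mulRep hg hFm (chi _ (measurableSet_finalCyl Γ g α)) *
      compOp hg hFm hΓ (g⁻¹ * α)) ξ x) (η x) ∂ν.restrict F =
      ∫ x in code Γ F ⁻¹' finalCyl Γ g α, inner ℂ (ξ (dotMap Γ F (g⁻¹ * α) x)) (η x)
        ∂ν.restrict F := by
    rw [← integral_indicator₀ hnf]
    refine integral_congr_ae ?_
    filter_upwards [mulRep_chi_ae hg hFm (measurableSet_finalCyl Γ g α)
      (compOp hg hFm hΓ (g⁻¹ * α) ξ), compOp_ae hg hFm hΓ (g⁻¹ * α) ξ] with x h1 h2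
    rw [_root_.mul_apply_eq_comp, h1, h2, Set.indicator]
    split_ifs with h h' h'
    · rfl
    · exact absurd h h'
    · exact absurd h' h
    · exact inner_zero_left _
  have h2 : ∫ x, inner ℂ (ξ x) ((mulRep hg hFm (chi _ (measurableSet_initialCyl Γ g α)) *
      compOp hg hFm hΓ g) η x) ∂ν.restrict F =
      ∫ x in code Γ F ⁻¹' initialCyl Γ g α, inner ℂ (ξ x) (η (dotMap Γ F g x))
        ∂ν.restrict F := by
    rw [← integral_indicator₀ hni]
    refine integral_congr_ae ?_
    filter_upwards [mulRep_chi_ae hg hFm (measurableSet_initialCyl Γ g α)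
      (compOp hg hFm hΓ g η), compOp_ae hg hFm hΓ g η] with x h1 h2
    rw [_root_.mul_apply_eq_comp, h1, h2, Set.indicator]
    split_ifs with h h' h'
    · rfl
    · exact absurd h h'
    · exact absurd h' h
    · exact inner_zero_right _
  rw [h1, h2, ← map_dotMap_restrict hg hFm g hα, integral_map]
  · refine integral_congr_ae ?_
    filter_upwards [ae_restrict_of_ae (ae_good_restrict hg hFm), ae_restrict_mem₀ hni] with x hx hxi
    rw [hx.2.dotMap_inv_dotMap hx.1 hα hxi]
  · exact (aemeasurable_dotMap hg hFm g).restrict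
  · rw [map_dotMap_restrict hg hFm g hα]
    refine AEStronglyMeasurable.restrict ?_
    refine AEStronglyMeasurable.inner ?_ (Lp.aestronglyMeasurable η)
    exact (Lp.aestronglyMeasurable _).congr (compOp_ae hg hFm hΓ (g⁻¹ * α) ξ)

end Operators

/-! ### The relations between the operators -/

section Relations

variable {G : Type*} [Group G] [Countable G] {X : Type*} [MulAction G X] [MeasurableSpace X]
  [MeasurableConstSMul G X] {ν : Measure X} [SMulInvariantMeasure G X ν] {Γ : Subgroup G}
  {F : Set X}

/-- The operator of the transformation `Γg` on `L²(F, ν)`. -/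
noncomputable def relOp (hg : ∀ᵐ x ∂ν, Good Γ F x) (hFm : MeasurableSet F) (hΓ : AlmostNormal Γ)
    (g : G) : L2 ν F →L[ℂ] L2 ν F :=
  star (compOp hg hFm hΓ g)

theorem compOp_comp_ae (hg : ∀ᵐ x ∂ν, Good Γ F x) (hFm : MeasurableSet F) (hΓ : AlmostNormal Γ)
    (g h : G) (ξ : L2 ν F) :
    compOp hg hFm hΓ g (compOp hg hFm hΓ h ξ) =ᵐ[ν.restrict F]
      fun x => ξ (dotMap Γ F h (dotMap Γ F g x)) := by
  filter_upwards [compOp_ae hg hFm hΓ g (compOp hg hFm hΓ h ξ),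
    ae_dotMap hg hFm (compOp_ae hg hFm hΓ h ξ) g] with x h1 h2
  rw [h1, h2]

theorem compOp_mul_left (hg : ∀ᵐ x ∂ν, Good Γ F x) (hFm : MeasurableSet F) (hΓ : AlmostNormal Γ)
    {γ : G} (hγ : γ ∈ Γ) (g : G) : compOp hg hFm hΓ (γ * g) = compOp hg hFm hΓ g :=
  clm_ext fun ξ => by
    filter_upwards [compOp_ae hg hFm hΓ (γ * g) ξ, compOp_ae hg hFm hΓ g ξ,
      ae_good_restrict hg hFm] with x h1 h2 hx
    rw [h1, h2, hx.2.dotMap_congr hγ]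

theorem compOp_one (hg : ∀ᵐ x ∂ν, Good Γ F x) (hFm : MeasurableSet F) (hΓ : AlmostNormal Γ) :
    compOp hg hFm hΓ 1 = 1 :=
  clm_ext fun ξ => by
    filter_upwards [compOp_ae hg hFm hΓ 1 ξ, ae_good_restrict hg hFm] with x h1 hx
    rw [h1, hx.2.dotMap_one hx.1, one_apply_eq_self]

/-- The composition formula, for the adjoints. -/
theorem compOp_mul_compOp (hg : ∀ᵐ x ∂ν, Good Γ F x) (hFm : MeasurableSet F) (hΓ : AlmostNormal Γ)
    (g₁ g₂ : G) {n : ℕ} {r : Fin n → G} (hr : IsRightTransversal (isot Γ g₁⁻¹) Γ r) :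
    compOp hg hFm hΓ g₂ * compOp hg hFm hΓ g₁ =
      ∑ j, mulRep hg hFm (chi _ (measurableSet_compCyl Γ g₁ (r j) g₂)) *
        compOp hg hFm hΓ (g₁ * r j * g₂) :=
  clm_ext fun ξ => by
    classical
    have h3 : ∀ᵐ x ∂ν.restrict F, ∀ j,
        (mulRep hg hFm (chi _ (measurableSet_compCyl Γ g₁ (r j) g₂)) *
        compOp hg hFm hΓ (g₁ * r j * g₂)) ξ x =
        if code Γ F x ∈ compCyl Γ g₁ (r j) g₂ then ξ (dotMap Γ F (g₁ * r j * g₂) x) else 0 := by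
      refine ae_all_iff.2 fun j => ?_
      filter_upwards [mulRep_chi_ae hg hFm (measurableSet_compCyl Γ g₁ (r j) g₂)
        (compOp hg hFm hΓ (g₁ * r j * g₂) ξ), compOp_ae hg hFm hΓ (g₁ * r j * g₂) ξ] with x h1 h2
      rw [mul_apply_eq_comp, h1, h2]
    rw [_root_.sum_apply]
    filter_upwards [compOp_comp_ae hg hFm hΓ g₂ g₁ ξ, h3, ae_good_restrict hg hFm,
      coeFn_finset_sum_two Finset.univ fun j =>
        (mulRep hg hFm (chi _ (measurableSet_compCyl Γ g₁ (r j) g₂)) *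
        compOp hg hFm hΓ (g₁ * r j * g₂)) ξ] with x h1 h2 hx h4
    rw [mul_apply_eq_comp, h1, h4]
    obtain ⟨j, hj, hu⟩ := existsUnique_mem_compCyl (hx.2.code_mem hx.1) g₂ hr
    rw [Finset.sum_eq_single j, h2, if_pos hj,
      hx.2.dotMap_dotMap_of_mem_compCyl hx.1 (hr.1 j) hj]
    · intro i _ hi
      rw [h2, if_neg fun h => hi (hu i h)]
    · exact fun h => absurd (Finset.mem_univ j) h

/-- Covariance, for the adjoints. -/
theorem compOp_mul_mulRep (hg : ∀ᵐ x ∂ν, Good Γ F x) (hFm : MeasurableSet F)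
    (hΓ : AlmostNormal Γ) (g : G) {f f' : Lp ℂ ∞ ((ν.restrict F).map (code Γ F))}
    (h : ⇑f' =ᵐ[(ν.restrict F).map (code Γ F)] fun y => f (shift Γ g y)) :
    compOp hg hFm hΓ g * mulRep hg hFm f = mulRep hg hFm f' * compOp hg hFm hΓ g :=
  clm_ext fun ξ => by
    filter_upwards [compOp_ae hg hFm hΓ g (mulRep hg hFm f ξ), compOp_ae hg hFm hΓ g ξ,
      ae_dotMap hg hFm (mulRep_ae hg hFm f ξ) g, mulRep_ae hg hFm f' (compOp hg hFm hΓ g ξ),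
      ae_of_ae_map (aemeasurable_code hg hFm) h, ae_good_restrict hg hFm] with x h1 h2 h3 h4 h5 hx
    rw [mul_apply_eq_comp, mul_apply_eq_comp, h1, h3, h4, h2, h5, hx.2.code_dotMap]

omit [SMulInvariantMeasure G X ν] in
theorem star_mulRep_chi (hg : ∀ᵐ x ∂ν, Good Γ F x) (hFm : MeasurableSet F) {E : Set (YSpace Γ)}
    (hE : MeasurableSet E) :
    star (mulRep hg hFm (chi ((ν.restrict F).map (code Γ F)) hE)) =
      mulRep hg hFm (chi ((ν.restrict F).map (code Γ F)) hE) := by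
  rw [← map_star, star_chi]

theorem star_relOp_mul_chi (hg : ∀ᵐ x ∂ν, Good Γ F x) (hFm : MeasurableSet F)
    (hΓ : AlmostNormal Γ) (g : G) {E : Set (YSpace Γ)} (hE : MeasurableSet E) :
    star (relOp hg hFm hΓ g * mulRep hg hFm (chi _ hE)) =
      mulRep hg hFm (chi _ hE) * compOp hg hFm hΓ g := by
  rw [star_mul, star_mulRep_chi, relOp, star_star]

theorem relOp_mul_chi (hg : ∀ᵐ x ∂ν, Good Γ F x) (hFm : MeasurableSet F)
    (hΓ : AlmostNormal Γ) (g : G) {α : G} (hα : α ∈ Γ) :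
    relOp hg hFm hΓ g * mulRep hg hFm (chi _ (measurableSet_initialCyl Γ g α)) =
      mulRep hg hFm (chi _ (measurableSet_finalCyl Γ g α)) * compOp hg hFm hΓ (g⁻¹ * α) := by
  rw [← star_chi_mul_compOp hg hFm hΓ g hα, ← star_relOp_mul_chi, star_star]

theorem chi_mul_compOp_ae (hg : ∀ᵐ x ∂ν, Good Γ F x) (hFm : MeasurableSet F)
    (hΓ : AlmostNormal Γ) (g : G) {E : Set (YSpace Γ)} (hE : MeasurableSet E) (ξ : L2 ν F) :
    (mulRep hg hFm (chi _ hE) * compOp hg hFm hΓ g) ξ =ᵐ[ν.restrict F]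
      (code Γ F ⁻¹' E).indicator fun x => ξ (dotMap Γ F g x) := by
  classical
  filter_upwards [mulRep_chi_ae hg hFm hE (compOp hg hFm hΓ g ξ), compOp_ae hg hFm hΓ g ξ]
    with x h1 h2
  rw [mul_apply_eq_comp, h1, h2, Set.indicator_apply]
  rfl

/-- The operators of the transformations `Γg` satisfy the relations. -/
theorem cosetRelations_relOp (hg : ∀ᵐ x ∂ν, Good Γ F x) (hFm : MeasurableSet F)
    (hΓ : AlmostNormal Γ) :
    CosetRelations Γ ((ν.restrict F).map (code Γ F)) (mulRep hg hFm) (relOp hg hFm hΓ) where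
  coset γ hγ g := by rw [relOp, compOp_mul_left hg hFm hΓ hγ, relOp]
  one := by rw [relOp, compOp_one, star_one]
  composition g₁ g₂ r hr := by
    rw [relOp, relOp, ← star_mul, compOp_mul_compOp hg hFm hΓ g₁ g₂ hr, star_sum]
    refine Finset.sum_congr rfl fun j _ => ?_
    rw [star_mul, star_mulRep_chi, relOp]
  initial g α hα := by
    rw [star_relOp_mul_chi, relOp_mul_chi hg hFm hΓ g hα]
    refine clm_ext fun ξ => ?_
    classical
    filter_upwards [chi_mul_compOp_ae hg hFm hΓ g (measurableSet_initialCyl Γ g α)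
      ((mulRep hg hFm (chi _ (measurableSet_finalCyl Γ g α)) * compOp hg hFm hΓ (g⁻¹ * α)) ξ),
      ae_dotMap hg hFm (chi_mul_compOp_ae hg hFm hΓ (g⁻¹ * α) (measurableSet_finalCyl Γ g α) ξ) g,
      mulRep_chi_ae hg hFm (measurableSet_initialCyl Γ g α) ξ,
      ae_good_restrict hg hFm] with x h1 h2 h3 hx
    rw [mul_apply_eq_comp, h1, h3, Set.indicator_apply, Set.mem_preimage]
    split_ifs with h
    · have h' : code Γ F (dotMap Γ F g x) ∈ finalCyl Γ g α := by
        rw [hx.2.code_dotMap]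
        exact shift_mem_finalCyl (hx.2.code_mem hx.1) hα h
      rw [h2, Set.indicator_of_mem (by exact h'), hx.2.dotMap_inv_dotMap hx.1 hα h]
    · rfl
  final g α hα := by
    rw [star_relOp_mul_chi, relOp_mul_chi hg hFm hΓ g hα]
    refine clm_ext fun ξ => ?_
    classical
    filter_upwards [chi_mul_compOp_ae hg hFm hΓ (g⁻¹ * α) (measurableSet_finalCyl Γ g α)
      ((mulRep hg hFm (chi _ (measurableSet_initialCyl Γ g α)) * compOp hg hFm hΓ g) ξ),
      ae_dotMap hg hFm (chi_mul_compOp_ae hg hFm hΓ g (measurableSet_initialCyl Γ g α) ξ)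
        (g⁻¹ * α),
      mulRep_chi_ae hg hFm (measurableSet_finalCyl Γ g α) ξ,
      ae_good_restrict hg hFm] with x h1 h2 h3 hx
    rw [mul_apply_eq_comp, h1, h3, Set.indicator_apply, Set.mem_preimage]
    split_ifs with h
    · have hy := hx.2.code_mem hx.1
      have h' : code Γ F (dotMap Γ F (g⁻¹ * α) x) ∈ initialCyl Γ g α := by
        rw [hx.2.code_dotMap, ← finalCyl_inv_iff_initialCyl (shift_mem hy _) hα]
        exact shift_mem_finalCyl hy (one_mem _) ((finalCyl_iff_initialCyl hy hα).1 h)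
      rw [h2, Set.indicator_of_mem (by exact h'), hx.2.dotMap_dotMap_inv hx.1 hα h]
    · rfl
  covariance g f f' h := by
    have h' : ⇑(star f') =ᵐ[(ν.restrict F).map (code Γ F)] fun y => (star f) (shift Γ g y) := by
      filter_upwards [h, Lp.coeFn_star f',
        (quasiMeasurePreserving_shift hg hFm g).ae (Lp.coeFn_star f)] with y h1 h2 h3
      rw [h2, h3, Pi.star_apply, Pi.star_apply, h1]
    have := congrArg star (compOp_mul_mulRep hg hFm hΓ g h')
    rwa [star_mul, star_mul, map_star, map_star, star_star, star_star] at this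

end Relations

/-! ### Kernels on the orbit relation -/

/-- In a countably separated space, countably many measurable sets isolate the points of finite
sets. -/
theorem exists_countable_isolating (X : Type*) [MeasurableSpace X]
    [MeasurableSpace.CountablySeparated X] :
    ∃ 𝒜 : Set (Set X), 𝒜.Countable ∧ (∀ E ∈ 𝒜, MeasurableSet E) ∧
      ∀ (x : X) (P : Set X), P.Finite → x ∉ P → ∃ E ∈ 𝒜, x ∈ E ∧ ∀ z ∈ P, z ∉ E := by
  classical
  obtain ⟨S, hSm, hS⟩ := exists_seq_separating X (p := MeasurableSet) MeasurableSet.empty Set.univ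
  have halg := isSetAlgebra_generateSetAlgebra (𝒜 := Set.range S)
  refine ⟨generateSetAlgebra (Set.range S), countable_generateSetAlgebra (Set.countable_range S),
    fun E hE => ?_, fun x P hP hx => ?_⟩
  · have h1 : MeasurableSpace.generateFrom (Set.range S) ≤ ‹MeasurableSpace X› :=
      MeasurableSpace.generateFrom_le (by rintro _ ⟨n, rfl⟩; exact hSm n)
    rw [← generateFrom_generateSetAlgebra_eq] at h1
    exact h1 _ (MeasurableSpace.measurableSet_generateFrom hE)
  · have h : ∀ z ∈ hP.toFinset, ∃ E ∈ generateSetAlgebra (Set.range S), x ∈ E ∧ z ∉ E := by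
      intro z hz
      have hne : x ≠ z := fun e => hx (e ▸ hP.mem_toFinset.1 hz)
      have : ∃ n, ¬(x ∈ S n ↔ z ∈ S n) := by
        by_contra! hcon
        exact hne (hS x trivial z trivial hcon)
      obtain ⟨n, hn⟩ := this
      have hmem : S n ∈ generateSetAlgebra (Set.range S) :=
        self_subset_generateSetAlgebra ⟨n, rfl⟩
      by_cases hxn : x ∈ S n
      · exact ⟨S n, hmem, hxn, fun h => hn ⟨fun _ => h, fun _ => hxn⟩⟩
      · exact ⟨(S n)ᶜ, halg.compl_mem hmem, hxn,
          fun h => hn ⟨fun h' => absurd h' hxn, fun h' => absurd h' h⟩⟩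
    choose! E hE hxE hzE using h
    refine ⟨⋂ z ∈ hP.toFinset, E z, halg.biInter_mem _ hE, Set.mem_iInter₂.2 hxE, fun z hz hmem => ?_⟩
    have hz' := hP.mem_toFinset.2 hz
    exact hzE z hz' (Set.mem_iInter₂.1 hmem z hz')

section Kernels

variable {G : Type*} [Group G] [Countable G] {X : Type*} [MulAction G X] [MeasurableSpace X]
  [MeasurableConstSMul G X] {ν : Measure X} [SMulInvariantMeasure G X ν] {Γ : Subgroup G}
  {F : Set X}

omit [Countable G] [MeasurableConstSMul G X] [SMulInvariantMeasure G X ν] in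
/-- The points of `F` in the orbit of a good point `y` are the `pt Γ F c y`, `c ∈ G / Γ`, so the
operator of a kernel is given by sums over `G / Γ`. -/
theorem isKernelOp_iff (hg : ∀ᵐ x ∂ν, Good Γ F x) {k : X → X → ℂ} {T : L2 ν F →L[ℂ] L2 ν F} :
    IsKernelOp G ν F k T ↔ ∀ ξ : L2 ν F, ∀ᵐ y ∂(ν.restrict F),
      T ξ y = ∑' c, k y (pt Γ F c y) * ξ (pt Γ F c y) := by
  refine forall_congr' fun ξ => ?_
  have h : ∀ᵐ y ∂ν.restrict F,
      ∑' x : {x : X // x ∈ F ∧ x ∈ MulAction.orbit G y}, k y x * ξ x =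
        ∑' c, k y (pt Γ F c y) * ξ (pt Γ F c y) := by
    filter_upwards [ae_restrict_of_ae hg] with y hy
    exact hy.tsum_orbit fun x => k y x * ξ x
  exact ⟨fun h1 => by filter_upwards [h, h1] with y h h1; rw [h1, h],
    fun h1 => by filter_upwards [h, h1] with y h h1; rw [h1, h]⟩

namespace IsKernelOp

variable {k k' : X → X → ℂ} {T T' : L2 ν F →L[ℂ] L2 ν F}

omit [Countable G] [MeasurableConstSMul G X] [SMulInvariantMeasure G X ν] in
/-- An operator is determined by its kernel. -/
theorem unique (h : IsKernelOp G ν F k T) (h' : IsKernelOp G ν F k T') : T = T' :=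
  clm_ext fun ξ => by filter_upwards [h ξ, h' ξ] with y h1 h2; rw [h1, h2]

omit [Countable G] [MeasurableConstSMul G X] [SMulInvariantMeasure G X ν] in
theorem congr (hg : ∀ᵐ x ∂ν, Good Γ F x) (h : IsKernelOp G ν F k T)
    (hk : ∀ᵐ y ∂ν.restrict F, ∀ c, k y (pt Γ F c y) = k' y (pt Γ F c y)) :
    IsKernelOp G ν F k' T := by
  rw [isKernelOp_iff hg] at h ⊢
  intro ξ
  filter_upwards [h ξ, hk] with y h1 h2
  rw [h1]
  exact tsum_congr fun c => by rw [h2]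

omit [Countable G] [MeasurableConstSMul G X] [SMulInvariantMeasure G X ν] in
theorem add (hg : ∀ᵐ x ∂ν, Good Γ F x) (h : IsKernelOp G ν F k T) (h' : IsKernelOp G ν F k' T')
    (hk : ∀ᵐ y ∂ν.restrict F, {c | k y (pt Γ F c y) ≠ 0}.Finite)
    (hk' : ∀ᵐ y ∂ν.restrict F, {c | k' y (pt Γ F c y) ≠ 0}.Finite) :
    IsKernelOp G ν F (fun y x => k y x + k' y x) (T + T') := by
  rw [isKernelOp_iff hg] at h h' ⊢
  intro ξ
  have hs : ∀ (k : X → X → ℂ) y, {c | k y (pt Γ F c y) ≠ 0}.Finite →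
      Summable fun c => k y (pt Γ F c y) * ξ (pt Γ F c y) := fun k y hf =>
    summable_of_hasFiniteSupport (hf.subset fun c hc h0 => hc (by simp only [h0, zero_mul]))
  filter_upwards [h ξ, h' ξ, hk, hk', Lp.coeFn_add (T ξ) (T' ξ)] with y h1 h2 h3 h4 h5
  rw [_root_.add_apply, h5, Pi.add_apply, h1, h2, ← (hs k y h3).tsum_add (hs k' y h4)]
  exact tsum_congr fun c => (add_mul _ _ _).symm

omit [Countable G] [MeasurableConstSMul G X] [SMulInvariantMeasure G X ν] [Group G]
  [MulAction G X] in
theorem smul [Group G] [MulAction G X] (h : IsKernelOp G ν F k T) (a : ℂ) :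
    IsKernelOp G ν F (fun y x => a * k y x) (a • T) := by
  intro ξ
  filter_upwards [h ξ, Lp.coeFn_smul a (T ξ)] with y h1 h2
  rw [_root_.smul_apply, h2, Pi.smul_apply, h1, smul_eq_mul, ← tsum_mul_left]
  exact tsum_congr fun c => (mul_assoc _ _ _).symm

omit [Countable G] [MeasurableConstSMul G X] [SMulInvariantMeasure G X ν] [Group G]
  [MulAction G X] in
theorem zero [Group G] [MulAction G X] : IsKernelOp G ν F (fun _ _ => 0) 0 := by
  intro ξ
  filter_upwards [Lp.coeFn_zero ℂ 2 (ν.restrict F)] with y h1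
  rw [_root_.zero_apply, h1]
  simp

omit [Countable G] [MeasurableConstSMul G X] [SMulInvariantMeasure G X ν] in
theorem sum (hg : ∀ᵐ x ∂ν, Good Γ F x) {ι : Type*} (s : Finset ι) {k : ι → X → X → ℂ}
    {T : ι → L2 ν F →L[ℂ] L2 ν F} (h : ∀ i ∈ s, IsKernelOp G ν F (k i) (T i))
    (hk : ∀ i ∈ s, ∀ᵐ y ∂ν.restrict F, {c | k i y (pt Γ F c y) ≠ 0}.Finite) :
    IsKernelOp G ν F (fun y x => ∑ i ∈ s, k i y x) (∑ i ∈ s, T i) ∧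
      ∀ᵐ y ∂ν.restrict F, {c | ∑ i ∈ s, k i y (pt Γ F c y) ≠ 0}.Finite := by
  classical
  induction s using Finset.induction_on with
  | empty => simpa using zero
  | insert i s hi ih =>
    simp only [Finset.mem_insert, forall_eq_or_imp] at h hk
    obtain ⟨h1, h2⟩ := ih h.2 hk.2
    simp only [Finset.sum_insert hi]
    refine ⟨h.1.add hg h1 hk.1 h2, ?_⟩
    filter_upwards [hk.1, h2] with y h3 h4
    refine (h3.union h4).subset fun c hc => ?_
    by_contra! hcon
    simp only [Set.mem_union, Set.mem_ofPred_eq, not_or, not_not] at hcon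
    exact hc (by rw [hcon.1, hcon.2, add_zero])

theorem compOp_mul (hg : ∀ᵐ x ∂ν, Good Γ F x) (hFm : MeasurableSet F) (hΓ : AlmostNormal Γ)
    (h : IsKernelOp G ν F k T) (g : G) :
    IsKernelOp G ν F (fun y x => k (dotMap Γ F g y) x) (compOp hg hFm hΓ g * T) := by
  intro ξ
  filter_upwards [compOp_ae hg hFm hΓ g (T ξ), ae_dotMap hg hFm (h ξ) g,
    ae_good_restrict hg hFm] with y h1 h2 hy
  have : MulAction.orbit G (dotMap Γ F g y) = MulAction.orbit G y := by
    rw [hy.2.dotMap_eq, pt]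
    exact MulAction.orbit_smul _ _
  rw [mul_apply_eq_comp, h1, h2, this]

theorem mul_mulRep (hg : ∀ᵐ x ∂ν, Good Γ F x) (hFm : MeasurableSet F)
    (h : IsKernelOp G ν F k T) (f : Lp ℂ ∞ ((ν.restrict F).map (code Γ F))) :
    IsKernelOp G ν F (fun y x => k y x * f (code Γ F x)) (T * mulRep hg hFm f) := by
  rw [isKernelOp_iff hg] at h ⊢
  intro ξ
  filter_upwards [h (mulRep hg hFm f ξ), ae_pt hg hFm (mulRep_ae hg hFm f ξ)] with y h1 h2
  rw [mul_apply_eq_comp, h1]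
  exact tsum_congr fun c => by rw [h2, mul_assoc]

/-- A kernel with finite rows is determined, almost everywhere, by its operator: characteristic
functions isolate the points of the rows. -/
theorem ae_eq_zero [MeasurableSpace.CountablySeparated X] (hg : ∀ᵐ x ∂ν, Good Γ F x)
    (hFm : MeasurableSet F) (hFfin : ν F < ∞) (h : IsKernelOp G ν F k 0)
    (hk : ∀ᵐ y ∂ν.restrict F, {c | k y (pt Γ F c y) ≠ 0}.Finite) :
    ∀ᵐ y ∂ν.restrict F, ∀ c, k y (pt Γ F c y) = 0 := by
  classical
  have hcount : Countable (G ⧸ Γ) := Quotient.countable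
  obtain ⟨𝒜, h𝒜, hm, hsep⟩ := exists_countable_isolating X
  rw [isKernelOp_iff hg] at h
  have h1 : ∀ᵐ y ∂ν.restrict F, ∀ E ∈ 𝒜,
      ∑' c, k y (pt Γ F c y) * E.indicator (fun _ => (1 : ℂ)) (pt Γ F c y) = 0 := by
    refine (ae_ball_iff h𝒜).2 fun E hE => ?_
    have hfin : (ν.restrict F) E ≠ ∞ :=
      ((measure_mono (Set.subset_univ _)).trans_lt (by rwa [Measure.restrict_apply_univ])).ne
    filter_upwards [h (indicatorConstLp 2 (hm E hE) hfin 1), Lp.coeFn_zero ℂ 2 (ν.restrict F),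
      ae_pt hg hFm (indicatorConstLp_coeFn (p := 2) (hs := hm E hE) (hμs := hfin) (c := (1 : ℂ)))]
      with y h1 h2 h3
    rw [_root_.zero_apply, h2, Pi.zero_apply] at h1
    rw [h1]
    exact tsum_congr fun c => by rw [h3]
  filter_upwards [h1, hk, ae_good_restrict hg hFm] with y h1 h2 hy c
  by_contra hc
  obtain ⟨E, hE, hcE, hE'⟩ := hsep (pt Γ F c y)
    ((fun d => pt Γ F d y) '' ({d | k y (pt Γ F d y) ≠ 0} \ {c})) (h2.sdiff.image _)
    (by rintro ⟨d, ⟨-, hd⟩, he⟩; exact hd (hy.2.pt_injective he))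
  have := h1 E hE
  rw [tsum_eq_single c, Set.indicator_of_mem hcE, mul_one] at this
  · exact hc this
  · intro d hd
    by_cases h0 : k y (pt Γ F d y) = 0
    · rw [h0, zero_mul]
    · rw [Set.indicator_of_notMem (hE' _ ⟨d, ⟨h0, hd⟩, rfl⟩), mul_zero]

end IsKernelOp

omit [Countable G] [MeasurableConstSMul G X] [SMulInvariantMeasure G X ν] [MeasurableSpace X] in
/-- A kernel supported on the graphs of finitely many of the transformations `Γg` has finite
rows. -/
theorem finite_row (hΓ : AlmostNormal Γ) {y : X} (hy : Good Γ F y) {k : X → X → ℂ} {A : Set G}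
    (hA : A.Finite) (hk : ∀ y x, k y x ≠ 0 → ∃ g ∈ A, ∃ γ ∈ Γ, y = (γ * g) • x) :
    {c | k y (pt Γ F c y) ≠ 0}.Finite := by
  refine (hΓ.finite_smul_image (hA.image fun g => ((g : G) : G ⧸ Γ))).subset fun c hc => ?_
  obtain ⟨g, hg, γ, hγ, h⟩ := hk _ _ hc
  refine ⟨γ, hγ, _, ⟨g, hg, rfl⟩, ?_⟩
  rw [pt, ← mul_smul] at h
  have := hy.free _ h.symm
  rw [mul_inv_eq_one] at this
  rw [smul_coe, this, hy.coe_sec]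

/-- The adjoint of composition with `Γg` sums over the preimages under `Γg`. -/
theorem isKernelOp_relOp (hg : ∀ᵐ x ∂ν, Good Γ F x) (hFm : MeasurableSet F) (hΓ : AlmostNormal Γ)
    (g : G) : IsKernelOp G ν F (graphKernel Γ F g) (relOp hg hFm hΓ g) := by
  classical
  rw [isKernelOp_iff hg]
  intro ξ
  obtain ⟨r, hr⟩ := exists_rightTransversal (hΓ g)
  have hrel := cosetRelations_relOp hg hFm hΓ
  -- the operator is the sum of its restrictions to the domains of bijectivity
  have hT : relOp hg hFm hΓ g = ∑ j,
      mulRep hg hFm (chi _ (measurableSet_finalCyl Γ g (r j))) * compOp hg hFm hΓ (g⁻¹ * r j) := by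
    rw [← star_star (relOp hg hFm hΓ g), hrel.star_eq_sum hΓ (ae_normalizedSections hg hFm) g hr,
      star_sum]
    refine Finset.sum_congr rfl fun j _ => ?_
    rw [star_relOp_mul_chi]
  have h1 : ∀ᵐ y ∂ν.restrict F, ∀ j,
      (mulRep hg hFm (chi _ (measurableSet_finalCyl Γ g (r j))) *
        compOp hg hFm hΓ (g⁻¹ * r j)) ξ y =
      (code Γ F ⁻¹' finalCyl Γ g (r j)).indicator (fun x => ξ (dotMap Γ F (g⁻¹ * r j) x)) y :=
    ae_all_iff.2 fun j => chi_mul_compOp_ae hg hFm hΓ _ (measurableSet_finalCyl Γ g (r j)) ξ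
  rw [hT, _root_.sum_apply]
  filter_upwards [h1, ae_good_restrict hg hFm, coeFn_finset_sum_two Finset.univ fun j =>
    (mulRep hg hFm (chi _ (measurableSet_finalCyl Γ g (r j))) *
      compOp hg hFm hΓ (g⁻¹ * r j)) ξ] with y h1 hy h2
  rw [h2]
  simp only [h1]
  let c : Fin ((isot Γ g).relIndex Γ) → G ⧸ Γ := fun j => (((r j)⁻¹ * g : G) : G ⧸ Γ)
  have hcinj : Function.Injective c := fun i j hij => by
    have hmem : r i * (r j)⁻¹ ∈ isot Γ g := by
      rw [mem_isot_iff_smul]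
      refine ⟨mul_mem (hr.1 i) (inv_mem (hr.1 j)), ?_⟩
      have hij' : (((r j)⁻¹ * g : G) : G ⧸ Γ) = (((r i)⁻¹ * g : G) : G ⧸ Γ) := hij.symm
      rw [mul_smul, smul_coe, hij', smul_coe, mul_inv_cancel_left]
    exact (hr.2 (r i) (hr.1 i)).unique (by rw [mul_inv_cancel]; exact one_mem _) hmem
  rw [← hcinj.tsum_eq (f := fun c => graphKernel Γ F g y (pt Γ F c y) * ξ (pt Γ F c y)),
    tsum_fintype]
  · refine Finset.sum_congr rfl fun j _ => ?_
    have hiff : y ∈ code Γ F ⁻¹' finalCyl Γ g (r j) ↔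
        dotMap Γ F g (pt Γ F (c j) y) = y := by
      rw [hy.2.dotMap_pt_eq_iff hy.1, Set.mem_preimage,
        mem_finalCyl_iff (hy.2.code_mem hy.1) (hr.1 j), code_eq, Schlichting.emb_smul,
        smul_coe_eq_iff, inv_one, one_mul]
    rw [Set.indicator_apply, graphKernel, hy.2.dotMap_eq, mul_inv_rev, inv_inv]
    by_cases h : dotMap Γ F g (pt Γ F (c j) y) = y
    · rw [if_pos h, if_pos (hiff.2 h), one_mul]
    · rw [if_neg h, if_neg (fun h' => h (hiff.1 h')), zero_mul]
  · intro d hd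
    have hd' : dotMap Γ F g (pt Γ F d y) = y := by
      by_contra hcon
      exact hd (by simp only [graphKernel, if_neg hcon, zero_mul])
    rw [hy.2.dotMap_pt_eq_iff hy.1] at hd'
    obtain ⟨j, hj, -⟩ := hr.2 _ (inv_mem hd')
    refine ⟨j, ?_⟩
    have h := (mem_isot_iff_smul.1 hj).2
    rw [mul_smul, inv_smul_eq_iff, smul_coe, smul_coe, inv_mul_cancel_right, hy.2.coe_sec] at h
    exact h

omit [Countable G] [MeasurableSpace X] [MeasurableConstSMul G X] in
theorem graphKernel_ne_zero {g : G} {x y : X} (hx : Good Γ F x) (h : graphKernel Γ F g y x ≠ 0) :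
    ∃ γ ∈ Γ, y = (γ * g) • x := by
  have h' : dotMap Γ F g x = y := by
    by_contra hcon
    exact h (if_neg hcon)
  refine ⟨(sec Γ F x ((g⁻¹ : G) : G ⧸ Γ))⁻¹ * g⁻¹, ?_, ?_⟩
  · exact QuotientGroup.eq.1 (hx.coe_sec ((g⁻¹ : G) : G ⧸ Γ))
  · rw [inv_mul_cancel_right, ← h', hx.dotMap_eq, pt]

omit [Countable G] [MeasurableSpace X] [MeasurableConstSMul G X] in
theorem finite_row_graphKernel (hΓ : AlmostNormal Γ) {y : X} (hy : Good Γ F y) (g : G) :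
    {c | graphKernel Γ F g y (pt Γ F c y) ≠ 0}.Finite := by
  classical
  refine (finite_row hΓ hy (Set.finite_singleton g) (k := fun y x =>
    if Good Γ F x then graphKernel Γ F g y x else 0) fun y x h => ?_).subset fun c hc => ?_
  · by_cases hx : Good Γ F x
    · rw [if_pos hx] at h
      exact ⟨g, rfl, graphKernel_ne_zero hx h⟩
    · exact absurd (if_neg hx) h
  · rwa [Set.mem_ofPred_eq, if_pos (hy.good_pt c)]

theorem isKernelOp_mulRep (hg : ∀ᵐ x ∂ν, Good Γ F x) (hFm : MeasurableSet F)
    (hΓ : AlmostNormal Γ) (f : Lp ℂ ∞ ((ν.restrict F).map (code Γ F))) :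
    IsKernelOp G ν F (diagKernel fun x => f (code Γ F x)) (mulRep hg hFm f) := by
  have h := (isKernelOp_relOp hg hFm hΓ 1).mul_mulRep hg hFm f
  rw [(cosetRelations_relOp hg hFm hΓ).one, one_mul] at h
  refine h.congr hg ?_
  filter_upwards [ae_good_restrict hg hFm] with y hy c
  rw [graphKernel, diagKernel, (hy.2.good_pt c).dotMap_one (hy.2.pt_mem c)]
  split_ifs
  · rw [one_mul]
  · rw [zero_mul]

end Kernels

/-! ### The algebra of the relation -/

section RelationAlgebra

variable {G : Type*} [Group G] [Countable G] {X : Type*} [MulAction G X] [MeasurableSpace X]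
  [MeasurableConstSMul G X] {ν : Measure X} [SMulInvariantMeasure G X ν] {Γ : Subgroup G}
  {F : Set X}

omit [Countable G] [MeasurableSpace X] [MeasurableConstSMul G X] in
theorem Good.dotMap_out_inv {x : X} (hx : Good Γ F x) (c : G ⧸ Γ) :
    dotMap Γ F c.out⁻¹ x = pt Γ F c x := by
  rw [hx.dotMap_eq, inv_inv, QuotientGroup.out_eq']

omit [Countable G] [MeasurableConstSMul G X] [SMulInvariantMeasure G X ν] in
open Classical in
/-- The value at a point of the graph of `Γg` of the kernel of a sum of operators `Γh · f`. -/
theorem sum_graphKernel_mul {x : X} (hx : Good Γ F x)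
    (a : (G ⧸ Γ) →₀ Lp ℂ ∞ ((ν.restrict F).map (code Γ F)))
    (c : G ⧸ Γ) :
    ∑ d ∈ a.support, graphKernel Γ F d.out⁻¹ (pt Γ F c x) x * a d (code Γ F x) =
      if c ∈ a.support then a c (code Γ F x) else 0 := by
  have h : ∀ d, graphKernel Γ F d.out⁻¹ (pt Γ F c x) x = if c = d then 1 else 0 := fun d => by
    rw [graphKernel, hx.dotMap_out_inv]
    exact if_congr (hx.pt_injective.eq_iff.trans eq_comm) rfl rfl
  simp only [h, ite_mul, one_mul, zero_mul, Finset.sum_ite_eq]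

theorem isKernelOp_lam (hg : ∀ᵐ x ∂ν, Good Γ F x) (hFm : MeasurableSet F) (hΓ : AlmostNormal Γ)
    (a : (G ⧸ Γ) →₀ Lp ℂ ∞ ((ν.restrict F).map (code Γ F))) :
    IsKernelOp G ν F
      (fun y x => ∑ d ∈ a.support, graphKernel Γ F d.out⁻¹ y x * a d (code Γ F x))
      (CosetRelations.lam (mulRep hg hFm) (relOp hg hFm hΓ) a) ∧
    ∀ᵐ y ∂ν.restrict F, {c | ∑ d ∈ a.support,
      graphKernel Γ F d.out⁻¹ y (pt Γ F c y) * a d (code Γ F (pt Γ F c y)) ≠ 0}.Finite := by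
  have h : CosetRelations.lam (mulRep hg hFm) (relOp hg hFm hΓ) a =
      ∑ d ∈ a.support, relOp hg hFm hΓ d.out⁻¹ * mulRep hg hFm (a d) := by
    conv_lhs => rw [← Finsupp.sum_single a, Finsupp.sum, map_sum]
    exact Finset.sum_congr rfl fun d _ => CosetRelations.lam_single d (a d)
  rw [h]
  refine IsKernelOp.sum hg a.support
    (k := fun d y x => graphKernel Γ F d.out⁻¹ y x * a d (code Γ F x))
    (fun d _ => (isKernelOp_relOp hg hFm hΓ d.out⁻¹).mul_mulRep hg hFm (a d)) fun d _ => ?_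
  filter_upwards [ae_good_restrict hg hFm] with y hy
  exact (finite_row_graphKernel hΓ hy.2 d.out⁻¹).subset fun c hc h0 =>
    hc (by simp only [h0, zero_mul])

/-- The sums of operators `Γg · f` over distinct cosets have kernels with disjoint supports, so their
coefficients are determined. -/
theorem lam_injective [MeasurableSpace.CountablySeparated X] (hg : ∀ᵐ x ∂ν, Good Γ F x)
    (hFm : MeasurableSet F) (hFfin : ν F < ∞) (hΓ : AlmostNormal Γ) :
    Function.Injective (CosetRelations.lam (mulRep hg hFm) (relOp hg hFm hΓ)) := by
  refine (injective_iff_map_eq_zero _).2 fun a ha => ?_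
  obtain ⟨h1, h2⟩ := isKernelOp_lam hg hFm hΓ a
  rw [ha] at h1
  have h3 := ae_pt hg hFm (h1.ae_eq_zero hg hFm hFfin h2)
  by_contra hne
  obtain ⟨c, hc⟩ := Finsupp.support_nonempty_iff.2 hne
  refine Finsupp.mem_support_iff.1 hc (Lp.ext ?_)
  have hE := Lp.stronglyMeasurable (a c)
  have h4 : ∀ᵐ x ∂ν.restrict F, a c (code Γ F x) = 0 := by
    filter_upwards [h3, ae_good_restrict hg hFm] with x h hx
    have hb : pt Γ F (((sec Γ F x c)⁻¹ : G) : G ⧸ Γ) (pt Γ F c x) = x := by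
      rw [hx.2.pt_pt, smul_coe, mul_inv_cancel, hx.2.pt_one hx.1]
    have := h c (((sec Γ F x c)⁻¹ : G) : G ⧸ Γ)
    rwa [hb, sum_graphKernel_mul hx.2, if_pos hc] at this
  have h5 : ∀ᵐ y ∂(ν.restrict F).map (code Γ F), a c y = 0 :=
    (ae_map_iff (aemeasurable_code hg hFm) (hE.measurable (measurableSet_singleton 0))).2 h4
  filter_upwards [h5, Lp.coeFn_zero ℂ ∞ ((ν.restrict F).map (code Γ F))] with y h6 h7
  rw [h6, h7, Pi.zero_apply]

theorem mulRep_injective [MeasurableSpace.CountablySeparated X] (hg : ∀ᵐ x ∂ν, Good Γ F x)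
    (hFm : MeasurableSet F) (hFfin : ν F < ∞) (hΓ : AlmostNormal Γ) :
    Function.Injective (mulRep hg hFm) := fun f f' h => by
  have hrel := cosetRelations_relOp hg hFm hΓ
  have key := lam_injective hg hFm hFfin hΓ (a₁ := Finsupp.single ((1⁻¹ : G) : G ⧸ Γ) f)
    (a₂ := Finsupp.single ((1⁻¹ : G) : G ⧸ Γ) f')
  rw [hrel.lam_single_coe, hrel.lam_single_coe, h] at key
  exact Finsupp.single_injective _ (key rfl)

/-! ### Functions measurable with respect to the Borel algebra of the relation -/

theorem measurable_relBorel_of_ae_eq (hg : ∀ᵐ x ∂ν, Good Γ F x) (hFm : MeasurableSet F)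
    {u : X → ℂ} {v : YSpace Γ → ℂ} (hv : Measurable v)
    (h : ∀ᵐ x ∂ν.restrict F, u x = v (code Γ F x)) : Measurable[relBorel ν Γ F] u := by
  intro s hs
  refine (measurableSet_relBorel_iff hg hFm _).2 ⟨v ⁻¹' s, hv hs, eventuallyEq_set.2 ?_⟩
  filter_upwards [h] with x hx
  rw [Set.mem_preimage, hx]
  rfl

/-- Functions measurable with respect to `ℬ` are functions of the code, up to null sets. -/
theorem exists_ae_eq_comp_code (hg : ∀ᵐ x ∂ν, Good Γ F x) (hFm : MeasurableSet F)
    {u : X → ℂ} (hu : Measurable[relBorel ν Γ F] u) :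
    ∃ v : YSpace Γ → ℂ, Measurable v ∧ ∀ᵐ x ∂ν.restrict F, u x = v (code Γ F x) := by
  have hc := aemeasurable_code hg hFm (Γ := Γ)
  have hsimple : ∀ s : @SimpleFunc X (relBorel ν Γ F) ℂ, ∃ v : YSpace Γ → ℂ, Measurable v ∧
      ∀ᵐ x ∂ν.restrict F, s x = v (code Γ F x) := by
    intro s
    classical
    choose D hD hsD using fun z : ℂ => (measurableSet_relBorel_iff hg hFm _).1
      (@SimpleFunc.measurableSet_fiber X ℂ (relBorel ν Γ F) s z)
    refine ⟨fun y => ∑ z ∈ @SimpleFunc.range X ℂ (relBorel ν Γ F) s, (D z).indicator (fun _ => z) y,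
      Finset.measurable_sum _ fun z _ => measurable_const.indicator (hD z), ?_⟩
    have h : ∀ᵐ x ∂ν.restrict F, ∀ z ∈ @SimpleFunc.range X ℂ (relBorel ν Γ F) s,
        (s x = z ↔ code Γ F x ∈ D z) :=
      (ae_ball_iff (Finset.countable_toSet _)).2 fun z _ => eventuallyEq_set.1 (hsD z)
    filter_upwards [h] with x hx
    rw [Finset.sum_eq_single (s x)]
    · rw [Set.indicator_of_mem ((hx _ (@SimpleFunc.mem_range_self X ℂ (relBorel ν Γ F) s x)).1 rfl)]
    · intro z hz hne
      rw [Set.indicator_of_notMem fun hm => hne ((hx z hz).2 hm).symm]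
    · exact fun hn => absurd (@SimpleFunc.mem_range_self X ℂ (relBorel ν Γ F) s x) hn
  have hsm := hu.stronglyMeasurable
  choose v hv hsv using fun n => hsimple (hsm.approx n)
  have h1 : ∀ᵐ x ∂ν.restrict F, Tendsto (fun n => v n (code Γ F x)) atTop (𝓝 (u x)) := by
    filter_upwards [ae_all_iff.2 hsv] with x hx
    simpa only [hx] using hsm.tendsto_approx x
  have h2 : ∀ᵐ y ∂(ν.restrict F).map (code Γ F), ∃ l, Tendsto (fun n => v n y) atTop (𝓝 l) :=
    (ae_map_iff hc (measurableSet_exists_tendsto hv)).2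
      (h1.mono fun x hx => ⟨_, hx⟩)
  obtain ⟨w, hw, hlim⟩ := measurable_limit_of_tendsto_metrizable_ae
    (fun n => (hv n).aemeasurable) h2
  refine ⟨w, hw, ?_⟩
  filter_upwards [h1, ae_of_ae_map hc hlim] with x h3 h4
  exact tendsto_nhds_unique h3 h4

omit [Countable G] [MeasurableConstSMul G X] [SMulInvariantMeasure G X ν] in
theorem add_mem_relationAlgebra (hg : ∀ᵐ x ∂ν, Good Γ F x) (hFm : MeasurableSet F)
    (hΓ : AlmostNormal Γ) {T T' : L2 ν F →L[ℂ] L2 ν F} (h : T ∈ relationAlgebra (G := G) ν Γ F)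
    (h' : T' ∈ relationAlgebra ν Γ F) : T + T' ∈ relationAlgebra ν Γ F := by
  classical
  obtain ⟨k, hk, ⟨C, hC⟩, ⟨A, hA⟩, hm⟩ := h
  obtain ⟨k', hk', ⟨C', hC'⟩, ⟨A', hA'⟩, hm'⟩ := h'
  refine ⟨fun y x => k y x + k' y x, hk.add hg hk' ?_ ?_,
    ⟨C + C', fun y x => (norm_add_le _ _).trans (add_le_add (hC y x) (hC' y x))⟩,
    ⟨A ∪ A', fun y x h => ?_⟩, fun g => ?_⟩
  · filter_upwards [ae_good_restrict hg hFm] with y hy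
    exact finite_row hΓ hy.2 A.finite_toSet hA
  · filter_upwards [ae_good_restrict hg hFm] with y hy
    exact finite_row hΓ hy.2 A'.finite_toSet hA'
  · by_cases h0 : k y x = 0
    · obtain ⟨g, hg, hγ⟩ := hA' y x fun h1 => h (by simp only [h0, h1, add_zero])
      exact ⟨g, Finset.mem_union_right _ hg, hγ⟩
    · obtain ⟨g, hg, hγ⟩ := hA y x h0
      exact ⟨g, Finset.mem_union_left _ hg, hγ⟩
  · exact (hm g).add (hm' g)

omit [Countable G] [MeasurableConstSMul G X] [SMulInvariantMeasure G X ν] in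
theorem zero_mem_relationAlgebra : (0 : L2 ν F →L[ℂ] L2 ν F) ∈ relationAlgebra (G := G) ν Γ F :=
  ⟨fun _ _ => 0, IsKernelOp.zero, ⟨0, by simp⟩, ⟨∅, by simp⟩,
    fun _ => @measurable_const _ _ _ (relBorel ν Γ F) _⟩

theorem relOp_mul_mulRep_mem_relationAlgebra (hg : ∀ᵐ x ∂ν, Good Γ F x) (hFm : MeasurableSet F)
    (hΓ : AlmostNormal Γ) (g : G) (f : Lp ℂ ∞ ((ν.restrict F).map (code Γ F))) :
    relOp hg hFm hΓ g * mulRep hg hFm f ∈ relationAlgebra ν Γ F := by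
  classical
  -- a measurable representative of `f` that is bounded everywhere
  let f₀ : YSpace Γ → ℂ := {y | ‖f y‖ ≤ ‖f‖}.indicator f
  have hf₀ : Measurable f₀ := (Lp.stronglyMeasurable f).measurable.indicator
    (measurableSet_le (Lp.stronglyMeasurable f).measurable.norm measurable_const)
  have hf₀b : ∀ y, ‖f₀ y‖ ≤ ‖f‖ := fun y => by
    by_cases hy : y ∈ {y | ‖f y‖ ≤ ‖f‖}
    · rw [show f₀ y = f y from Set.indicator_of_mem hy _]; exact hy
    · rw [show f₀ y = 0 from Set.indicator_of_notMem hy _, norm_zero]; exact norm_nonneg f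
  have hf₀e : ∀ᵐ x ∂ν.restrict F, f (code Γ F x) = f₀ (code Γ F x) := by
    filter_upwards [ae_of_ae_map (aemeasurable_code hg hFm) (ae_norm_le f)] with x hx
    exact (Set.indicator_of_mem (s := {y | ‖f y‖ ≤ ‖f‖}) hx _).symm
  refine ⟨fun y x => if Good Γ F x then graphKernel Γ F g y x * f₀ (code Γ F x) else 0,
    ((isKernelOp_relOp hg hFm hΓ g).mul_mulRep hg hFm f).congr hg ?_, ⟨‖f‖, fun y x => ?_⟩,
    ⟨{g}, fun y x h => ?_⟩, fun h => ?_⟩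
  · filter_upwards [ae_pt hg hFm hf₀e, ae_good_restrict hg hFm] with y h hy c
    rw [if_pos (hy.2.good_pt c), h]
  · simp only [graphKernel]
    split_ifs
    · rw [one_mul]; exact hf₀b _
    · rw [zero_mul, norm_zero]; exact norm_nonneg f
    · rw [norm_zero]; exact norm_nonneg f
  · by_cases hx : Good Γ F x
    · simp only [if_pos hx] at h
      exact ⟨g, Finset.mem_singleton_self g, graphKernel_ne_zero hx (left_ne_zero_of_mul h)⟩
    · exact absurd (if_neg hx) h
  · refine measurable_relBorel_of_ae_eq hg hFm
      (v := if ((g⁻¹ : G) : G ⧸ Γ) = ((h⁻¹ : G) : G ⧸ Γ) then f₀ else 0) ?_ ?_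
    · split_ifs
      · exact hf₀
      · exact measurable_const
    · filter_upwards [ae_good_restrict hg hFm] with x hx
      rw [if_pos hx.2, graphKernel, hx.2.dotMap_eq, hx.2.dotMap_eq]
      simp only [hx.2.pt_injective.eq_iff]
      split_ifs
      · rw [one_mul]
      · rw [zero_mul, Pi.zero_apply]

/-- The algebra of the relation consists of the sums of operators `Γg · f`. -/
theorem range_lam_eq_relationAlgebra (hg : ∀ᵐ x ∂ν, Good Γ F x) (hFm : MeasurableSet F)
    (hΓ : AlmostNormal Γ) :
    Set.range (CosetRelations.lam (mulRep hg hFm) (relOp hg hFm hΓ)) = relationAlgebra ν Γ F := by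
  classical
  apply Set.Subset.antisymm
  · rintro _ ⟨a, rfl⟩
    induction a using Finsupp.induction_linear with
    | zero => rw [map_zero]; exact zero_mem_relationAlgebra
    | add a b ha hb => rw [map_add]; exact add_mem_relationAlgebra hg hFm hΓ ha hb
    | single c f =>
      rw [CosetRelations.lam_single]
      exact relOp_mul_mulRep_mem_relationAlgebra hg hFm hΓ _ f
  · rintro T ⟨k, hk, ⟨C, hC⟩, ⟨A, hA⟩, hm⟩
    have hc := aemeasurable_code hg hFm (Γ := Γ)
    have hf : ∀ c : G ⧸ Γ, ∃ f : Lp ℂ ∞ ((ν.restrict F).map (code Γ F)),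
        ∀ᵐ x ∂ν.restrict F, k (pt Γ F c x) x = f (code Γ F x) := fun c => by
      obtain ⟨v, hv, hkv⟩ := exists_ae_eq_comp_code hg hFm (hm c.out⁻¹)
      have hb : ∀ᵐ y ∂(ν.restrict F).map (code Γ F), ‖v y‖ ≤ C := by
        refine (ae_map_iff hc (measurableSet_le hv.norm measurable_const)).2 ?_
        filter_upwards [hkv] with x hx
        rw [← hx]
        exact hC _ _
      have hmem : MemLp v ∞ ((ν.restrict F).map (code Γ F)) :=
        memLp_top_of_bound hv.aestronglyMeasurable C hb
      refine ⟨hmem.toLp v, ?_⟩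
      filter_upwards [hkv, ae_of_ae_map hc hmem.coeFn_toLp, ae_good_restrict hg hFm]
        with x h1 h2 hx
      rw [h2, ← h1, hx.2.dotMap_out_inv]
    choose f hf using hf
    let a : (G ⧸ Γ) →₀ Lp ℂ ∞ ((ν.restrict F).map (code Γ F)) :=
      Finsupp.onFinset (A.image fun g => ((g⁻¹ : G) : G ⧸ Γ))
        (fun c => if c ∈ A.image fun g => ((g⁻¹ : G) : G ⧸ Γ) then f c else 0)
        fun c h => by_contra fun h' => h (if_neg h')
    refine ⟨a, ((isKernelOp_lam hg hFm hΓ a).1.congr hg ?_).unique hk⟩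
    have hcount : Countable (G ⧸ Γ) := Quotient.countable
    have ha0 : ∀ᵐ x ∂ν.restrict F, (0 : Lp ℂ ∞ ((ν.restrict F).map (code Γ F))) (code Γ F x) = 0 :=
      ae_of_ae_map hc (Lp.coeFn_zero ℂ ∞ _)
    filter_upwards [ae_good_restrict hg hFm, ae_pt hg hFm (ae_all_iff.2 hf), ae_pt hg hFm ha0]
      with y hy h1 h0 d
    -- `y` is the image of `x` under the transformation labelled by `c`
    set x := pt Γ F d y with hxd
    have hx : Good Γ F x := hy.2.good_pt d
    obtain ⟨c, hcy⟩ : ∃ c, pt Γ F c x = y := ⟨(((sec Γ F y d)⁻¹ : G) : G ⧸ Γ), by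
      rw [hxd, hy.2.pt_pt, smul_coe, mul_inv_cancel, hy.2.pt_one hy.1]⟩
    have h2 : ∑ d ∈ a.support, graphKernel Γ F d.out⁻¹ y x * a d (code Γ F x) =
        a c (code Γ F x) := by
      rw [← hcy, sum_graphKernel_mul hx]
      split_ifs with h
      · rfl
      · rw [Finsupp.notMem_support_iff.1 h]
        exact (h0 d).symm
    rw [h2]
    change (if c ∈ A.image fun g => ((g⁻¹ : G) : G ⧸ Γ) then f c else 0 : Lp ℂ ∞ _) _ = _
    split_ifs with h
    · rw [← h1 d c, hcy]
    · by_contra hne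
      have hne' : k y x ≠ 0 := fun h' => hne (by rw [h']; exact h0 d)
      obtain ⟨g, hgA, γ, hγ, hyx⟩ := hA y x hne'
      refine h (Finset.mem_image.2 ⟨g, hgA, ?_⟩)
      refine hx.pt_injective ?_
      change pt Γ F _ x = pt Γ F c x
      rw [hcy, hyx, ← hx.exists_pt_eq (γ * g) (hyx ▸ hy.1), mul_inv_rev,
        coe_mul_of_mem _ (inv_mem hγ)]

end RelationAlgebra

section Cylinders

variable {G : Type*} [Group G] [Countable G] {X : Type*} [MulAction G X] [MeasurableSpace X]
  [MeasurableConstSMul G X] {ν : Measure X} [SMulInvariantMeasure G X ν] {Γ : Subgroup G}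
  {F : Set X}

/-! ### The action of the partial isometries on characteristic functions -/

omit [Countable G] [MeasurableSpace X] [MeasurableConstSMul G X] in
/-- If the bijection `shift Γ g` of the normalized sections in `initialCyl Γ g α` and
`finalCyl Γ g α` matches the subsets `S` and `R`, then so do the transformations of `F`. -/
theorem Good.code_dotMap_mem_iff {x : X} (hx : Good Γ F x) (hxF : x ∈ F) {g α : G} (hα : α ∈ Γ)
    {S R : Set (YSpace Γ)}
    (hSR : ∀ y ∈ normalizedSections Γ, y ∈ initialCyl Γ g α → (y ∈ S ↔ shift Γ g y ∈ R))
    (h : code Γ F x ∈ finalCyl Γ g α) :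
    code Γ F (dotMap Γ F (g⁻¹ * α) x) ∈ initialCyl Γ g α ∧
      (code Γ F (dotMap Γ F (g⁻¹ * α) x) ∈ S ↔ code Γ F x ∈ R) := by
  have hy := hx.code_mem hxF
  have h' : code Γ F (dotMap Γ F (g⁻¹ * α) x) ∈ initialCyl Γ g α := by
    rw [hx.code_dotMap, ← finalCyl_inv_iff_initialCyl (shift_mem hy _) hα]
    exact shift_mem_finalCyl hy (one_mem _) ((finalCyl_iff_initialCyl hy hα).1 h)
  have hz := hx.good_dotMap (g⁻¹ * α)
  refine ⟨h', (hSR _ (hz.code_mem (hx.dotMap_mem _)) h').trans ?_⟩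
  rw [← hz.code_dotMap, hx.dotMap_dotMap_inv hxF hα h]

theorem partial_mul_chi_mul_star (hg : ∀ᵐ x ∂ν, Good Γ F x) (hFm : MeasurableSet F)
    (hΓ : AlmostNormal Γ) {g α : G} (hα : α ∈ Γ) {S R : Set (YSpace Γ)} (hS : MeasurableSet S)
    (hR : MeasurableSet R) (hRf : R ⊆ finalCyl Γ g α)
    (hSR : ∀ y ∈ normalizedSections Γ, y ∈ initialCyl Γ g α → (y ∈ S ↔ shift Γ g y ∈ R)) :
    (relOp hg hFm hΓ g * mulRep hg hFm (chi _ (measurableSet_initialCyl Γ g α))) *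
        mulRep hg hFm (chi _ hS) *
        star (relOp hg hFm hΓ g * mulRep hg hFm (chi _ (measurableSet_initialCyl Γ g α))) =
      mulRep hg hFm (chi _ hR) := by
  classical
  rw [star_relOp_mul_chi, relOp_mul_chi hg hFm hΓ g hα, mul_assoc]
  refine clm_ext fun ξ => ?_
  filter_upwards [chi_mul_compOp_ae hg hFm hΓ (g⁻¹ * α) (measurableSet_finalCyl Γ g α)
      ((mulRep hg hFm (chi _ hS) *
        (mulRep hg hFm (chi _ (measurableSet_initialCyl Γ g α)) * compOp hg hFm hΓ g)) ξ),
    ae_dotMap hg hFm (mulRep_chi_ae hg hFm hS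
      ((mulRep hg hFm (chi _ (measurableSet_initialCyl Γ g α)) * compOp hg hFm hΓ g) ξ))
      (g⁻¹ * α),
    ae_dotMap hg hFm (chi_mul_compOp_ae hg hFm hΓ g (measurableSet_initialCyl Γ g α) ξ)
        (g⁻¹ * α),
    mulRep_chi_ae hg hFm hR ξ, ae_good_restrict hg hFm] with x h1 h2 h3 h4 hx
  rw [mul_apply_eq_comp, h1, h4]
  by_cases h : code Γ F x ∈ finalCyl Γ g α
  · obtain ⟨h5, h6⟩ := hx.2.code_dotMap_mem_iff hx.1 hα hSR h
    rw [Set.indicator_of_mem (by exact h), mul_apply_eq_comp, h2, h3,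
      Set.indicator_of_mem (by exact h5), hx.2.dotMap_dotMap_inv hx.1 hα h]
    exact if_congr h6 rfl rfl
  · rw [Set.indicator_of_notMem (by exact h), if_neg fun h' => h (hRf h')]

theorem partial_indicator_ae (hg : ∀ᵐ x ∂ν, Good Γ F x) (hFm : MeasurableSet F)
    (hΓ : AlmostNormal Γ) {g α : G} (hα : α ∈ Γ) {S R : Set (YSpace Γ)}
    (hRf : R ⊆ finalCyl Γ g α)
    (hSR : ∀ y ∈ normalizedSections Γ, y ∈ initialCyl Γ g α → (y ∈ S ↔ shift Γ g y ∈ R))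
    {ξ : L2 ν F} (hξ : ⇑ξ =ᵐ[ν.restrict F] (code Γ F ⁻¹' S).indicator fun _ => 1) :
    ⇑((relOp hg hFm hΓ g * mulRep hg hFm (chi _ (measurableSet_initialCyl Γ g α))) ξ)
      =ᵐ[ν.restrict F] (code Γ F ⁻¹' R).indicator fun _ => 1 := by
  classical
  rw [relOp_mul_chi hg hFm hΓ g hα]
  filter_upwards [chi_mul_compOp_ae hg hFm hΓ (g⁻¹ * α) (measurableSet_finalCyl Γ g α) ξ,
    ae_dotMap hg hFm hξ (g⁻¹ * α), ae_good_restrict hg hFm] with x h1 h2 hx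
  rw [h1]
  by_cases h : code Γ F x ∈ finalCyl Γ g α
  · obtain ⟨-, h6⟩ := hx.2.code_dotMap_mem_iff hx.1 hα hSR h
    rw [Set.indicator_of_mem (by exact h), h2, Set.indicator_apply, Set.indicator_apply]
    exact if_congr h6 rfl rfl
  · rw [Set.indicator_of_notMem (by exact h), Set.indicator_of_notMem fun h' => h (hRf (by exact h'))]

end Cylinders

/-! ### The pairing of left and right cosets of the compact subgroup -/

section Pairing

variable {G : Type*} [Group G] {Γ : Subgroup G}

open Schlichting

theorem mem_sandwich_iff {a b s : Schlichting Γ} :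
    s ∈ ({a} * (compactSubgroup Γ : Set (Schlichting Γ)) * {b} : Set (Schlichting Γ)) ↔
      a⁻¹ * s * b⁻¹ ∈ compactSubgroup Γ := by
  constructor
  · rintro ⟨_, ⟨_, rfl, k, hk, rfl⟩, _, rfl, rfl⟩
    simpa [mul_assoc] using hk
  · intro h
    exact ⟨_, ⟨_, rfl, _, h, rfl⟩, _, rfl, by simp [mul_assoc]⟩

theorem emb_mem_compactSubgroup {g : G} : emb Γ g ∈ compactSubgroup Γ ↔ g ∈ Γ := by
  rw [mem_compactSubgroup, emb_smul, smul_coe_eq_self_iff]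

theorem ind_left_eq (a : G) :
    ind ({emb Γ a} * (compactSubgroup Γ : Set (Schlichting Γ))) =
      ind ({emb Γ a} * (compactSubgroup Γ : Set (Schlichting Γ)) * {emb Γ 1}) := by
  rw [map_one, Set.singleton_one, mul_one]

theorem ind_right_eq (b : G) :
    ind ((compactSubgroup Γ : Set (Schlichting Γ)) * {emb Γ b}) =
      ind ({emb Γ 1} * (compactSubgroup Γ : Set (Schlichting Γ)) * {emb Γ b}) := by
  rw [map_one, Set.singleton_one, one_mul]

theorem measurableSet_compactSubgroup :
    MeasurableSet (compactSubgroup Γ : Set (Schlichting Γ)) :=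
  isOpen_compactSubgroup.measurableSet

/-- If `t ∈ aK`, then `t⁻¹s ∈ Kb` if and only if `s ∈ aKb`. -/
theorem ind_mul_ind_inv_mul (a b : G) (s t : Schlichting Γ) :
    ind ({emb Γ a} * (compactSubgroup Γ : Set (Schlichting Γ))) t *
        ind ((compactSubgroup Γ : Set (Schlichting Γ)) * {emb Γ b}) (t⁻¹ * s) =
      (((emb Γ a)⁻¹ * ·) ⁻¹' (compactSubgroup Γ : Set (Schlichting Γ))).indicator
        (fun _ => ind ({emb Γ a} * (compactSubgroup Γ : Set (Schlichting Γ)) * {emb Γ b}) s) t := by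
  have h1 : t ∈ ({emb Γ a} * (compactSubgroup Γ : Set (Schlichting Γ)) * {emb Γ 1} : Set _) ↔
      t ∈ ((emb Γ a)⁻¹ * ·) ⁻¹' (compactSubgroup Γ : Set (Schlichting Γ)) := by
    rw [mem_sandwich_iff, map_one, inv_one, mul_one]
    rfl
  rw [ind_left_eq, ind_right_eq]
  by_cases h : t ∈ ((emb Γ a)⁻¹ * ·) ⁻¹' (compactSubgroup Γ : Set (Schlichting Γ))
  · rw [Set.indicator_of_mem h, ind, Set.indicator_of_mem (h1.2 h), one_mul]
    have h2 : t⁻¹ * s ∈ ({emb Γ 1} * (compactSubgroup Γ : Set (Schlichting Γ)) * {emb Γ b} :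
        Set (Schlichting Γ)) ↔
        s ∈ ({emb Γ a} * (compactSubgroup Γ : Set (Schlichting Γ)) * {emb Γ b} :
          Set (Schlichting Γ)) := by
      have h' : (emb Γ a)⁻¹ * t ∈ compactSubgroup Γ := h
      rw [mem_sandwich_iff, mem_sandwich_iff, map_one, inv_one, one_mul,
        ← Subgroup.mul_mem_cancel_left _ h']
      simp [mul_assoc]
    classical
    rw [ind, ind, Set.indicator_apply, Set.indicator_apply]
    exact if_congr h2 rfl rfl
  · rw [Set.indicator_of_notMem h, ind, Set.indicator_of_notMem fun h' => h (h1.1 h'), zero_mul]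

theorem integrable_ind_mul (m : Measure (Schlichting Γ)) [m.IsHaarMeasure]
    (hm : m (compactSubgroup Γ : Set (Schlichting Γ)) = 1) (a b : G) (s : Schlichting Γ) :
    Integrable (fun t => ind ({emb Γ a} * (compactSubgroup Γ : Set (Schlichting Γ))) t *
        ind ((compactSubgroup Γ : Set (Schlichting Γ)) * {emb Γ b}) (t⁻¹ * s)) m := by
  simp only [ind_mul_ind_inv_mul]
  refine (integrable_indicator_iff (measurable_const_mul _ measurableSet_compactSubgroup)).2 ?_
  refine integrableOn_const ?_
  rw [measure_preimage_mul, hm]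
  exact ENNReal.one_ne_top

theorem conv_ind_ind (m : Measure (Schlichting Γ)) [m.IsHaarMeasure]
    (hm : m (compactSubgroup Γ : Set (Schlichting Γ)) = 1) (a b : G) :
    conv m (ind ({emb Γ a} * (compactSubgroup Γ : Set (Schlichting Γ))))
        (ind ((compactSubgroup Γ : Set (Schlichting Γ)) * {emb Γ b})) =
      ind ({emb Γ a} * (compactSubgroup Γ : Set (Schlichting Γ)) * {emb Γ b}) := by
  funext s
  rw [conv]
  simp only [ind_mul_ind_inv_mul]
  rw [integral_indicator_const _ (measurable_const_mul _ measurableSet_compactSubgroup),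
    measureReal_def, measure_preimage_mul, hm, ENNReal.toReal_one, one_smul]

theorem leftCosetSpan_le : leftCosetSpan Γ ≤ sandwichSpan Γ := by
  refine Submodule.span_le.2 ?_
  rintro _ ⟨a, rfl⟩
  simp only [ind_left_eq]
  exact sandwich_mem Γ a 1

theorem rightCosetSpan_le : rightCosetSpan Γ ≤ sandwichSpan Γ := by
  refine Submodule.span_le.2 ?_
  rintro _ ⟨b, rfl⟩
  simp only [ind_right_eq]
  exact sandwich_mem Γ 1 b

end Pairing

section Theta

variable {G : Type*} [Group G] [Countable G] {X : Type*} [MulAction G X] [MeasurableSpace X]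
  [MeasurableConstSMul G X] {ν : Measure X} [SMulInvariantMeasure G X ν] {Γ : Subgroup G}
  {F : Set X}

open Schlichting

omit [Countable G] [MeasurableSpace X] [MeasurableConstSMul G X] in
/-- The action is free, so the sum in `koopmanKernel` has one term. -/
theorem Good.koopmanKernel_pt {y : X} (hy : Good Γ F y) (φ : Schlichting Γ → ℂ) (c : G ⧸ Γ) :
    koopmanKernel φ y (pt Γ F c y) = φ (emb Γ (sec Γ F y c)) := by
  have h : sec Γ F y c • pt Γ F c y = y := smul_inv_smul _ _
  rw [koopmanKernel, tsum_eq_single ⟨sec Γ F y c, h⟩]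
  rintro ⟨θ, hθ⟩ hne
  refine absurd (Subtype.ext ?_) hne
  exact (hy.good_pt c).eq_of_smul_eq (hθ.trans h.symm)

omit [Countable G] [MeasurableSpace X] [MeasurableConstSMul G X] in
/-- The kernel of `(Γg₂)* Γg₁` is that of the function `χ_{g₂⁻¹Kg₁}`. -/
theorem Good.graphKernel_dotMap_pt {y : X} (hy : Good Γ F y) (g₁ g₂ : G) (c : G ⧸ Γ) :
    graphKernel Γ F g₁ (dotMap Γ F g₂ y) (pt Γ F c y) =
      koopmanKernel (ind ({emb Γ g₂⁻¹} * (compactSubgroup Γ : Set (Schlichting Γ)) * {emb Γ g₁}))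
        y (pt Γ F c y) := by
  classical
  rw [hy.koopmanKernel_pt, graphKernel, (hy.good_pt c).dotMap_eq, hy.dotMap_eq, hy.pt_pt, ind,
    Set.indicator_apply]
  refine if_congr ?_ rfl rfl
  rw [hy.pt_injective.eq_iff, smul_coe_eq_iff, mem_sandwich_iff, ← map_inv, ← map_inv, ← map_mul,
    ← map_mul, emb_mem_compactSubgroup]

theorem isKernelOp_star_mul (hg : ∀ᵐ x ∂ν, Good Γ F x) (hFm : MeasurableSet F)
    (hΓ : AlmostNormal Γ) (g₁ g₂ : G) :
    IsKernelOp G ν F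
      (koopmanKernel (ind ({emb Γ g₂⁻¹} * (compactSubgroup Γ : Set (Schlichting Γ)) * {emb Γ g₁})))
      (star (relOp hg hFm hΓ g₂) * relOp hg hFm hΓ g₁) := by
  have h := (isKernelOp_relOp hg hFm hΓ g₁).compOp_mul hg hFm hΓ g₂
  rw [relOp, star_star]
  refine h.congr hg ?_
  filter_upwards [ae_good_restrict hg hFm] with y hy c
  exact hy.2.graphKernel_dotMap_pt g₁ g₂ c

omit [Countable G] [MeasurableConstSMul G X] [SMulInvariantMeasure G X ν] in
theorem IsKernelOp.koopmanKernel_smul (hg : ∀ᵐ x ∂ν, Good Γ F x) (hFm : MeasurableSet F)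
    {φ : Schlichting Γ → ℂ} {T : L2 ν F →L[ℂ] L2 ν F} (h : IsKernelOp G ν F (koopmanKernel φ) T)
    (a : ℂ) : IsKernelOp G ν F (koopmanKernel (a • φ)) (a • T) := by
  refine (h.smul a).congr hg ?_
  filter_upwards [ae_good_restrict hg hFm] with y hy c
  rw [hy.2.koopmanKernel_pt, hy.2.koopmanKernel_pt, Pi.smul_apply, smul_eq_mul]

omit [Countable G] [MeasurableConstSMul G X] [SMulInvariantMeasure G X ν] in
theorem IsKernelOp.koopmanKernel_add (hg : ∀ᵐ x ∂ν, Good Γ F x) (hFm : MeasurableSet F)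
    {φ ψ : Schlichting Γ → ℂ} {T T' : L2 ν F →L[ℂ] L2 ν F}
    (h : IsKernelOp G ν F (koopmanKernel φ) T) (h' : IsKernelOp G ν F (koopmanKernel ψ) T')
    (hφ : ∀ᵐ y ∂ν.restrict F, {c | koopmanKernel φ y (pt Γ F c y) ≠ 0}.Finite)
    (hψ : ∀ᵐ y ∂ν.restrict F, {c | koopmanKernel ψ y (pt Γ F c y) ≠ 0}.Finite) :
    IsKernelOp G ν F (koopmanKernel (φ + ψ)) (T + T') := by
  refine (h.add hg h' hφ hψ).congr hg ?_
  filter_upwards [ae_good_restrict hg hFm] with y hy c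
  simp only [hy.2.koopmanKernel_pt, Pi.add_apply]

theorem exists_isKernelOp_koopmanKernel (hg : ∀ᵐ x ∂ν, Good Γ F x) (hFm : MeasurableSet F)
    (hΓ : AlmostNormal Γ) (φ : Schlichting Γ → ℂ) (hφ : φ ∈ sandwichSpan Γ) :
    (∃ T : L2 ν F →L[ℂ] L2 ν F, IsKernelOp G ν F (koopmanKernel φ) T) ∧
      ∀ᵐ y ∂ν.restrict F, {c | koopmanKernel φ y (pt Γ F c y) ≠ 0}.Finite := by
  induction hφ using Submodule.span_induction with
  | mem _ h =>
    obtain ⟨⟨a, b⟩, rfl⟩ := h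
    refine ⟨⟨star (relOp hg hFm hΓ a⁻¹) * relOp hg hFm hΓ b, ?_⟩, ?_⟩
    · have := isKernelOp_star_mul hg hFm hΓ b a⁻¹
      rwa [inv_inv] at this
    · filter_upwards [ae_good_restrict hg hFm] with y hy
      -- the row at `y` is the row at the image of `y` under the transformation `Γa⁻¹`
      have hz := hy.2.good_pt (a : G ⧸ Γ)
      refine ((finite_row_graphKernel hΓ hz b).image
        fun d => sec Γ F y (a : G ⧸ Γ) • d).subset fun c hc => ?_
      refine ⟨(sec Γ F y (a : G ⧸ Γ))⁻¹ • c, ?_, smul_inv_smul _ _⟩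
      have h := hy.2.graphKernel_dotMap_pt b a⁻¹ c
      rw [inv_inv, hy.2.dotMap_eq, inv_inv] at h
      rw [Set.mem_ofPred_eq, hy.2.pt_pt, smul_inv_smul, h]
      exact hc
  | zero =>
    have h0 : (koopmanKernel (0 : Schlichting Γ → ℂ) : X → X → ℂ) = fun _ _ => 0 := by
      funext y x
      simp only [koopmanKernel, Pi.zero_apply, tsum_zero]
    rw [h0]
    exact ⟨⟨0, IsKernelOp.zero⟩, Eventually.of_forall fun y => by simp⟩
  | add φ ψ _ _ h1 h2 =>
    obtain ⟨⟨T, hT⟩, h1⟩ := h1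
    obtain ⟨⟨T', hT'⟩, h2⟩ := h2
    refine ⟨⟨T + T', hT.koopmanKernel_add hg hFm hT' h1 h2⟩, ?_⟩
    filter_upwards [ae_good_restrict hg hFm, h1, h2] with y hy h3 h4
    refine (h3.union h4).subset fun c hc => ?_
    by_contra! hcon
    simp only [Set.mem_union, Set.mem_ofPred_eq, not_or, not_not] at hcon
    refine hc ?_
    rw [hy.2.koopmanKernel_pt] at hcon ⊢
    rw [hy.2.koopmanKernel_pt] at hcon
    rw [Pi.add_apply, hcon.1, hcon.2, add_zero]
  | smul a φ _ h =>
    obtain ⟨⟨T, hT⟩, h⟩ := h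
    refine ⟨⟨a • T, hT.koopmanKernel_smul hg hFm a⟩, ?_⟩
    filter_upwards [ae_good_restrict hg hFm, h] with y hy h1
    refine h1.subset fun c hc h0 => hc ?_
    rw [hy.2.koopmanKernel_pt] at h0 ⊢
    rw [Pi.smul_apply, h0, smul_zero]

/-- An operator is determined by its kernel, so operators chosen for the kernels of the functions in
the span depend linearly on them. -/
theorem exists_theta (hg : ∀ᵐ x ∂ν, Good Γ F x) (hFm : MeasurableSet F) (hΓ : AlmostNormal Γ) :
    ∃ Θ : sandwichSpan Γ →ₗ[ℂ] (L2 ν F →L[ℂ] L2 ν F), ∀ φ : sandwichSpan Γ,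
      IsKernelOp G ν F (koopmanKernel (φ : Schlichting Γ → ℂ)) (Θ φ) := by
  have h := fun φ : sandwichSpan Γ =>
    exists_isKernelOp_koopmanKernel (ν := ν) hg hFm hΓ (φ : Schlichting Γ → ℂ) φ.2
  choose T hT using fun φ => (h φ).1
  exact ⟨{ toFun := T
           map_add' := fun φ ψ => (hT (φ + ψ)).unique
             ((hT φ).koopmanKernel_add hg hFm (hT ψ) (h φ).2 (h ψ).2)
           map_smul' := fun a φ => (hT (a • φ)).unique ((hT φ).koopmanKernel_smul hg hFm a) }, hT⟩

/-- The map `Θ` is multiplicative on the pairs for which convolution is defined. -/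
theorem theta_conv (hg : ∀ᵐ x ∂ν, Good Γ F x) (hFm : MeasurableSet F) (hΓ : AlmostNormal Γ)
    {Θ : sandwichSpan Γ →ₗ[ℂ] (L2 ν F →L[ℂ] L2 ν F)}
    (hΘ : ∀ g₁ g₂ : G, star (relOp hg hFm hΓ g₂) * relOp hg hFm hΓ g₁ =
      Θ ⟨_, sandwich_mem Γ g₂⁻¹ g₁⟩)
    (m : Measure (Schlichting Γ)) [m.IsHaarMeasure]
    (hm : m (compactSubgroup Γ : Set (Schlichting Γ)) = 1) {φ ψ : Schlichting Γ → ℂ}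
    (hφ : φ ∈ leftCosetSpan Γ) (hψ : ψ ∈ rightCosetSpan Γ) :
    (∀ s, Integrable (fun t => φ t * ψ (t⁻¹ * s)) m) ∧
      ∃ h : conv m φ ψ ∈ sandwichSpan Γ,
        Θ ⟨conv m φ ψ, h⟩ = Θ ⟨φ, leftCosetSpan_le hφ⟩ * Θ ⟨ψ, rightCosetSpan_le hψ⟩ := by
  have hone := (cosetRelations_relOp hg hFm hΓ).one
  have hΘl : ∀ a, Θ ⟨_, leftCosetSpan_le (Submodule.subset_span ⟨a, rfl⟩)⟩ = star (relOp hg hFm hΓ a⁻¹) := fun a => by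
    have h := hΘ 1 a⁻¹
    rw [hone, mul_one] at h
    rw [h]
    congr 2
    simp only [ind_left_eq, inv_inv]
  have hΘr : ∀ b, Θ ⟨_, rightCosetSpan_le (Submodule.subset_span ⟨b, rfl⟩)⟩ = relOp hg hFm hΓ b := fun b => by
    have h := hΘ b 1
    rw [hone, star_one, one_mul] at h
    rw [h]
    congr 2
    simp only [ind_right_eq, inv_one]
  induction hφ, hψ using Submodule.span_induction₂ with
  | mem_mem _ _ h1 h2 =>
    obtain ⟨a, rfl⟩ := h1
    obtain ⟨b, rfl⟩ := h2
    have hc := conv_ind_ind m hm a b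
    refine ⟨integrable_ind_mul m hm a b, hc ▸ sandwich_mem Γ a b, ?_⟩
    have h := hΘ b a⁻¹
    rw [← hΘl, ← hΘr] at h
    rw [h]
    congr 2
    rw [hc, inv_inv]
  | zero_left ψ hψ =>
    have hc : conv m (0 : Schlichting Γ → ℂ) ψ = 0 := by
      funext s
      simp [conv]
    refine ⟨fun s => by simp, by rw [hc]; exact zero_mem _, ?_⟩
    simp only [hc]
    exact (map_zero Θ).trans
      (by rw [show (⟨0, _⟩ : sandwichSpan Γ) = 0 from rfl, map_zero, zero_mul])
  | zero_right φ hφ =>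
    have hc : conv m φ (0 : Schlichting Γ → ℂ) = 0 := by
      funext s
      simp [conv]
    refine ⟨fun s => by simp, by rw [hc]; exact zero_mem _, ?_⟩
    simp only [hc]
    exact (map_zero Θ).trans
      (by rw [show (⟨0, _⟩ : sandwichSpan Γ) = 0 from rfl, map_zero, mul_zero])
  | add_left φ φ' ψ hφ hφ' hψ h1 h2 =>
    obtain ⟨i1, m1, e1⟩ := h1
    obtain ⟨i2, m2, e2⟩ := h2
    have hc : conv m (φ + φ') ψ = conv m φ ψ + conv m φ' ψ := by
      funext s
      simp only [conv, Pi.add_apply, add_mul]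
      exact integral_add (i1 s) (i2 s)
    refine ⟨fun s => ?_, hc ▸ add_mem m1 m2, ?_⟩
    · simp only [Pi.add_apply, add_mul]
      exact (i1 s).add (i2 s)
    · simp only [hc]
      refine (map_add Θ ⟨_, m1⟩ ⟨_, m2⟩).trans ?_
      rw [e1, e2, ← add_mul, ← map_add]
      rfl
  | add_right φ ψ ψ' hφ hψ hψ' h1 h2 =>
    obtain ⟨i1, m1, e1⟩ := h1
    obtain ⟨i2, m2, e2⟩ := h2
    have hc : conv m φ (ψ + ψ') = conv m φ ψ + conv m φ ψ' := by
      funext s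
      simp only [conv, Pi.add_apply, mul_add]
      exact integral_add (i1 s) (i2 s)
    refine ⟨fun s => ?_, hc ▸ add_mem m1 m2, ?_⟩
    · simp only [Pi.add_apply, mul_add]
      exact (i1 s).add (i2 s)
    · simp only [hc]
      refine (map_add Θ ⟨_, m1⟩ ⟨_, m2⟩).trans ?_
      rw [e1, e2, ← mul_add, ← map_add]
      rfl
  | smul_left a φ ψ hφ hψ h =>
    obtain ⟨i1, m1, e1⟩ := h
    have hc : conv m (a • φ) ψ = a • conv m φ ψ := by
      funext s
      simp only [conv, Pi.smul_apply, smul_mul_assoc]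
      exact integral_smul a _
    refine ⟨fun s => ?_, hc ▸ Submodule.smul_mem _ a m1, ?_⟩
    · simp only [Pi.smul_apply, smul_mul_assoc]
      exact (i1 s).smul a
    · simp only [hc]
      refine (map_smul Θ a ⟨_, m1⟩).trans ?_
      rw [e1, ← smul_mul_assoc, ← map_smul]
      rfl
  | smul_right a φ ψ hφ hψ h =>
    obtain ⟨i1, m1, e1⟩ := h
    have hc : conv m φ (a • ψ) = a • conv m φ ψ := by
      funext s
      simp only [conv, Pi.smul_apply, mul_smul_comm]
      exact integral_smul a _
    refine ⟨fun s => ?_, hc ▸ Submodule.smul_mem _ a m1, ?_⟩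
    · simp only [Pi.smul_apply, mul_smul_comm]
      exact (i1 s).smul a
    · simp only [hc]
      refine (map_smul Θ a ⟨_, m1⟩).trans ?_
      rw [e1, ← mul_smul_comm, ← map_smul]
      rfl

end Theta

end CosetAlgebra

theorem theorem4 {G : Type u} [Group G] [Countable G]
    {X : Type v} [MeasurableSpace X] [MeasurableSpace.CountablySeparated X]
    [MulAction G X] [MeasurableConstSMul G X]
    (ν : Measure X) [SigmaFinite ν] [SMulInvariantMeasure G X ν]
    (hfree : ∀ᵐ x ∂ν, ∀ g : G, g • x = x → g = 1)
    (Γ : Subgroup G) (hΓ : AlmostNormal Γ)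
    (F : Set X) (hFm : MeasurableSet F) (hF : IsFundamentalDomain Γ F ν) (hFfin : ν F < ∞) :
    -- the completion `𝒮`, its subgroup `K`, and the Haar measure
    (IsTopologicalGroup (Schlichting Γ) ∧ T2Space (Schlichting Γ) ∧
      LocallyCompactSpace (Schlichting Γ) ∧ TotallyDisconnectedSpace (Schlichting Γ) ∧
      DenseRange (emb Γ) ∧
      IsCompact (compactSubgroup Γ : Set (Schlichting Γ)) ∧
      IsOpen (compactSubgroup Γ : Set (Schlichting Γ)) ∧
      (compactSubgroup Γ : Set (Schlichting Γ)) = cl Γ (Γ : Set G) ∧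
      (∃ e : ProfiniteCompl Γ ≃* compactSubgroup Γ, Continuous e ∧ Continuous e.symm ∧
        ∀ γ : Γ, (e (toProfinite Γ γ) : Schlichting Γ) = emb Γ (γ : G)) ∧
      (∀ s : Schlichting Γ, ∃ g : G, s ∈
        (compactSubgroup Γ : Set (Schlichting Γ)) * {emb Γ g} *
          (compactSubgroup Γ : Set (Schlichting Γ))) ∧
      (∀ g g' : G, emb Γ g' ∈
        (compactSubgroup Γ : Set (Schlichting Γ)) * {emb Γ g} *
          (compactSubgroup Γ : Set (Schlichting Γ)) ↔
        g' ∈ (Γ : Set G) * {g} * (Γ : Set G)) ∧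
      ∃! m : Measure (Schlichting Γ), m.IsHaarMeasure ∧
        m (compactSubgroup Γ : Set (Schlichting Γ)) = 1) ∧
    -- the measure `ν_F` on `𝒴`
    ∃ νF : Measure (YSpace Γ),
      CylinderFormula ν Γ F νF ∧
      (∀ μ : Measure (YSpace Γ), CylinderFormula ν Γ F μ → μ = νF) ∧
      (∀ᵐ y ∂νF, y ∈ normalizedSections Γ) ∧
      -- `F` is coded by `𝒴`; the Borel algebra `ℬ` is that of `(𝒴, ν_F)`
      AEMeasurable (code Γ F) (ν.restrict F) ∧ (ν.restrict F).map (code Γ F) = νF ∧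
      (∀ (g : G), ∀ H ∈ subgroupLattice Γ,
        code Γ F ⁻¹' cyl Γ g (g • (H : Set G)) =ᵐ[ν.restrict F] ((g • (H : Set G)) • F : Set X)) ∧
      (∀ E : Set X, MeasurableSet[relBorel ν Γ F] E ↔
        ∃ D : Set (YSpace Γ), MeasurableSet D ∧ E =ᵐ[ν.restrict F] code Γ F ⁻¹' D) ∧
      -- the transformations of `𝒴`, which depend on the cosets alone
      (∀ g : G, (∀ᵐ x ∂(ν.restrict F), code Γ F (dotMap Γ F g x) = shift Γ g (code Γ F x)) ∧
        ∀ α ∈ Γ,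
          MeasurePreserving (shift Γ g) (νF.restrict (initialCyl Γ g α))
            (νF.restrict (finalCyl Γ g α)) ∧
          Set.BijOn (shift Γ g) (initialCyl Γ g α ∩ normalizedSections Γ)
            (finalCyl Γ g α ∩ normalizedSections Γ)) ∧
      -- the operators of the transformations `Γg`, and `L^∞(𝒴, ν_F)`
      ∃ (T : G → (L2 ν F →L[ℂ] L2 ν F)) (π : Lp ℂ ∞ νF →⋆ₐ[ℂ] (L2 ν F →L[ℂ] L2 ν F)),
        (∀ g, IsKernelOp G ν F (graphKernel Γ F g) (T g)) ∧
        (∀ f, IsKernelOp G ν F (diagKernel fun x => f (code Γ F x)) (π f)) ∧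
        Function.Injective π ∧
        -- generators
        (StarAlgebra.adjoin ℂ (Set.range T ∪ Set.range π) : Set (L2 ν F →L[ℂ] L2 ν F)) =
          relationAlgebra ν Γ F ∧
        -- relations
        CosetRelations Γ νF π T ∧
        -- the relations present the algebra
        (∀ (D : Type w) [Ring D] [StarRing D] [Algebra ℂ D] [StarModule ℂ D]
          (ρ : Lp ℂ ∞ νF →⋆ₐ[ℂ] D) (t : G → D), CosetRelations Γ νF ρ t →
          ∃! Φ : StarAlgebra.adjoin ℂ (Set.range T ∪ Set.range π) →⋆ₐ[ℂ] D,
            (∀ (a : StarAlgebra.adjoin ℂ (Set.range T ∪ Set.range π)) (g : G),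
              (a : L2 ν F →L[ℂ] L2 ν F) = T g → Φ a = t g) ∧
            (∀ (a : StarAlgebra.adjoin ℂ (Set.range T ∪ Set.range π)) (f : Lp ℂ ∞ νF),
              (a : L2 ν F →L[ℂ] L2 ν F) = π f → Φ a = ρ f)) ∧
        -- the action on cylinder sets
        (∀ H ∈ subgroupLattice Γ, ∃ N ∈ subgroupLattice Γ, N ≤ H ∧ (N.subgroupOf Γ).Normal) ∧
        (∀ (g : G) (n : ℕ) (gs : Fin n → G), ∀ Γ₀ ∈ subgroupLattice Γ,
          ∃ Γ' ∈ subgroupLattice Γ, Γ' ≤ isot Γ g ∧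
          ∀ Γ₁ ∈ subgroupLattice Γ, Γ₁ ≤ Γ' → (Γ₁.subgroupOf Γ).Normal →
          ∀ r ∈ isot Γ g, ∀ α ∈ Γ,
            sourceCyl Γ Γ₀ Γ₁ g r α gs ⊆ initialCyl Γ g α ∧
            shift Γ g '' (sourceCyl Γ Γ₀ Γ₁ g r α gs ∩ normalizedSections Γ) =
              targetCyl Γ Γ₀ Γ₁ g r α gs ∩ normalizedSections Γ ∧
            (T g * π (chi νF (measurableSet_initialCyl Γ g α))) *
                π (chi νF (measurableSet_sourceCyl Γ Γ₀ Γ₁ g r α gs)) *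
                star (T g * π (chi νF (measurableSet_initialCyl Γ g α))) =
              π (chi νF (measurableSet_targetCyl Γ Γ₀ Γ₁ g r α gs)) ∧
            ∀ ξ : L2 ν F,
              (⇑ξ =ᵐ[ν.restrict F]
                (code Γ F ⁻¹' sourceCyl Γ Γ₀ Γ₁ g r α gs).indicator fun _ => 1) →
              ⇑((T g * π (chi νF (measurableSet_initialCyl Γ g α))) ξ) =ᵐ[ν.restrict F]
                (code Γ F ⁻¹' targetCyl Γ Γ₀ Γ₁ g r α gs).indicator fun _ => 1) ∧
        -- the pairing of left and right cosets
        ∃ Θ : sandwichSpan Γ →ₗ[ℂ] (L2 ν F →L[ℂ] L2 ν F),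
          (∀ φ : sandwichSpan Γ,
            IsKernelOp G ν F (koopmanKernel (φ : Schlichting Γ → ℂ)) (Θ φ)) ∧
          (∀ g₁ g₂ : G, star (T g₂) * T g₁ = Θ ⟨_, sandwich_mem Γ g₂⁻¹ g₁⟩) ∧
          ∀ m : Measure (Schlichting Γ), m.IsHaarMeasure →
            m (compactSubgroup Γ : Set (Schlichting Γ)) = 1 →
            (∀ a b : G,
              conv m (ind ({emb Γ a} * (compactSubgroup Γ : Set (Schlichting Γ))))
                  (ind ((compactSubgroup Γ : Set (Schlichting Γ)) * {emb Γ b})) =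
                ind ({emb Γ a} * (compactSubgroup Γ : Set (Schlichting Γ)) * {emb Γ b})) ∧
            ∀ φ ∈ leftCosetSpan Γ, ∀ ψ ∈ rightCosetSpan Γ,
              ∃ (hφ : φ ∈ sandwichSpan Γ) (hψ : ψ ∈ sandwichSpan Γ)
                (h : conv m φ ψ ∈ sandwichSpan Γ),
                Θ ⟨conv m φ ψ, h⟩ = Θ ⟨φ, hφ⟩ * Θ ⟨ψ, hψ⟩ := by
  have hg : ∀ᵐ x ∂ν, Good Γ F x := ae_good hfree hF
  have hns := ae_normalizedSections hg hFm
  have hrel := cosetRelations_relOp hg hFm hΓ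
  have hq := quasiMeasurePreserving_shift hg hFm
  refine ⟨⟨inferInstance, inferInstance, Schlichting.locallyCompactSpace hΓ, inferInstance,
    Schlichting.denseRange_emb, ProfiniteCompl.isCompact_compactSubgroup hΓ,
    Schlichting.isOpen_compactSubgroup, Schlichting.coe_compactSubgroup_eq_cl,
    ProfiniteCompl.exists_mulEquiv hΓ, Schlichting.exists_mem_doubleCoset,
    Schlichting.emb_mem_doubleCoset_iff, Schlichting.existsUnique_haar hΓ⟩,
    (ν.restrict F).map (code Γ F), cylinderFormula_map hg hFm,
    fun μ hμ => hμ.unique (cylinderFormula_map hg hFm) hg hFm hFfin, hns,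
    aemeasurable_code hg hFm, rfl, fun g H hH => preimage_cyl_ae_eq hg hFm g hH,
    measurableSet_relBorel_iff hg hFm, fun g => ⟨?_, fun α hα =>
      ⟨measurePreserving_shift hg hFm g hα, shift_bijOn hα⟩⟩,
    relOp hg hFm hΓ, mulRep hg hFm, isKernelOp_relOp hg hFm hΓ, isKernelOp_mulRep hg hFm hΓ,
    mulRep_injective hg hFm hFfin hΓ, ?_, hrel, ?_, fun H hH => hΓ.exists_normal_le hH, ?_, ?_⟩
  · filter_upwards [ae_good_restrict hg hFm] with x hx
    exact hx.2.code_dotMap g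
  · rw [hrel.coe_adjoin_eq_range hΓ hns hq, range_lam_eq_relationAlgebra hg hFm hΓ]
  · intro D _ _ _ _ ρ t ht
    exact hrel.existsUnique_starAlgHom hΓ hns hq (lam_injective hg hFm hFfin hΓ) ht
  · intro g n gs Γ₀ hΓ₀
    obtain ⟨Γ', hΓ', hle', hconj⟩ := exists_conj_le hΓ₀ g gs
    refine ⟨Γ', hΓ', hle', fun Γ₁ hΓ₁ hle hN r hr α hα => ?_⟩
    have hΓ₀' := le_of_mem hΓ₀
    have hconj' := fun i x hx => hconj i x (hle hx)
    have hRf := targetCyl_subset (Γ₀ := Γ₀) (α := α) (hle.trans hle') hr gs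
    have hSR := fun y hy hyi =>
      mem_sourceCyl_iff hΓ₁ hN hΓ₀' hconj' hr hα (y := y) hy hyi
    exact ⟨sourceCyl_subset hΓ₁ (hle.trans hle') hN hr hα gs,
      shift_image_sourceCyl hΓ₁ (hle.trans hle') hN hΓ₀' hconj' hr hα,
      partial_mul_chi_mul_star hg hFm hΓ hα _ _ hRf hSR,
      fun ξ hξ => partial_indicator_ae hg hFm hΓ hα hRf hSR hξ⟩
  · obtain ⟨Θ, hΘ⟩ := exists_theta hg hFm hΓ
    have hΘ' : ∀ g₁ g₂ : G, star (relOp hg hFm hΓ g₂) * relOp hg hFm hΓ g₁ =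
        Θ ⟨_, sandwich_mem Γ g₂⁻¹ g₁⟩ := fun g₁ g₂ =>
      (isKernelOp_star_mul hg hFm hΓ g₁ g₂).unique (hΘ _)
    refine ⟨Θ, hΘ, hΘ', fun m hm hm1 => ⟨conv_ind_ind m hm1, fun φ hφ ψ hψ => ?_⟩⟩
    obtain ⟨-, h, he⟩ := theta_conv hg hFm hΓ hΘ' m hm1 hφ hψ
    exact ⟨leftCosetSpan_le hφ, rightCosetSpan_le hψ, h, he⟩
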